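/- \textbf{Setting.} Let $X$ be a $C^\infty$, real analytic or complex manifold with structure sheaf $\mathcal O_X$ of real or complex valued $C^\infty$, real analytic, respectively holomorphic functions (scalars $K=\mathbb R$ or $\mathbb C$); let $\mathcal T_X$ be the sheaf of $K$-linear derivations of $\mathcal O_X$ (vector fields), $\Omega^k_X$ the sheaf of differential $k$-forms, and $\Omega^{3,cl}_X\subset\Omega^3_X$ the closed $3$-forms. An \emph{exact Courant algebroid} on $X$ is a sheaf of $\mathcal O_X$-modules $\mathcal Q$ with a $K$-bilinear Leibniz bracket $\{\,,\}$, an $\mathcal O_X$-linear anchor $\pi:\mathcal Q\to\mathcal T_X$ which is a map of Leibniz algebras, a symmetric $\mathcal O_X$-bilinear pairing $\langle\,,\rangle:\mathcal Q\times\mathcal Q\to\mathcal O_X$ and an $\mathcal O_X$-linear co-anchor $\pi^\dagger:\Omega^1_X\to\mathcal Q$ such that $\pi\pi^\dagger=0$, $\{q_1,gq_2\}=g\{q_1,q_2\}+\pi(q_1)(g)q_2$, $\langle\{q,q_1\},q_2\rangle+\langle q_1,\{q,q_2\}\rangle=\pi(q)\langle q_1,q_2\rangle$, $\{q,\pi^\dagger\alpha\}=\pi^\dagger(L_{\pi(q)}\alpha)$,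 $\langle q,\pi^\dagger\alpha\rangle=\iota_{\pi(q)}\alpha$, $\{q_1,q_2\}+\{q_2,q_1\}=\pi^\dagger d\langle q_1,q_2\rangle$, and such that $0\to\Omega^1_X\xrightarrow{\pi^\dagger}\mathcal Q\xrightarrow{\pi}\mathcal T_X\to0$ is exact. A morphism is an $\mathcal O_X$-linear map that preserves brackets, anchors and co-anchors. This defines the category $\mathrm{ECA}(X)$. An \emph{$(\Omega^2_X\to\Omega^{3,cl}_X)$-torsor} is an $\Omega^2_X$-torsor $\mathcal C$ (a sheaf) with a map of sheaves $c:\mathcal C\to\Omega^{3,cl}_X$ such that $c(\theta+s)=d\theta+c(s)$; morphisms are equivariant maps of sheaves compatible with $c$. For $\mathcal Q\in\mathrm{ECA}(X)$ let $\mathcal C(\mathcal Q)$ be the sheaf of connections, i.e. of $\mathcal O_X$-linear isotropic splittings $\nabla:\mathcal T_X\to\mathcal Q$ of $\pi$. The form $\theta\in\Omega^2_X$ acts by $\nabla\mapsto\nabla+\pi^\dagger(\iota_{(\cdot)}\theta)$, and the curvature $c(\nabla)$ is given by $\pi^\dagger(\iota_\eta\iota_\xi c(\nabla))=\{\nabla\xi,\nabla\eta\}-\nabla[\xi,\eta]$.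 Let $f:Y\to X$ be a map of manifolds. The inverse image $f^{++}\mathcal Q$ is the quotient of $\Omega^1_Y\oplus(f^*\mathcal Q\times_{f^*\mathcal T_X}\mathcal T_Y)$ by the image of $f^*\Omega^1_X$ under $\gamma\mapsto((df)^\vee\gamma,-f^*(\pi^\dagger)\gamma,0)$, with anchor $(\alpha,u,\xi)\mapsto\xi$, co-anchor $\beta\mapsto(\beta,0,0)$, and, for $(\alpha,\sum_i h_i\otimes q_i,\xi)$ and $(\beta,\sum_k j_k\otimes p_k,\eta)$, pairing $\iota_\xi\beta+\iota_\eta\alpha+\sum_{i,k}h_ij_kf^*\langle q_i,p_k\rangle$ and bracket $$\Big(-\iota_\eta d\alpha+L_\xi\beta+\sum_{i,k}j_kf^*\langle q_i,p_k\rangle\,dh_i,\ \sum_{i,k}h_ij_k\otimes\{q_i,p_k\}-\sum_i\eta(h_i)\otimes q_i+\sum_k\xi(j_k)\otimes p_k,\ [\xi,\eta]\Big).$$ For a torsor $(\mathcal C,c)$ on $X$, $f^*(\mathcal C,c)$ is $\Omega^2_Y\times_{f^{-1}\Omega^2_X}f^{-1}\mathcal C$ (where $(\theta'+f^*\theta,s)\sim(\theta',\theta+s)$)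 with curvature $(\theta',s)\mapsto d\theta'+f^*c(s)$. \textbf{Proposition.} These constructions are well defined functors $(\mathcal C,c):\mathrm{ECA}\to(\Omega^2\to\Omega^{3,cl})\text{-torsors}$ on $X$ and on $Y$, $f^{++}:\mathrm{ECA}(X)\to\mathrm{ECA}(Y)$, and $f^*$ from $(\Omega^2_X\to\Omega^{3,cl}_X)$-torsors to $(\Omega^2_Y\to\Omega^{3,cl}_Y)$-torsors, and the square $$\begin{array}{ccc}\mathrm{ECA}(X)&\xrightarrow{(\mathcal C,c)}&(\Omega^2_X\to\Omega^{3,cl}_X)\text{-torsors}\\ {\scriptstyle f^{++}}\downarrow&&\downarrow{\scriptstyle f^*}\\ \mathrm{ECA}(Y)&\xrightarrow{(\mathcal C,c)}&(\Omega^2_Y\to\Omega^{3,cl}_Y)\text{-torsors}\end{array}$$ commutes up to a natural isomorphism $f^*(\mathcal C(\mathcal Q),c)\cong(\mathcal C(f^{++}\mathcal Q),c)$. This isomorphism sends the class of $(0,\nabla)$ to the connection $f^{++}\nabla:\xi\mapsto(0,f^*(\nabla)(df(\xi)),\xi)$, and $c(f^{++}\nabla)=f^*c(\nabla)$. -/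

import Mathlib

open Filter Topology Manifold CategoryTheory TensorProduct

universe u

noncomputable section

namespace CourantPullback

instance germAlgebra {K : Type} [RCLike K] {X : Type u} (l : Filter X) :
    Algebra K (Germ l K) :=
  Algebra.ofModule
    (fun r a b => by
      induction a using Germ.inductionOn
      induction b using Germ.inductionOn
      exact congrArg _ (funext fun _ => smul_mul_assoc _ _ _))
    (fun r a b => by
      induction a using Germ.inductionOn
      induction b using Germ.inductionOn
      exact congrArg _ (funext fun _ => mul_smul_comm _ _ _))

/-! ### Spaces with a sheaf of `K`-valued functions -/

/-- A sheaf of `K`-algebras of `K`-valued functions on `X`, given by its stalks, which are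
algebras of germs of functions.  A function whose germ at `x` belongs to the stalk at `x`
belongs to the sheaf on a neighbourhood of `x`. -/
structure FunctionSheaf (K : Type) [RCLike K] (X : Type u) [TopologicalSpace X] where
  germs : (x : X) → Subalgebra K (Germ (𝓝 x) K)
  spread : ∀ (x : X) (s : X → K), (s : Germ (𝓝 x) K) ∈ germs x →
    ∀ᶠ z in 𝓝 x, (s : Germ (𝓝 z) K) ∈ germs z

variable {K : Type} [RCLike K] {X Y : Type u} [TopologicalSpace X] [TopologicalSpace Y]

namespace FunctionSheaf

variable (𝒪 : FunctionSheaf K X)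

/-- The stalk at `x` of the structure sheaf. -/
def stalk (x : X) : Type u := 𝒪.germs x

instance (x : X) : CommRing (𝒪.stalk x) := inferInstanceAs (CommRing (𝒪.germs x))
instance (x : X) : Algebra K (𝒪.stalk x) := inferInstanceAs (Algebra K (𝒪.germs x))

/-- The family of germs `g` is, near `x`, the family of germs of one function: `g` is a section
of the structure sheaf on a neighbourhood of `x`. -/
def IsSec (x : X) (g : ∀ z, 𝒪.stalk z) : Prop :=
  ∃ s : X → K, ∀ᶠ z in 𝓝 x, (g z).1 = (s : Germ (𝓝 z) K)

variable {𝒪} in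
lemma IsSec.eventually {x : X} {g : ∀ z, 𝒪.stalk z} (h : 𝒪.IsSec x g) :
    ∀ᶠ z in 𝓝 x, 𝒪.IsSec z g := by
  obtain ⟨s, hs⟩ := h
  filter_upwards [hs.eventually_nhds] with z hz using ⟨s, hz⟩

lemma IsSec.add {𝒪 : FunctionSheaf K X} {x : X} {g h : ∀ z, 𝒪.stalk z}
    (hg : 𝒪.IsSec x g) (hh : 𝒪.IsSec x h) : 𝒪.IsSec x (fun z => g z + h z) := by
  obtain ⟨s, hs⟩ := hg
  obtain ⟨t, ht⟩ := hh
  refine ⟨s + t, ?_⟩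
  filter_upwards [hs, ht] with z h1 h2
  change ((g z).1 : Germ (𝓝 z) K) + (h z).1 = _ 
  rw [h1, h2]
  rfl

lemma IsSec.sub {𝒪 : FunctionSheaf K X} {x : X} {g h : ∀ z, 𝒪.stalk z}
    (hg : 𝒪.IsSec x g) (hh : 𝒪.IsSec x h) : 𝒪.IsSec x (fun z => g z - h z) := by
  obtain ⟨s, hs⟩ := hg
  obtain ⟨t, ht⟩ := hh
  refine ⟨s - t, ?_⟩
  filter_upwards [hs, ht] with z h1 h2
  change ((g z).1 : Germ (𝓝 z) K) - (h z).1 = _ 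
  rw [h1, h2]
  rfl

lemma IsSec.mul {𝒪 : FunctionSheaf K X} {x : X} {g h : ∀ z, 𝒪.stalk z}
    (hg : 𝒪.IsSec x g) (hh : 𝒪.IsSec x h) : 𝒪.IsSec x (fun z => g z * h z) := by
  obtain ⟨s, hs⟩ := hg
  obtain ⟨t, ht⟩ := hh
  refine ⟨s * t, ?_⟩
  filter_upwards [hs, ht] with z h1 h2
  change ((g z).1 : Germ (𝓝 z) K) * (h z).1 = _ 
  rw [h1, h2]
  rfl

lemma isSec_zero (x : X) : 𝒪.IsSec x (fun _ => 0) :=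
  ⟨0, Eventually.of_forall fun _ => rfl⟩

lemma exists_isSec (x : X) (a : 𝒪.stalk x) : ∃ g : ∀ z, 𝒪.stalk z, 𝒪.IsSec x g ∧ g x = a := by
  classical
  obtain ⟨a, ha⟩ := a
  induction a using Germ.inductionOn with
  | _ s =>
    refine ⟨fun z => if h : (s : Germ (𝓝 z) K) ∈ 𝒪.germs z then ⟨s, h⟩ else 0, ⟨s, ?_⟩, ?_⟩
    · filter_upwards [𝒪.spread x s ha] with z hz
      simp [hz]
    · exact dif_pos ha

/-! ### Vector fields -/

/-- The `K`-linear derivations of the stalk at `x`. -/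
abbrev Der (x : X) : Type u := Derivation K (𝒪.stalk x) (𝒪.stalk x)

/-- The family of derivations `D` is, on a neighbourhood of `x`, a derivation of the sheaf. -/
def IsDerSec (x : X) (D : ∀ z, 𝒪.Der z) : Prop :=
  ∀ᶠ z in 𝓝 x, ∀ g, 𝒪.IsSec z g → 𝒪.IsSec z (fun w => D w (g w))

/-- The stalk at `x` of the tangent sheaf, the sheaf of `K`-linear derivations of the structure
sheaf. -/
def vectorFields (x : X) : Submodule (𝒪.stalk x) (𝒪.Der x) where
  carrier := {D | ∃ F : ∀ z, 𝒪.Der z, 𝒪.IsDerSec x F ∧ F x = D}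
  add_mem' := by
    rintro _ _ ⟨F, hF, rfl⟩ ⟨G, hG, rfl⟩
    refine ⟨fun z => F z + G z, ?_, rfl⟩
    filter_upwards [hF, hG] with z h1 h2 g hg
    exact (h1 g hg).add (h2 g hg)
  zero_mem' := ⟨fun _ => 0, Eventually.of_forall fun z _ _ => 𝒪.isSec_zero z, rfl⟩
  smul_mem' := by
    rintro a _ ⟨F, hF, rfl⟩
    obtain ⟨b, hb, rfl⟩ := 𝒪.exists_isSec x a
    refine ⟨fun z => b z • F z, ?_, rfl⟩
    filter_upwards [hF, hb.eventually] with z h1 h2 g hg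
    exact h2.mul (h1 g hg)

/-- The stalk at `x` of the tangent sheaf. -/
def T (x : X) : Type u := 𝒪.vectorFields x

instance (x : X) : AddCommGroup (𝒪.T x) := inferInstanceAs (AddCommGroup (𝒪.vectorFields x))
instance (x : X) : Module (𝒪.stalk x) (𝒪.T x) :=
  inferInstanceAs (Module (𝒪.stalk x) (𝒪.vectorFields x))

/-- The commutator of vector fields. -/
instance (x : X) : Bracket (𝒪.T x) (𝒪.T x) where
  bracket ξ η := ⟨⁅ξ.1, η.1⁆, by
    obtain ⟨_, F, hF, rfl⟩ := ξ
    obtain ⟨_, G, hG, rfl⟩ := η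
    refine ⟨fun z => ⁅F z, G z⁆, ?_, rfl⟩
    filter_upwards [hF, hG] with z h1 h2 g hg
    simp only [Derivation.commutator_apply]
    exact (h1 _ (h2 g hg)).sub (h2 _ (h1 g hg))⟩

/-- `ξ` is a vector field on a neighbourhood of `x`. -/
def IsVectSec (x : X) (ξ : ∀ z, 𝒪.T z) : Prop := 𝒪.IsDerSec x fun z => (ξ z).1

variable {𝒪} {x : X}

/-- The action of a vector field on functions. -/
def act (ξ : 𝒪.T x) (g : 𝒪.stalk x) : 𝒪.stalk x := ξ.1 g

@[simp] lemma act_add_left (ξ η : 𝒪.T x) (g : 𝒪.stalk x) : act (ξ + η) g = act ξ g + act η g := rfl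
@[simp] lemma act_smul_left (a : 𝒪.stalk x) (ξ : 𝒪.T x) (g : 𝒪.stalk x) :
    act (a • ξ) g = a * act ξ g := rfl
@[simp] lemma act_add (ξ : 𝒪.T x) (g h : 𝒪.stalk x) : act ξ (g + h) = act ξ g + act ξ h :=
  map_add ξ.1 g h
@[simp] lemma act_zero (ξ : 𝒪.T x) : act ξ (0 : 𝒪.stalk x) = 0 := map_zero ξ.1
@[simp] lemma act_neg (ξ : 𝒪.T x) (g : 𝒪.stalk x) : act ξ (-g) = -act ξ g :=
  map_neg ξ.1 g
@[simp] lemma act_mul (ξ : 𝒪.T x) (g h : 𝒪.stalk x) :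
    act ξ (g * h) = g * act ξ h + act ξ g * h := by
  simp [act, Derivation.leibniz, mul_comm]

lemma lie_add_left (ξ ξ' η : 𝒪.T x) : ⁅ξ + ξ', η⁆ = ⁅ξ, η⁆ + ⁅ξ', η⁆ :=
  Subtype.ext (add_lie ξ.1 ξ'.1 η.1)
lemma lie_add_right (ξ η η' : 𝒪.T x) : ⁅ξ, η + η'⁆ = ⁅ξ, η⁆ + ⁅ξ, η'⁆ :=
  Subtype.ext (lie_add ξ.1 η.1 η'.1)
lemma lie_self' (ξ : 𝒪.T x) : ⁅ξ, ξ⁆ = 0 := Subtype.ext (lie_self ξ.1)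
lemma lie_neg_swap (ξ η : 𝒪.T x) : ⁅ξ, η⁆ = -⁅η, ξ⁆ :=
  Subtype.ext (lie_skew ξ.1 η.1).symm
lemma lie_smul_right (a : 𝒪.stalk x) (ξ η : 𝒪.T x) : ⁅ξ, a • η⁆ = a • ⁅ξ, η⁆ + act ξ a • η := by
  apply Subtype.ext
  ext g : 1
  change ξ.1 (a * η.1 g) - a * η.1 (ξ.1 g) =
    a * (ξ.1 (η.1 g) - η.1 (ξ.1 g)) +
      ξ.1 a * η.1 g
  rw [Derivation.leibniz]
  simp only [smul_eq_mul]
  ring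
lemma lie_smul_left (a : 𝒪.stalk x) (ξ η : 𝒪.T x) : ⁅a • ξ, η⁆ = a • ⁅ξ, η⁆ - act η a • ξ := by
  rw [lie_neg_swap, lie_smul_right, lie_neg_swap η ξ]
  simp [sub_eq_add_neg, add_comm]

/-! ### Differential forms and the de Rham differential in low degrees -/

variable (𝒪) in
/-- The stalk at `x` of the sheaf of differential `k`-forms. -/
abbrev Form (x : X) (k : ℕ) : Type u := 𝒪.T x [⋀^Fin k]→ₗ[𝒪.stalk x] 𝒪.stalk x

variable (𝒪) in
/-- `ω` is a differential form on a neighbourhood of `x`. -/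
def IsFormSec (x : X) (k : ℕ) (θ : ∀ z, 𝒪.Form z k) : Prop :=
  ∀ᶠ z in 𝓝 x, ∀ ξ : Fin k → ∀ w, 𝒪.T w, (∀ i, 𝒪.IsVectSec z (ξ i)) →
    𝒪.IsSec z (fun w => θ w fun i => ξ i w)

/-- A linear form on vector fields, as a `1`-form. -/
def oneForm (α : 𝒪.T x →ₗ[𝒪.stalk x] 𝒪.stalk x) : 𝒪.Form x 1 :=
  AlternatingMap.ofSubsingleton (𝒪.stalk x) (𝒪.T x) (𝒪.stalk x) (0 : Fin 1) α

/-- `df`, for a function `f`. -/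
def d0 (f : 𝒪.stalk x) : 𝒪.Form x 1 :=
  oneForm { toFun := fun ξ => act ξ f, map_add' := fun _ _ => rfl, map_smul' := fun _ _ => rfl }

lemma map_add_fst {n : ℕ} (θ : 𝒪.Form x (n + 1)) (ξ ξ' : 𝒪.T x) (v : Fin n → 𝒪.T x) :
    θ (Matrix.vecCons (ξ + ξ') v) = θ (Matrix.vecCons ξ v) + θ (Matrix.vecCons ξ' v) :=
  θ.map_vecCons_add v ξ ξ'

lemma map_smul_fst {n : ℕ} (θ : 𝒪.Form x (n + 1)) (a : 𝒪.stalk x) (ξ : 𝒪.T x)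
    (v : Fin n → 𝒪.T x) : θ (Matrix.vecCons (a • ξ) v) = a * θ (Matrix.vecCons ξ v) :=
  θ.map_vecCons_smul v a ξ

lemma form2_self (θ : 𝒪.Form x 2) (ξ : 𝒪.T x) : θ ![ξ, ξ] = 0 :=
  θ.map_eq_zero_of_eq ![ξ, ξ] (i := 0) (j := 1) rfl (by decide)

lemma form2_swap (θ : 𝒪.Form x 2) (ξ η : 𝒪.T x) : θ ![ξ, η] = -θ ![η, ξ] := by
  rw [← θ.map_swap ![η, ξ] (i := 0) (j := 1) (by decide)]
  congr 1
  funext i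
  fin_cases i <;> rfl

lemma form2_add_snd (θ : 𝒪.Form x 2) (ξ η η' : 𝒪.T x) :
    θ ![ξ, η + η'] = θ ![ξ, η] + θ ![ξ, η'] := by
  rw [form2_swap, map_add_fst, form2_swap θ η, form2_swap θ η']
  ring

lemma form2_smul_snd (θ : 𝒪.Form x 2) (a : 𝒪.stalk x) (ξ η : 𝒪.T x) :
    θ ![ξ, a • η] = a * θ ![ξ, η] := by
  rw [form2_swap, map_smul_fst, form2_swap θ η]
  ring

lemma map_neg_fst {n : ℕ} (θ : 𝒪.Form x (n + 1)) (ξ : 𝒪.T x) (v : Fin n → 𝒪.T x) :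
    θ (Matrix.vecCons (-ξ) v) = -θ (Matrix.vecCons ξ v) := by
  have h := map_smul_fst θ (-1) ξ v
  simpa using h

lemma map_zero_fst {n : ℕ} (θ : 𝒪.Form x (n + 1)) (v : Fin n → 𝒪.T x) :
    θ (Matrix.vecCons 0 v) = 0 := by
  simpa using map_smul_fst θ 0 0 v

lemma map_sub_fst {n : ℕ} (θ : 𝒪.Form x (n + 1)) (ξ η : 𝒪.T x) (v : Fin n → 𝒪.T x) :
    θ (Matrix.vecCons (ξ - η) v) = θ (Matrix.vecCons ξ v) - θ (Matrix.vecCons η v) := by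
  rw [sub_eq_add_neg, map_add_fst, map_neg_fst, sub_eq_add_neg]

/-- An alternating bilinear function of two vector fields, as a `2`-form. -/
def mkForm2 (B : 𝒪.T x → 𝒪.T x → 𝒪.stalk x)
    (add : ∀ ξ ξ' η, B (ξ + ξ') η = B ξ η + B ξ' η)
    (smul : ∀ a ξ η, B (a • ξ) η = a * B ξ η)
    (self : ∀ ξ, B ξ ξ = 0) (swap : ∀ ξ η, B ξ η = -B η ξ) : 𝒪.Form x 2 where
  toFun v := B (v 0) (v 1)
  map_update_add' := by
    intro inst v i ξ η
    obtain rfl := Subsingleton.elim inst (instDecidableEqFin 2)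
    fin_cases i
    · simp [add]
    · simp only [Fin.mk_one, Function.update_self, ne_eq, zero_ne_one, not_false_eq_true,
        Function.update_of_ne]
      rw [swap, add, swap ξ, swap η]
      ring
  map_update_smul' := by
    intro inst v i a ξ
    obtain rfl := Subsingleton.elim inst (instDecidableEqFin 2)
    fin_cases i
    · simp [smul]
    · simp only [Fin.mk_one, Function.update_self, ne_eq, zero_ne_one, not_false_eq_true,
        Function.update_of_ne, smul_eq_mul]
      rw [swap, smul, swap ξ]
      ring
  map_eq_zero_of_eq' := by
    intro v i j h hij
    have h01 : v 0 = v 1 := by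
      fin_cases i <;> fin_cases j <;>
        first | exact absurd rfl hij | exact h | exact h.symm
    rw [h01, self]

/-- An alternating trilinear function of three vector fields, as a `3`-form. -/
def mkForm3 (B : 𝒪.T x → 𝒪.T x → 𝒪.T x → 𝒪.stalk x)
    (add : ∀ ξ ξ' η ζ, B (ξ + ξ') η ζ = B ξ η ζ + B ξ' η ζ)
    (smul : ∀ a ξ η ζ, B (a • ξ) η ζ = a * B ξ η ζ)
    (self : ∀ ξ ζ, B ξ ξ ζ = 0) (swap : ∀ ξ η ζ, B ξ η ζ = -B η ξ ζ)
    (swap' : ∀ ξ η ζ, B ξ η ζ = -B ξ ζ η) : 𝒪.Form x 3 where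
  toFun v := B (v 0) (v 1) (v 2)
  map_update_add' := by
    intro inst v i ξ η
    obtain rfl := Subsingleton.elim inst (instDecidableEqFin 3)
    fin_cases i
    · simp [add]
    · simp only [Fin.mk_one, Function.update_self, ne_eq, zero_ne_one, not_false_eq_true,
        Function.update_of_ne, Fin.reduceEq]
      rw [swap, add, swap ξ, swap η]
      ring
    · simp only [Fin.reduceFinMk, Function.update_self, ne_eq, not_false_eq_true,
        Function.update_of_ne, Fin.reduceEq]
      rw [swap', swap, add, swap' _ _ ξ, swap _ ξ, swap' _ _ η, swap _ η]
      ring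
  map_update_smul' := by
    intro inst v i a ξ
    obtain rfl := Subsingleton.elim inst (instDecidableEqFin 3)
    fin_cases i
    · simp [smul]
    · simp only [Fin.mk_one, Function.update_self, ne_eq, zero_ne_one, not_false_eq_true,
        Function.update_of_ne, Fin.reduceEq, smul_eq_mul]
      rw [swap, smul, swap ξ]
      ring
    · simp only [Fin.reduceFinMk, Function.update_self, ne_eq, not_false_eq_true,
        Function.update_of_ne, Fin.reduceEq, smul_eq_mul]
      rw [swap', swap, smul, swap' _ _ ξ, swap _ ξ]
      ring
  map_eq_zero_of_eq' := by
    intro v i j h hij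
    have h12 : ∀ ξ ζ, B ζ ξ ξ = 0 := fun ξ ζ => by rw [swap, swap', self]; simp
    have h02 : ∀ ξ ζ, B ξ ζ ξ = 0 := fun ξ ζ => by rw [swap', self]; simp
    have h3 : v 0 = v 1 ∨ v 0 = v 2 ∨ v 1 = v 2 := by
      fin_cases i <;> fin_cases j <;>
        first
        | exact absurd rfl hij
        | exact Or.inl h
        | exact Or.inl h.symm
        | exact Or.inr (Or.inl h)
        | exact Or.inr (Or.inl h.symm)
        | exact Or.inr (Or.inr h)
        | exact Or.inr (Or.inr h.symm)
    rcases h3 with h3 | h3 | h3 <;> simp only [h3, self, h12, h02]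

/-- The de Rham differential of a `1`-form. -/
def d1 (α : 𝒪.Form x 1) : 𝒪.Form x 2 :=
  mkForm2 (fun ξ η => act ξ (α ![η]) - act η (α ![ξ]) - α ![⁅ξ, η⁆])
    (by
      intro ξ ξ' η
      simp only [lie_add_left, map_add_fst, act_add, act_add_left]
      ring)
    (by
      intro a ξ η
      simp only [lie_smul_left, map_sub_fst, map_smul_fst, act_mul, act_smul_left]
      ring)
    (by
      intro ξ
      rw [lie_self', map_zero_fst]
      ring)
    (by
      intro ξ η
      rw [lie_neg_swap ξ η, map_neg_fst]
      ring)

/-- The de Rham differential of a `2`-form. -/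
def d2 (θ : 𝒪.Form x 2) : 𝒪.Form x 3 :=
  mkForm3
    (fun ξ η ζ => act ξ (θ ![η, ζ]) - act η (θ ![ξ, ζ]) + act ζ (θ ![ξ, η])
      - θ ![⁅ξ, η⁆, ζ] + θ ![⁅ξ, ζ⁆, η] - θ ![⁅η, ζ⁆, ξ])
    (by
      intro ξ ξ' η ζ
      simp only [lie_add_left, map_add_fst, act_add, act_add_left, form2_add_snd]
      ring)
    (by
      intro a ξ η ζ
      simp only [lie_smul_left, map_sub_fst, map_smul_fst, act_mul, act_smul_left,
        form2_smul_snd]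
      ring)
    (by
      intro ξ ζ
      rw [lie_self', map_zero_fst, form2_self, act_zero]
      ring)
    (by
      intro ξ η ζ
      rw [lie_neg_swap ξ η, map_neg_fst, form2_swap θ ξ η, act_neg]
      ring)
    (by
      intro ξ η ζ
      rw [lie_neg_swap ζ η, map_neg_fst, form2_swap θ ζ η, act_neg]
      ring)

/-- A `3`-form is closed if its de Rham differential vanishes. -/
def IsClosedForm (H : 𝒪.Form x 3) : Prop :=
  ∀ ξ₀ ξ₁ ξ₂ ξ₃ : 𝒪.T x,
    act ξ₀ (H ![ξ₁, ξ₂, ξ₃]) - act ξ₁ (H ![ξ₀, ξ₂, ξ₃]) + act ξ₂ (H ![ξ₀, ξ₁, ξ₃])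
      - act ξ₃ (H ![ξ₀, ξ₁, ξ₂])
      - H ![⁅ξ₀, ξ₁⁆, ξ₂, ξ₃] + H ![⁅ξ₀, ξ₂⁆, ξ₁, ξ₃] - H ![⁅ξ₀, ξ₃⁆, ξ₁, ξ₂]
      - H ![⁅ξ₁, ξ₂⁆, ξ₀, ξ₃] + H ![⁅ξ₁, ξ₃⁆, ξ₀, ξ₂] - H ![⁅ξ₂, ξ₃⁆, ξ₀, ξ₁] = 0

/-- The interior product `ι_ξ`. -/
def contract {k : ℕ} (ξ : 𝒪.T x) (θ : 𝒪.Form x (k + 1)) : 𝒪.Form x k := θ.curryLeft ξ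

/-- The Lie derivative of a `1`-form, by Cartan's formula `L_ξ = ι_ξ d + d ι_ξ`. -/
def lieDeriv (ξ : 𝒪.T x) (α : 𝒪.Form x 1) : 𝒪.Form x 1 :=
  contract ξ (d1 α) + d0 (α ![ξ])

end FunctionSheaf

open FunctionSheaf

/-! ### Sheaves given by their stalks -/

/-- A sheaf of sets on `X` with stalks `S x`, where `IsSec x s` says that the family of elements
`s` is a section of the sheaf on a neighbourhood of `x`: being a section near a point is an open
and local condition, every element of a stalk extends to a section near the point, and two
sections with the same value at a point agree near the point. -/
structure IsSheaf (S : X → Type u) (IsSec : X → (∀ z, S z) → Prop) : Prop where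
  isOpen : ∀ x s, IsSec x s → ∀ᶠ z in 𝓝 x, IsSec z s
  congr : ∀ x s t, IsSec x s → (∀ᶠ z in 𝓝 x, s z = t z) → IsSec x t
  extend : ∀ x (a : S x), ∃ s, IsSec x s ∧ s x = a
  separated : ∀ x s t, IsSec x s → IsSec x t → s x = t x → ∀ᶠ z in 𝓝 x, s z = t z

/-! ### Courant algebroids -/

/-- The data of a Courant algebroid, given on stalks. -/
structure CourantData (𝒪 : FunctionSheaf K X) where
  stalk : X → Type u
  [addCommGroup : ∀ x, AddCommGroup (stalk x)]
  [module : ∀ x, Module (𝒪.stalk x) (stalk x)]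
  IsSec : X → (∀ z, stalk z) → Prop
  bracket : ∀ {x}, stalk x → stalk x → stalk x
  pairing : ∀ {x}, stalk x → stalk x → 𝒪.stalk x
  anchor : ∀ x, stalk x →ₗ[𝒪.stalk x] 𝒪.T x
  coanchor : ∀ x, 𝒪.Form x 1 →ₗ[𝒪.stalk x] stalk x

attribute [instance] CourantData.addCommGroup CourantData.module

/-- The axioms of a Courant algebroid: `Q` is a sheaf of modules, all operations are morphisms of
sheaves, the bracket is a `K`-bilinear Leibniz bracket, and the compatibilities hold. -/
structure CourantData.IsCourant {𝒪 : FunctionSheaf K X} (Q : CourantData 𝒪) : Prop where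
  isSheaf : IsSheaf Q.stalk Q.IsSec
  add_sec : ∀ x s t, Q.IsSec x s → Q.IsSec x t → Q.IsSec x fun z => s z + t z
  smul_sec : ∀ x g s, 𝒪.IsSec x g → Q.IsSec x s → Q.IsSec x fun z => g z • s z
  bracket_sec : ∀ x s t, Q.IsSec x s → Q.IsSec x t → Q.IsSec x fun z => Q.bracket (s z) (t z)
  pairing_sec : ∀ x s t, Q.IsSec x s → Q.IsSec x t → 𝒪.IsSec x fun z => Q.pairing (s z) (t z)
  anchor_sec : ∀ x s, Q.IsSec x s → 𝒪.IsVectSec x fun z => Q.anchor z (s z)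
  coanchor_sec : ∀ x α, 𝒪.IsFormSec x 1 α → Q.IsSec x fun z => Q.coanchor z (α z)
  bracket_add_left : ∀ x (p q r : Q.stalk x),
    Q.bracket (p + q) r = Q.bracket p r + Q.bracket q r
  bracket_add_right : ∀ x (p q r : Q.stalk x),
    Q.bracket p (q + r) = Q.bracket p q + Q.bracket p r
  bracket_const_left : ∀ x (c : K) (p q : Q.stalk x),
    Q.bracket (algebraMap K (𝒪.stalk x) c • p) q = algebraMap K (𝒪.stalk x) c • Q.bracket p q
  bracket_const_right : ∀ x (c : K) (p q : Q.stalk x),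
    Q.bracket p (algebraMap K (𝒪.stalk x) c • q) = algebraMap K (𝒪.stalk x) c • Q.bracket p q
  bracket_bracket : ∀ x (p q r : Q.stalk x),
    Q.bracket p (Q.bracket q r) = Q.bracket (Q.bracket p q) r + Q.bracket q (Q.bracket p r)
  pairing_add_left : ∀ x (p q r : Q.stalk x),
    Q.pairing (p + q) r = Q.pairing p r + Q.pairing q r
  pairing_smul_left : ∀ x (g : 𝒪.stalk x) (p q : Q.stalk x),
    Q.pairing (g • p) q = g * Q.pairing p q
  pairing_comm : ∀ x (p q : Q.stalk x), Q.pairing p q = Q.pairing q p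
  anchor_bracket : ∀ x (p q : Q.stalk x),
    Q.anchor x (Q.bracket p q) = ⁅Q.anchor x p, Q.anchor x q⁆
  anchor_coanchor : ∀ x (α : 𝒪.Form x 1), Q.anchor x (Q.coanchor x α) = 0
  bracket_smul : ∀ x (g : 𝒪.stalk x) (p q : Q.stalk x),
    Q.bracket p (g • q) = g • Q.bracket p q + act (Q.anchor x p) g • q
  pairing_invariant : ∀ x (p q r : Q.stalk x),
    Q.pairing (Q.bracket p q) r + Q.pairing q (Q.bracket p r) = act (Q.anchor x p) (Q.pairing q r)
  bracket_coanchor : ∀ x (p : Q.stalk x) (α : 𝒪.Form x 1),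
    Q.bracket p (Q.coanchor x α) = Q.coanchor x (lieDeriv (Q.anchor x p) α)
  pairing_coanchor : ∀ x (p : Q.stalk x) (α : 𝒪.Form x 1),
    Q.pairing p (Q.coanchor x α) = α ![Q.anchor x p]
  bracket_symm : ∀ x (p q : Q.stalk x),
    Q.bracket p q + Q.bracket q p = Q.coanchor x (d0 (Q.pairing p q))

/-- An exact Courant algebroid: the sequence `0 → Ω¹ → Q → T → 0` is exact. -/
structure CourantData.IsExactCourant {𝒪 : FunctionSheaf K X} (Q : CourantData 𝒪) : Prop
    extends Q.IsCourant where
  coanchor_injective : ∀ x, Function.Injective (Q.coanchor x)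
  ker_anchor : ∀ x, LinearMap.ker (Q.anchor x) = LinearMap.range (Q.coanchor x)
  anchor_surjective : ∀ x, Function.Surjective (Q.anchor x)

/-- Exact Courant algebroids. -/
structure ECA (𝒪 : FunctionSheaf K X) extends CourantData 𝒪 where
  isExact : toCourantData.IsExactCourant

/-- A morphism of Courant algebroids: a morphism of sheaves of modules compatible with the
brackets, the anchors and the co-anchors. -/
structure IsCourantHom {𝒪 : FunctionSheaf K X} (Q P : CourantData 𝒪)
    (φ : ∀ x, Q.stalk x →ₗ[𝒪.stalk x] P.stalk x) : Prop where
  map_sec : ∀ x s, Q.IsSec x s → P.IsSec x fun z => φ z (s z)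
  map_bracket : ∀ x (p q : Q.stalk x), φ x (Q.bracket p q) = P.bracket (φ x p) (φ x q)
  map_anchor : ∀ x (p : Q.stalk x), P.anchor x (φ x p) = Q.anchor x p
  map_coanchor : ∀ x (α : 𝒪.Form x 1), φ x (Q.coanchor x α) = P.coanchor x α

/-- A morphism of exact Courant algebroids. -/
@[ext]
structure ECA.Hom {𝒪 : FunctionSheaf K X} (Q P : ECA 𝒪) where
  toFun : ∀ x, Q.stalk x →ₗ[𝒪.stalk x] P.stalk x
  isHom : IsCourantHom Q.toCourantData P.toCourantData toFun

instance (𝒪 : FunctionSheaf K X) : Category (ECA 𝒪) where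
  Hom Q P := ECA.Hom Q P
  id Q := ⟨fun _ => LinearMap.id, ⟨fun _ _ h => h, fun _ _ _ => rfl, fun _ _ => rfl,
    fun _ _ => rfl⟩⟩
  comp φ ψ := ⟨fun x => ψ.toFun x ∘ₗ φ.toFun x,
    ⟨fun x s h => ψ.isHom.map_sec x _ (φ.isHom.map_sec x s h),
     fun x p q => by simp [φ.isHom.map_bracket, ψ.isHom.map_bracket],
     fun x p => by simp [φ.isHom.map_anchor, ψ.isHom.map_anchor],
     fun x α => by simp [φ.isHom.map_coanchor, ψ.isHom.map_coanchor]⟩⟩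

/-! ### Torsors with curvature -/

/-- The data of an `(Ω² → Ω^{3,cl})`-torsor, given on stalks. -/
structure TorsorData (𝒪 : FunctionSheaf K X) where
  stalk : X → Type u
  IsSec : X → (∀ z, stalk z) → Prop
  vadd : ∀ {x}, 𝒪.Form x 2 → stalk x → stalk x
  curv : ∀ {x}, stalk x → 𝒪.Form x 3

/-- The axioms of an `(Ω² → Ω^{3,cl})`-torsor: a sheaf with locally a section on which `Ω²` acts
simply transitively, with a map to closed `3`-forms for which `c(θ + s) = dθ + c(s)`. -/
structure TorsorData.IsTorsor {𝒪 : FunctionSheaf K X} (C : TorsorData 𝒪) : Prop where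
  isSheaf : IsSheaf C.stalk C.IsSec
  nonempty : ∀ x, Nonempty (C.stalk x)
  vadd_sec : ∀ x θ s, 𝒪.IsFormSec x 2 θ → C.IsSec x s → C.IsSec x fun z => C.vadd (θ z) (s z)
  zero_vadd : ∀ x (s : C.stalk x), C.vadd 0 s = s
  add_vadd : ∀ x (θ θ' : 𝒪.Form x 2) (s : C.stalk x),
    C.vadd (θ + θ') s = C.vadd θ (C.vadd θ' s)
  simply_transitive : ∀ x (s t : C.stalk x), ∃! θ : 𝒪.Form x 2, C.vadd θ s = t
  curv_sec : ∀ x s, C.IsSec x s → 𝒪.IsFormSec x 3 fun z => C.curv (s z)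
  curv_closed : ∀ x (s : C.stalk x), IsClosedForm (C.curv s)
  curv_vadd : ∀ x (θ : 𝒪.Form x 2) (s : C.stalk x), C.curv (C.vadd θ s) = d2 θ + C.curv s

/-- `(Ω² → Ω^{3,cl})`-torsors. -/
structure Torsor (𝒪 : FunctionSheaf K X) extends TorsorData 𝒪 where
  isTorsor : toTorsorData.IsTorsor

/-- A morphism of torsors: an equivariant morphism of sheaves that preserves the curvature. -/
structure IsTorsorHom {𝒪 : FunctionSheaf K X} (C D : TorsorData 𝒪)
    (m : ∀ x, C.stalk x → D.stalk x) : Prop where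
  map_sec : ∀ x s, C.IsSec x s → D.IsSec x fun z => m z (s z)
  map_vadd : ∀ x (θ : 𝒪.Form x 2) (s : C.stalk x), m x (C.vadd θ s) = D.vadd θ (m x s)
  map_curv : ∀ x (s : C.stalk x), D.curv (m x s) = C.curv s

/-- A morphism of torsors. -/
@[ext]
structure Torsor.Hom {𝒪 : FunctionSheaf K X} (C D : Torsor 𝒪) where
  toFun : ∀ x, C.stalk x → D.stalk x
  isHom : IsTorsorHom C.toTorsorData D.toTorsorData toFun

instance (𝒪 : FunctionSheaf K X) : Category (Torsor 𝒪) where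
  Hom C D := Torsor.Hom C D
  id C := ⟨fun _ s => s, ⟨fun _ _ h => h, fun _ _ _ => rfl, fun _ _ => rfl⟩⟩
  comp m k := ⟨fun x s => k.toFun x (m.toFun x s),
    ⟨fun x s h => k.isHom.map_sec x _ (m.isHom.map_sec x s h),
     fun x θ s => by simp [m.isHom.map_vadd, k.isHom.map_vadd],
     fun x s => by simp [m.isHom.map_curv, k.isHom.map_curv]⟩⟩

/-! ### The torsor of connections -/

/-- A connection on the stalk at `x`: an isotropic splitting of the anchor. -/
structure IsConnection {𝒪 : FunctionSheaf K X} (Q : CourantData 𝒪) (x : X)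
    (D : 𝒪.T x →ₗ[𝒪.stalk x] Q.stalk x) : Prop where
  anchor : ∀ ξ, Q.anchor x (D ξ) = ξ
  isotropic : ∀ ξ η, Q.pairing (D ξ) (D η) = 0

/-- The stalk at `x` of the sheaf of connections. -/
def Conn {𝒪 : FunctionSheaf K X} (Q : CourantData 𝒪) (x : X) : Type u :=
  {D : 𝒪.T x →ₗ[𝒪.stalk x] Q.stalk x // IsConnection Q x D}

/-- `D` is a connection on a neighbourhood of `x`. -/
def IsConnSec {𝒪 : FunctionSheaf K X} (Q : CourantData 𝒪) (x : X) (D : ∀ z, Conn Q z) : Prop :=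
  ∀ᶠ z in 𝓝 x, ∀ ξ, 𝒪.IsVectSec z ξ → Q.IsSec z fun w => (D w).1 (ξ w)

/-- `H` is the curvature of the connection `D`: under the co-anchor, `ι_η ι_ξ H` corresponds to
`{D ξ, D η} - D [ξ, η]`. -/
def IsCurvature {𝒪 : FunctionSheaf K X} {Q : CourantData 𝒪} {x : X} (D : Conn Q x)
    (H : 𝒪.Form x 3) : Prop :=
  ∀ ξ η, Q.bracket (D.1 ξ) (D.1 η) - D.1 ⁅ξ, η⁆ = Q.coanchor x (contract η (contract ξ H))

/-- The curvature of a connection. -/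
def curvature {𝒪 : FunctionSheaf K X} {Q : CourantData 𝒪} {x : X} (D : Conn Q x) : 𝒪.Form x 3 :=
  Classical.epsilon (IsCurvature D)

/-- The linear map `ξ ↦ π†(ι_ξ θ)`. -/
def shift {𝒪 : FunctionSheaf K X} (Q : CourantData 𝒪) {x : X} (θ : 𝒪.Form x 2) :
    𝒪.T x →ₗ[𝒪.stalk x] Q.stalk x :=
  Q.coanchor x ∘ₗ θ.curryLeft

lemma isConnection_add_shift {𝒪 : FunctionSheaf K X} (Q : ECA 𝒪) {x : X}
    {D : 𝒪.T x →ₗ[𝒪.stalk x] Q.stalk x} (hD : IsConnection Q.toCourantData x D)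
    (θ : 𝒪.Form x 2) :
    IsConnection Q.toCourantData x (D + shift Q.toCourantData θ) := by
  have hQ := Q.isExact.toIsCourant
  have hc : ∀ p (α : 𝒪.Form x 1), Q.pairing (Q.coanchor x α) p = α ![Q.anchor x p] :=
    fun p α => by rw [hQ.pairing_comm, hQ.pairing_coanchor]
  have hr : ∀ p q r : Q.stalk x, Q.pairing p (q + r) = Q.pairing p q + Q.pairing p r := by
    intro p q r
    rw [hQ.pairing_comm, hQ.pairing_add_left, hQ.pairing_comm _ q, hQ.pairing_comm _ r]
  refine ⟨fun ξ => ?_, fun ξ η => ?_⟩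
  · simp [shift, hD.anchor, hQ.anchor_coanchor]
  · simp only [shift, LinearMap.add_apply, LinearMap.comp_apply, hQ.pairing_add_left, hr,
      hD.isotropic, hQ.pairing_coanchor, hc, hD.anchor, hQ.anchor_coanchor]
    have h1 : (θ.curryLeft η) ![ξ] = θ ![η, ξ] := rfl
    have h2 : (θ.curryLeft ξ) ![η] = θ ![ξ, η] := rfl
    rw [h1, h2, map_zero_fst, form2_swap θ η ξ]
    ring

/-- The torsor of connections of an exact Courant algebroid: `θ` acts by
`D ↦ D + π†(ι_{(·)} θ)`. -/
def connData {𝒪 : FunctionSheaf K X} (Q : ECA 𝒪) : TorsorData 𝒪 where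
  stalk := Conn Q.toCourantData
  IsSec := IsConnSec Q.toCourantData
  vadd θ D := ⟨D.1 + shift Q.toCourantData θ, isConnection_add_shift Q D.2 θ⟩
  curv D := curvature D

/-- The connections of exact Courant algebroids form torsors, functorially. -/
structure ConnectionsWellDefined (𝒪 : FunctionSheaf K X) : Prop where
  existsUnique_curvature : ∀ (Q : ECA 𝒪) (x : X) (D : Conn Q.toCourantData x),
    ∃! H, IsCurvature D H
  isTorsor : ∀ Q : ECA 𝒪, (connData Q).IsTorsor
  isConnection : ∀ {Q P : ECA 𝒪} (φ : ECA.Hom Q P) {x : X} (D : Conn Q.toCourantData x),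
    IsConnection P.toCourantData x (φ.toFun x ∘ₗ D.1)
  isTorsorHom : ∀ {Q P : ECA 𝒪} (φ : ECA.Hom Q P),
    IsTorsorHom (connData Q) (connData P) fun _ D => ⟨φ.toFun _ ∘ₗ D.1, isConnection φ D⟩

/-- The functor `Q ↦ (C(Q), c)`. -/
def connFunctor {𝒪 : FunctionSheaf K X} (h : ConnectionsWellDefined 𝒪) : ECA 𝒪 ⥤ Torsor 𝒪 where
  obj Q := ⟨connData Q, h.isTorsor Q⟩
  map φ := ⟨fun _ D => ⟨φ.toFun _ ∘ₗ D.1, h.isConnection φ D⟩, h.isTorsorHom φ⟩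
  map_id _ := rfl
  map_comp _ _ := rfl

/-! ### Maps and inverse images -/

/-- A map `Y → X` which pulls functions back to functions. -/
structure FunctionSheaf.Map (𝒪Y : FunctionSheaf K Y) (𝒪X : FunctionSheaf K X) where
  toFun : Y → X
  continuous : Continuous toFun
  pull : ∀ (y : Y) (s : X → K), (s : Germ (𝓝 (toFun y)) K) ∈ 𝒪X.germs (toFun y) →
    ((s ∘ toFun : Y → K) : Germ (𝓝 y) K) ∈ 𝒪Y.germs y

variable {𝒪Y : FunctionSheaf K Y} {𝒪X : FunctionSheaf K X} (f : 𝒪Y.Map 𝒪X) (y : Y)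

/-- Pull-back of functions, on stalks. -/
def FunctionSheaf.Map.comap : 𝒪X.stalk (f.toFun y) →+* 𝒪Y.stalk y where
  toFun g := ⟨g.1.compTendsto f.toFun (f.continuous.tendsto y), by
    obtain ⟨g, hg⟩ := g
    induction g using Germ.inductionOn with
    | _ s => exact f.pull y s hg⟩
  map_one' := rfl
  map_zero' := rfl
  map_add' := by
    rintro ⟨g, hg⟩ ⟨h, hh⟩
    apply Subtype.ext
    induction g using Germ.inductionOn
    induction h using Germ.inductionOn
    rfl
  map_mul' := by
    rintro ⟨g, hg⟩ ⟨h, hh⟩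
    apply Subtype.ext
    induction g using Germ.inductionOn
    induction h using Germ.inductionOn
    rfl

instance FunctionSheaf.Map.algebra : Algebra (𝒪X.stalk (f.toFun y)) (𝒪Y.stalk y) :=
  (f.comap y).toAlgebra

/-- The stalk at `y` of `f^*E`, where `M` is the stalk of `E` at `f y`. -/
abbrev PullStalk (M : Type u) [AddCommGroup M] [Module (𝒪X.stalk (f.toFun y)) M] : Type u :=
  𝒪Y.stalk y ⊗[𝒪X.stalk (f.toFun y)] M

/-- The action of sections of `f^*T_X` as derivations along `f`: `h ⊗ v` acts by
`g ↦ h · f^*(v g)`. -/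
def actAlong : PullStalk f y (𝒪X.T (f.toFun y)) →ₗ[𝒪Y.stalk y]
    (𝒪X.stalk (f.toFun y) → 𝒪Y.stalk y) :=
  LinearMap.liftBaseChange (𝒪Y.stalk y)
    { toFun := fun v g => f.comap y (act v g)
      map_add' := fun v w => funext fun g => by simp
      map_smul' := fun a v => funext fun g => by
        simp only [act_smul_left, map_mul, Pi.smul_apply, RingHom.id_apply, Algebra.smul_def]
        rfl }

/-- `t` is the image `df(ξ)` of `ξ` under the differential `df : T_Y → f^*T_X`, that is, `t` and
`ξ` define the same derivation along `f`. -/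
def IsDifferential (ξ : 𝒪Y.T y) (t : PullStalk f y (𝒪X.T (f.toFun y))) : Prop :=
  ∀ g, actAlong f y t g = act ξ (f.comap y g)

/-- `θ'` is the pull-back of the form `θ`: its value on vector fields `ξ i` is the value of `θ` on
the `df(ξ i)`, computed by multilinearity from `df(ξ i) = ∑ j, h i j ⊗ v i j`. -/
def IsFormPullback {k : ℕ} (θ : 𝒪X.Form (f.toFun y) k) (θ' : 𝒪Y.Form y k) : Prop :=
  ∀ (ξ : Fin k → 𝒪Y.T y) (m : ℕ) (h : Fin k → Fin m → 𝒪Y.stalk y)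
    (v : Fin k → Fin m → 𝒪X.T (f.toFun y)),
    (∀ i, IsDifferential f y (ξ i) (∑ j, h i j ⊗ₜ v i j)) →
    θ' ξ = ∑ j : Fin k → Fin m, (∏ i, h i (j i)) * f.comap y (θ fun i => v i (j i))

/-- The pull-back `f^*θ`. -/
def pullForm {k : ℕ} (θ : 𝒪X.Form (f.toFun y) k) : 𝒪Y.Form y k :=
  Classical.epsilon (IsFormPullback f y θ)

/-! ### The inverse image of a Courant algebroid -/

section InverseImage

variable (Q : CourantData 𝒪X)

/-- The ambient module `Ω¹_Y ⊕ f^*Q ⊕ T_Y`. -/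
def Ambient : Type u := 𝒪Y.Form y 1 × PullStalk f y (Q.stalk (f.toFun y)) × 𝒪Y.T y

instance : AddCommGroup (Ambient f y Q) :=
  inferInstanceAs (AddCommGroup (𝒪Y.Form y 1 × PullStalk f y (Q.stalk (f.toFun y)) × 𝒪Y.T y))
instance : Module (𝒪Y.stalk y) (Ambient f y Q) :=
  inferInstanceAs
    (Module (𝒪Y.stalk y) (𝒪Y.Form y 1 × PullStalk f y (Q.stalk (f.toFun y)) × 𝒪Y.T y))

/-- The submodule `Ω¹_Y ⊕ (f^*Q ×_{f^*T_X} T_Y)`. -/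
def fiberProduct : Submodule (𝒪Y.stalk y) (Ambient f y Q) where
  carrier := {m | IsDifferential f y m.2.2 ((Q.anchor (f.toFun y)).baseChange (𝒪Y.stalk y) m.2.1)}
  add_mem' {a b} ha hb g := by
    change actAlong f y (LinearMap.baseChange _ _ (a.2.1 + b.2.1)) g = act (a.2.2 + b.2.2) _
    simpa using congrArg₂ (· + ·) (ha g) (hb g)
  zero_mem' g := by
    change actAlong f y (LinearMap.baseChange _ _ 0) g = act 0 _
    rw [map_zero, map_zero]
    rfl
  smul_mem' c a ha g := by
    change actAlong f y (LinearMap.baseChange _ _ (c • a.2.1)) g = act (c • a.2.2) _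
    simpa using congrArg (c * ·) (ha g)

/-- The triple `(α, u, ξ)`, as an element of the ambient module. -/
def triple (α : 𝒪Y.Form y 1) (u : PullStalk f y (Q.stalk (f.toFun y))) (ξ : 𝒪Y.T y) :
    Ambient f y Q := (α, u, ξ)

/-- The submodule generated by the `(f^*γ, -(1 ⊗ π†(γ)), 0)`, for `1`-forms `γ` on `X`. -/
def relations : Submodule (𝒪Y.stalk y) (Ambient f y Q) :=
  Submodule.span _ (Set.range fun γ : 𝒪X.Form (f.toFun y) 1 =>
    triple f y Q (pullForm f y γ) (-((1 : 𝒪Y.stalk y) ⊗ₜ Q.coanchor (f.toFun y) γ)) 0)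

/-- The projection `(α, u, ξ) ↦ ξ`. -/
def projT : Ambient f y Q →ₗ[𝒪Y.stalk y] 𝒪Y.T y where
  toFun m := m.2.2
  map_add' _ _ := rfl
  map_smul' _ _ := rfl

lemma relations_le : relations f y Q ≤ LinearMap.ker (projT f y Q) := by
  rw [relations, Submodule.span_le]
  rintro _ ⟨γ, rfl⟩
  rfl

/-- The stalk at `y` of `f⁺⁺Q`: the quotient of `Ω¹_Y ⊕ (f^*Q ×_{f^*T_X} T_Y)` which identifies
the two images of `f^*Ω¹_X`. -/
abbrev InverseStalk : Type u :=
  fiberProduct f y Q ⧸ (relations f y Q).submoduleOf (fiberProduct f y Q)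

variable {f y Q} in
/-- `s` is the class of `(α, u, ξ)`. -/
def IsClass (s : InverseStalk f y Q) (α : 𝒪Y.Form y 1) (u : PullStalk f y (Q.stalk (f.toFun y)))
    (ξ : 𝒪Y.T y) : Prop :=
  ∃ h : triple f y Q α u ξ ∈ fiberProduct f y Q,
    s = Submodule.Quotient.mk ⟨triple f y Q α u ξ, h⟩

variable {f y Q} in
/-- The pairing of the class of `(α, ∑ h i ⊗ q i, ξ)` and the class of `(β, ∑ j k ⊗ p k, η)` is
`ι_ξ β + ι_η α + ∑ h i j k ⟨q i, p k⟩`. -/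
def IsPairing (s t : InverseStalk f y Q) (b : 𝒪Y.stalk y) : Prop :=
  ∃ (m : ℕ) (α : 𝒪Y.Form y 1) (h : Fin m → 𝒪Y.stalk y) (q : Fin m → Q.stalk (f.toFun y))
    (ξ : 𝒪Y.T y) (l : ℕ) (β : 𝒪Y.Form y 1) (j : Fin l → 𝒪Y.stalk y)
    (p : Fin l → Q.stalk (f.toFun y)) (η : 𝒪Y.T y),
    IsClass s α (∑ i, h i ⊗ₜ q i) ξ ∧ IsClass t β (∑ k, j k ⊗ₜ p k) η ∧
    b = β ![ξ] + α ![η] + ∑ i, ∑ k, h i * j k * f.comap y (Q.pairing (q i) (p k))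

variable {f y Q} in
/-- The bracket of the class of `(α, ∑ h i ⊗ q i, ξ)` and the class of `(β, ∑ j k ⊗ p k, η)` is
the class of
`(-ι_η dα + L_ξ β + ∑ j k ⟨q i, p k⟩ d(h i),
  ∑ h i j k ⊗ {q i, p k} - ∑ η(h i) ⊗ q i + ∑ ξ(j k) ⊗ p k, [ξ, η])`. -/
def IsBracket (s t r : InverseStalk f y Q) : Prop :=
  ∃ (m : ℕ) (α : 𝒪Y.Form y 1) (h : Fin m → 𝒪Y.stalk y) (q : Fin m → Q.stalk (f.toFun y))
    (ξ : 𝒪Y.T y) (l : ℕ) (β : 𝒪Y.Form y 1) (j : Fin l → 𝒪Y.stalk y)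
    (p : Fin l → Q.stalk (f.toFun y)) (η : 𝒪Y.T y),
    IsClass s α (∑ i, h i ⊗ₜ q i) ξ ∧ IsClass t β (∑ k, j k ⊗ₜ p k) η ∧
    IsClass r
      (-contract η (d1 α) + lieDeriv ξ β +
        ∑ i, ∑ k, (j k * f.comap y (Q.pairing (q i) (p k))) • d0 (h i))
      (∑ i, ∑ k, (h i * j k) ⊗ₜ Q.bracket (q i) (p k) - ∑ i, act η (h i) ⊗ₜ q i
        + ∑ k, act ξ (j k) ⊗ₜ p k)
      ⁅ξ, η⁆

/-- `s` is a section of `f⁺⁺Q` near `y`: it is the class of `(α, ∑ h i ⊗ q i, ξ)` for sections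
`α`, `h i` and `ξ` on `Y` near `y` and sections `q i` of `Q` near `f y`. -/
def IsInverseSec (s : ∀ z, InverseStalk f z Q) : Prop :=
  ∃ (m : ℕ) (α : ∀ z, 𝒪Y.Form z 1) (h : Fin m → ∀ z, 𝒪Y.stalk z) (q : Fin m → ∀ x, Q.stalk x)
    (ξ : ∀ z, 𝒪Y.T z), 𝒪Y.IsFormSec y 1 α ∧ (∀ i, 𝒪Y.IsSec y (h i)) ∧
    (∀ i, Q.IsSec (f.toFun y) (q i)) ∧ 𝒪Y.IsVectSec y ξ ∧
    ∀ᶠ z in 𝓝 y, IsClass (s z) (α z) (∑ i, h i z ⊗ₜ q i (f.toFun z)) (ξ z)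

/-- The inverse image `f⁺⁺Q`. -/
def inverseData : CourantData 𝒪Y where
  stalk z := InverseStalk f z Q
  IsSec z s := IsInverseSec f z Q s
  bracket s t := Classical.epsilon (IsBracket s t)
  pairing s t := Classical.epsilon (IsPairing s t)
  anchor z := Submodule.liftQ _ (projT f z Q ∘ₗ (fiberProduct f z Q).subtype)
    (fun _ hm => relations_le f z Q hm)
  coanchor z := Submodule.mkQ _ ∘ₗ
    { toFun := fun β => ⟨triple f z Q β 0 0, fun g => by
        change actAlong f z (LinearMap.baseChange _ _ 0) g = act 0 _
        rw [map_zero, map_zero]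
        rfl⟩
      map_add' := fun _ _ =>
        Subtype.ext (Prod.ext rfl (Prod.ext (add_zero 0).symm (add_zero 0).symm))
      map_smul' := fun c _ =>
        Subtype.ext (Prod.ext rfl (Prod.ext (smul_zero c).symm (smul_zero c).symm)) }

end InverseImage

/-- The map of ambient modules induced by a morphism of Courant algebroids. -/
def ambientMap {Q P : ECA 𝒪X} (φ : ECA.Hom Q P) :
    Ambient f y Q.toCourantData →ₗ[𝒪Y.stalk y] Ambient f y P.toCourantData where
  toFun m := triple f y P.toCourantData m.1
    ((φ.toFun (f.toFun y)).baseChange (𝒪Y.stalk y) m.2.1) m.2.2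
  map_add' m m' := Prod.ext rfl (Prod.ext (map_add _ m.2.1 m'.2.1) rfl)
  map_smul' c m := Prod.ext rfl (Prod.ext (map_smul _ c m.2.1) rfl)

lemma ambientMap_mem {Q P : ECA 𝒪X} (φ : ECA.Hom Q P) (m : Ambient f y Q.toCourantData)
    (hm : m ∈ fiberProduct f y Q.toCourantData) :
    ambientMap f y φ m ∈ fiberProduct f y P.toCourantData := by
  intro g
  have hφ : P.anchor (f.toFun y) ∘ₗ φ.toFun (f.toFun y) = Q.anchor (f.toFun y) :=
    LinearMap.ext (φ.isHom.map_anchor _)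
  refine Eq.trans ?_ (hm g)
  rw [← hφ, LinearMap.baseChange_comp]
  rfl

lemma ambientMap_relations {Q P : ECA 𝒪X} (φ : ECA.Hom Q P) (m : Ambient f y Q.toCourantData)
    (hm : m ∈ relations f y Q.toCourantData) :
    ambientMap f y φ m ∈ relations f y P.toCourantData := by
  have h : relations f y Q.toCourantData ≤
      (relations f y P.toCourantData).comap (ambientMap f y φ) := by
    rw [relations, Submodule.span_le]
    rintro _ ⟨γ, rfl⟩
    refine Submodule.subset_span ⟨γ, Prod.ext rfl (Prod.ext ?_ rfl)⟩
    change _ = LinearMap.baseChange _ _ (-_)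
    rw [map_neg, LinearMap.baseChange_tmul, φ.isHom.map_coanchor]
    rfl
  exact h hm

/-- The map `f⁺⁺φ` induced by `φ` on inverse images: `(α, u, ξ) ↦ (α, f^*(φ)(u), ξ)`. -/
def inverseMap {Q P : ECA 𝒪X} (φ : ECA.Hom Q P) :
    InverseStalk f y Q.toCourantData →ₗ[𝒪Y.stalk y] InverseStalk f y P.toCourantData :=
  Submodule.mapQ _ _ ((ambientMap f y φ).restrict (ambientMap_mem f y φ))
    (fun m hm => ambientMap_relations f y φ m hm)

/-- The inverse image is a well-defined functor between exact Courant algebroids. -/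
structure InverseImageWellDefined : Prop where
  existsUnique_pairing : ∀ (Q : ECA 𝒪X) (y : Y) (s t : InverseStalk f y Q.toCourantData),
    ∃! b, IsPairing s t b
  existsUnique_bracket : ∀ (Q : ECA 𝒪X) (y : Y) (s t : InverseStalk f y Q.toCourantData),
    ∃! r, IsBracket s t r
  isExactCourant : ∀ Q : ECA 𝒪X, (inverseData f Q.toCourantData).IsExactCourant
  isCourantHom : ∀ {Q P : ECA 𝒪X} (φ : ECA.Hom Q P),
    IsCourantHom (inverseData f Q.toCourantData) (inverseData f P.toCourantData)
      fun y => inverseMap f y φ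

/-- The functor `f⁺⁺`. -/
def inverseImage (h : InverseImageWellDefined f) : ECA 𝒪X ⥤ ECA 𝒪Y where
  obj Q := ⟨inverseData f Q.toCourantData, h.isExactCourant Q⟩
  map φ := ⟨fun y => inverseMap f y φ, h.isCourantHom φ⟩
  map_id Q := by
    refine ECA.Hom.ext (funext fun y => LinearMap.ext fun s => ?_)
    induction s using Submodule.Quotient.induction_on with
    | _ m =>
      refine congrArg Submodule.Quotient.mk (Subtype.ext (Prod.ext rfl (Prod.ext ?_ rfl)))
      change LinearMap.baseChange _ LinearMap.id _ = _
      rw [LinearMap.baseChange_id]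
      rfl
  map_comp {Q P R} φ ψ := by
    refine ECA.Hom.ext (funext fun y => LinearMap.ext fun s => ?_)
    induction s using Submodule.Quotient.induction_on with
    | _ m =>
      refine congrArg Submodule.Quotient.mk (Subtype.ext (Prod.ext rfl (Prod.ext ?_ rfl)))
      change LinearMap.baseChange _ (_ ∘ₗ _) _ = _
      rw [LinearMap.baseChange_comp]
      rfl

/-- `D'` is the connection `f⁺⁺D : ξ ↦ (0, f^*(D)(df(ξ)), ξ)`. -/
def IsConnPullback {Q : CourantData 𝒪X} (D : Conn Q (f.toFun y))
    (D' : Conn (inverseData f Q) y) : Prop :=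
  ∀ ξ t, IsDifferential f y ξ t → IsClass (D'.1 ξ) 0 (D.1.baseChange (𝒪Y.stalk y) t) ξ

/-! ### The inverse image of a torsor -/

section TorsorPullback

variable (C : Torsor 𝒪X)

/-- `(θ' + f^*θ, s)` and `(θ', θ + s)` are identified in `f^*C`. -/
inductive PullRel : 𝒪Y.Form y 2 × C.stalk (f.toFun y) → 𝒪Y.Form y 2 × C.stalk (f.toFun y) → Prop
  | rel (θ' : 𝒪Y.Form y 2) (θ : 𝒪X.Form (f.toFun y) 2) (s : C.stalk (f.toFun y)) :
    PullRel (θ' + pullForm f y θ, s) (θ', C.vadd θ s)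

/-- The stalk at `y` of `f^*C = Ω²_Y ×_{f⁻¹Ω²_X} f⁻¹C`. -/
def PullTorsorStalk : Type u := Quot (PullRel f y C)

/-- The element of `f^*C` given by a `2`-form on `Y` and an element of `C`. -/
def pullMk (θ : 𝒪Y.Form y 2) (s : C.stalk (f.toFun y)) : PullTorsorStalk f y C :=
  Quot.mk _ (θ, s)

/-- The inverse image of a torsor, with curvature `(θ, s) ↦ dθ + f^*c(s)`. -/
def pullTorsorData : TorsorData 𝒪Y where
  stalk y := PullTorsorStalk f y C
  IsSec y a := ∃ (θ : ∀ z, 𝒪Y.Form z 2) (s : ∀ x, C.stalk x),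
    𝒪Y.IsFormSec y 2 θ ∧ C.IsSec (f.toFun y) s ∧
      ∀ᶠ z in 𝓝 y, a z = pullMk f z C (θ z) (s (f.toFun z))
  vadd {y} θ := Quot.map (fun p => (θ + p.1, p.2)) (by
    rintro _ _ ⟨θ', η, s⟩
    simpa only [add_assoc] using PullRel.rel (f := f) (y := y) (C := C) (θ + θ') η s)
  curv {y} a := Classical.epsilon fun H =>
    ∃ θ s, a = pullMk f y C θ s ∧ H = d2 θ + pullForm f y (C.curv s)

end TorsorPullback

/-- The map induced by a morphism of torsors on inverse images: `(θ, s) ↦ (θ, m(s))`. -/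
def pullTorsorMap {C D : Torsor 𝒪X} (m : Torsor.Hom C D) :
    PullTorsorStalk f y C → PullTorsorStalk f y D :=
  Quot.map (fun p => (p.1, m.toFun _ p.2)) (by
    rintro _ _ ⟨θ', η, s⟩
    simpa only [m.isHom.map_vadd] using PullRel.rel (f := f) (y := y) (C := D) θ' η (m.toFun _ s))

/-- The inverse image of torsors is well defined. -/
structure TorsorPullbackWellDefined : Prop where
  existsUnique_pullForm : ∀ (y : Y) (k : ℕ) (θ : 𝒪X.Form (f.toFun y) k),
    ∃! θ', IsFormPullback f y θ θ'
  curv_mk : ∀ (C : Torsor 𝒪X) (y : Y) (θ : 𝒪Y.Form y 2) (s : C.stalk (f.toFun y)),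
    (pullTorsorData f C).curv (pullMk f y C θ s) = d2 θ + pullForm f y (C.curv s)
  isTorsor : ∀ C : Torsor 𝒪X, (pullTorsorData f C).IsTorsor

lemma isTorsorHom_pullTorsorMap (h : TorsorPullbackWellDefined f) {C D : Torsor 𝒪X}
    (m : Torsor.Hom C D) :
    IsTorsorHom (pullTorsorData f C) (pullTorsorData f D) fun y => pullTorsorMap f y m where
  map_sec := by
    rintro y a ⟨θ, s, hθ, hs, ha⟩
    refine ⟨θ, fun x => m.toFun x (s x), hθ, m.isHom.map_sec _ _ hs, ?_⟩
    filter_upwards [ha] with z hz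
    rw [hz]
    rfl
  map_vadd := by
    rintro y θ ⟨θ', s⟩
    rfl
  map_curv := by
    rintro y ⟨θ, s⟩
    refine (h.curv_mk D y θ (m.toFun _ s)).trans (Eq.trans ?_ (h.curv_mk C y θ s).symm)
    rw [m.isHom.map_curv]

/-- The functor `f^*` on torsors. -/
def torsorPullback (h : TorsorPullbackWellDefined f) : Torsor 𝒪X ⥤ Torsor 𝒪Y where
  obj C := ⟨pullTorsorData f C, h.isTorsor C⟩
  map m := ⟨fun y => pullTorsorMap f y m, isTorsorHom_pullTorsorMap f h m⟩
  map_id C := by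
    refine Torsor.Hom.ext (funext fun y => funext ?_)
    rintro ⟨θ, s⟩
    rfl
  map_comp m k := by
    refine Torsor.Hom.ext (funext fun y => funext ?_)
    rintro ⟨θ, s⟩
    rfl

/-! ### Manifolds -/

section Manifold

variable {𝕜 : Type} [RCLike 𝕜] (K) [NormedAlgebra 𝕜 K]
  {E : Type*} [NormedAddCommGroup E] [NormedSpace 𝕜 E]
  {F : Type*} [NormedAddCommGroup F] [NormedSpace 𝕜 F] (n : WithTop ℕ∞)

/-- The sheaf of `K`-valued functions of class `C^n` on a manifold `X` modelled on `E`. -/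
def smoothFunctions (𝕜 : Type) [RCLike 𝕜] [NormedAlgebra 𝕜 K] (E : Type*) [NormedAddCommGroup E]
    [NormedSpace 𝕜 E] (X : Type u) [TopologicalSpace X] [ChartedSpace E X] :
    FunctionSheaf K X where
  germs x :=
    { carrier := {g | ∃ s : X → K,
        (∀ᶠ z in 𝓝 x, ContMDiffAt 𝓘(𝕜, E) 𝓘(𝕜, K) n s z) ∧ g = (s : Germ (𝓝 x) K)}
      mul_mem' := by
        rintro _ _ ⟨s, hs, rfl⟩ ⟨t, ht, rfl⟩
        refine ⟨s * t, ?_, rfl⟩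
        filter_upwards [hs, ht] with z h1 h2
        exact ContMDiffAt.comp z (g := fun p : K × K => p.1 * p.2)
          contDiff_mul.contMDiff.contMDiffAt (h1.prodMk_space h2)
      add_mem' := by
        rintro _ _ ⟨s, hs, rfl⟩ ⟨t, ht, rfl⟩
        refine ⟨s + t, ?_, rfl⟩
        filter_upwards [hs, ht] with z h1 h2
        exact h1.add h2
      algebraMap_mem' := fun c => ⟨fun _ => c, Eventually.of_forall fun _ => contMDiffAt_const, by
        rw [Algebra.algebraMap_eq_smul_one]
        exact congrArg (fun s : X → K => (s : Germ (𝓝 x) K)) (funext fun _ => mul_one c)⟩ }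
  spread x s := by
    rintro ⟨t, ht, hst⟩
    filter_upwards [ht.eventually_nhds, (Germ.coe_eq.mp hst).eventually_nhds] with z h1 h2
    exact ⟨t, h1, Germ.coe_eq.mpr h2⟩

/-- A `C^n` map of manifolds, with the pull-back of functions. -/
def smoothMap [ChartedSpace E X] [ChartedSpace F Y]
    (f : C^n⟮𝓘(𝕜, F), Y; 𝓘(𝕜, E), X⟯) :
    (smoothFunctions K n 𝕜 F Y).Map (smoothFunctions K n 𝕜 E X) where
  toFun := f
  continuous := f.contMDiff.continuous
  pull y s := by
    rintro ⟨t, ht, hst⟩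
    have hc : Tendsto f (𝓝 y) (𝓝 (f y)) := f.contMDiff.continuous.tendsto y
    refine ⟨t ∘ f, ?_, Germ.coe_eq.mpr (hc.eventually (Germ.coe_eq.mp hst))⟩
    filter_upwards [hc.eventually ht] with z hz
    exact hz.comp z f.contMDiff.contMDiffAt

end Manifold

end CourantPullback
end

/-!
The whole argument takes place over a sheaf of functions which has, at every point, local
coordinates `c i` with partial derivatives `p i` such that `p i (c j) = δ i j` and such that every
germ has a Hadamard expansion `g = k + ∑ i, (c i - c i(z)) * h i` (`IsCoord`, `HasCoords`).  A
manifold of class `C^∞` or `C^ω` has such coordinates (`hasCoords_smoothFunctions`): the components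
of a chart, with Hadamard's lemma proved by integrating the derivative along segments, respectively
by dividing a power series by its variable.

The Hadamard expansion forces the chain rule `act_comap` for an arbitrary derivation: both sides are
sections, and a section is determined by its values.  So the `p i` are a basis of the vector fields,
differential forms are determined by arbitrary components, the differential `df : T_Y → f^*T_X`
exists and is unique, and pull-back of forms exists, is unique and commutes with `d`.

Locally an exact Courant algebroid has a connection, and a connection splits it as `Ω¹ ⊕ T` with the
standard anchor, co-anchor and pairing and with the bracket
`[(α, ξ), (β, η)] = (L_ξ β - ι_η dα + ι_η ι_ξ H, [ξ, η])`, where `H` is the curvature, a closed form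
(`IsTwisted`).  Conversely such a splitting near every point makes `Q` an exact Courant algebroid,
since the axioms hold for the twisted bracket (`isExactCourant_of_isLocallyTwisted`).  Given a
connection `D` of `Q` at `f y`, the map
`(α, ∑ h i ⊗ q i, ξ) ↦ (α + ∑ h i f^*⟨q i, D(·)⟩, ξ)` is a linear isomorphism of `f⁺⁺Q` with
`Ω¹_Y ⊕ T_Y` that takes the given pairing and bracket to the ones twisted by `f^*H`
(`isTwisted_inverseEquiv`).  Hence `f⁺⁺Q` is well defined and exact, and the connection
corresponding to `ξ ↦ (0, ξ)` is `f⁺⁺D`, with curvature `f^*H`.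

The connections form a torsor because the difference of two isotropic splittings is a `2`-form, and
`(θ, D) ↦ θ + f⁺⁺D` is a morphism of torsors from `f^*C(Q)` to `C(f⁺⁺Q)`.  A morphism of torsors is
an isomorphism, and naturality in `Q` is a computation with representatives.
-/

noncomputable section

namespace CourantPullback

variable {K : Type} [RCLike K] {X Y : Type u} [TopologicalSpace X] [TopologicalSpace Y]

open FunctionSheaf

/-! ### Sections of a function sheaf -/

namespace FunctionSheaf

variable {𝒪 : FunctionSheaf K X} {x : X}

/-- The value at `x` of an element of the stalk at `x`. -/
def value (g : 𝒪.stalk x) : K := Germ.value g.1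

@[simp] lemma value_add (g h : 𝒪.stalk x) : value (g + h) = value g + value h := by
  obtain ⟨g, hg⟩ := g
  obtain ⟨h, hh⟩ := h
  induction g using Germ.inductionOn
  induction h using Germ.inductionOn
  rfl

@[simp] lemma value_mul (g h : 𝒪.stalk x) : value (g * h) = value g * value h := by
  obtain ⟨g, hg⟩ := g
  obtain ⟨h, hh⟩ := h
  induction g using Germ.inductionOn
  induction h using Germ.inductionOn
  rfl

@[simp] lemma value_zero : value (0 : 𝒪.stalk x) = 0 := rfl

@[simp] lemma value_algebraMap (k : K) : value (algebraMap K (𝒪.stalk x) k) = k := by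
  have h : ((algebraMap K (𝒪.stalk x) k).1 : Germ (𝓝 x) K) = ((fun _ => k : X → K) : Germ _ K) := by
    change algebraMap K (Germ (𝓝 x) K) k = _
    rw [Algebra.algebraMap_eq_smul_one]
    exact congrArg (fun s : X → K => (s : Germ (𝓝 x) K)) (funext fun _ => mul_one k)
  rw [value, h]
  rfl

@[simp] lemma value_sub (g h : 𝒪.stalk x) : value (g - h) = value g - value h := by
  rw [eq_sub_iff_add_eq, ← value_add, sub_add_cancel]

@[simp] lemma value_sum {ι : Type*} (s : Finset ι) (g : ι → 𝒪.stalk x) :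
    value (∑ i ∈ s, g i) = ∑ i ∈ s, value (g i) :=
  map_sum (AddMonoidHom.mk' (value (𝒪 := 𝒪) (x := x)) value_add) g s

lemma IsSec.congr {g h : ∀ z, 𝒪.stalk z} (hg : 𝒪.IsSec x g) (e : ∀ᶠ z in 𝓝 x, g z = h z) :
    𝒪.IsSec x h := by
  obtain ⟨s, hs⟩ := hg
  refine ⟨s, ?_⟩
  filter_upwards [hs, e] with z h1 h2
  rw [← h2, h1]

lemma IsSec.const (k : K) : 𝒪.IsSec x (fun z => algebraMap K (𝒪.stalk z) k) := by
  refine ⟨fun _ => k, Eventually.of_forall fun z => ?_⟩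
  change algebraMap K (Germ (𝓝 z) K) k = _
  rw [Algebra.algebraMap_eq_smul_one]
  exact congrArg (fun s : X → K => (s : Germ (𝓝 z) K)) (funext fun _ => mul_one k)

lemma IsSec.neg {g : ∀ z, 𝒪.stalk z} (hg : 𝒪.IsSec x g) : 𝒪.IsSec x (fun z => -g z) := by
  simpa using (𝒪.isSec_zero x).sub hg

lemma IsSec.one : 𝒪.IsSec x (fun _ => 1) := by
  simpa using IsSec.const (𝒪 := 𝒪) (x := x) 1

lemma IsSec.sum {ι : Type*} (s : Finset ι) {g : ι → ∀ z, 𝒪.stalk z}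
    (hg : ∀ i, 𝒪.IsSec x (g i)) : 𝒪.IsSec x (fun z => ∑ i ∈ s, g i z) := by
  classical
  induction s using Finset.induction_on with
  | empty => simpa using 𝒪.isSec_zero x
  | insert a s ha ih => simpa only [Finset.sum_insert ha] using (hg a).add ih

lemma IsSec.prod {ι : Type*} (s : Finset ι) {g : ι → ∀ z, 𝒪.stalk z}
    (hg : ∀ i, 𝒪.IsSec x (g i)) : 𝒪.IsSec x (fun z => ∏ i ∈ s, g i z) := by
  classical
  induction s using Finset.induction_on with
  | empty => simpa using IsSec.one
  | insert a s ha ih => simpa only [Finset.prod_insert ha] using (hg a).mul ih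

lemma isSheaf_stalk (𝒪 : FunctionSheaf K X) : IsSheaf 𝒪.stalk 𝒪.IsSec where
  isOpen _ _ h := h.eventually
  congr _ _ _ h e := h.congr e
  extend x a := 𝒪.exists_isSec x a
  separated x g h := by
    rintro ⟨s, hs⟩ ⟨t, ht⟩ e
    have hst : (s : Germ (𝓝 x) K) = t := by
      rw [← hs.self_of_nhds, ← ht.self_of_nhds, e]
    filter_upwards [hs, ht, (Germ.coe_eq.mp hst).eventually_nhds] with z h1 h2 h3
    apply Subtype.ext
    rw [h1, h2]
    exact Germ.coe_eq.mpr h3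

/-- A section that vanishes at every point near `x` has zero germ at `x`. -/
lemma IsSec.eq_zero_of_value {g : ∀ z, 𝒪.stalk z} (hg : 𝒪.IsSec x g)
    (h : ∀ᶠ z in 𝓝 x, value (g z) = 0) : g x = 0 := by
  obtain ⟨s, hs⟩ := hg
  apply Subtype.ext
  rw [hs.self_of_nhds]
  refine Germ.coe_eq.mpr ?_
  filter_upwards [hs, h] with z h1 h2
  rw [value, h1] at h2
  exact h2

lemma act_algebraMap (ξ : 𝒪.T x) (k : K) : act ξ (algebraMap K (𝒪.stalk x) k) = 0 :=
  ξ.1.map_algebraMap k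

@[simp] lemma act_one (ξ : 𝒪.T x) : act ξ (1 : 𝒪.stalk x) = 0 :=
  ξ.1.map_one_eq_zero

@[simp] lemma act_sub (ξ : 𝒪.T x) (g h : 𝒪.stalk x) : act ξ (g - h) = act ξ g - act ξ h :=
  map_sub ξ.1 g h

@[simp] lemma act_sum {ι : Type*} (ξ : 𝒪.T x) (s : Finset ι) (g : ι → 𝒪.stalk x) :
    act ξ (∑ i ∈ s, g i) = ∑ i ∈ s, act ξ (g i) :=
  map_sum ξ.1 g s

@[simp] lemma act_zero_left (g : 𝒪.stalk x) : act (0 : 𝒪.T x) g = 0 := rfl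

/-- `act`, as a linear map in the vector field. -/
def actLin (g : 𝒪.stalk x) : 𝒪.T x →ₗ[𝒪.stalk x] 𝒪.stalk x where
  toFun ξ := act ξ g
  map_add' _ _ := rfl
  map_smul' _ _ := rfl

@[simp] lemma actLin_apply (g : 𝒪.stalk x) (ξ : 𝒪.T x) : actLin g ξ = act ξ g := rfl

@[simp] lemma act_sum_left {ι : Type*} (s : Finset ι) (ξ : ι → 𝒪.T x) (g : 𝒪.stalk x) :
    act (∑ i ∈ s, ξ i) g = ∑ i ∈ s, act (ξ i) g :=
  map_sum (actLin g) ξ s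

lemma act_lie (ξ η : 𝒪.T x) (g : 𝒪.stalk x) : act ⁅ξ, η⁆ g = act ξ (act η g) - act η (act ξ g) :=
  Derivation.commutator_apply (D1 := ξ.1) (D2 := η.1) g

lemma IsVectSec.act {ξ : ∀ z, 𝒪.T z} {g : ∀ z, 𝒪.stalk z} (hξ : 𝒪.IsVectSec x ξ)
    (hg : 𝒪.IsSec x g) : 𝒪.IsSec x (fun z => act (ξ z) (g z)) :=
  hξ.self_of_nhds g hg

lemma IsVectSec.eventually {ξ : ∀ z, 𝒪.T z} (h : 𝒪.IsVectSec x ξ) :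
    ∀ᶠ z in 𝓝 x, 𝒪.IsVectSec z ξ :=
  Filter.Eventually.eventually_nhds h

lemma IsVectSec.congr {ξ η : ∀ z, 𝒪.T z} (h : 𝒪.IsVectSec x ξ) (e : ∀ᶠ z in 𝓝 x, ξ z = η z) :
    𝒪.IsVectSec x η := by
  have h' : ∀ᶠ z in 𝓝 x, 𝒪.IsVectSec z ξ := h.eventually
  filter_upwards [h', e.eventually_nhds] with z h1 h2 g hg
  refine (IsVectSec.act h1 hg).congr ?_
  filter_upwards [h2] with w hw
  rw [hw]
  rfl

lemma IsVectSec.add {ξ η : ∀ z, 𝒪.T z} (h : 𝒪.IsVectSec x ξ) (h' : 𝒪.IsVectSec x η) :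
    𝒪.IsVectSec x (fun z => ξ z + η z) := by
  filter_upwards [h.eventually, h'.eventually] with z h1 h2 g hg
  exact (IsVectSec.act h1 hg).add (IsVectSec.act h2 hg)

lemma IsVectSec.smul {ξ : ∀ z, 𝒪.T z} {a : ∀ z, 𝒪.stalk z} (ha : 𝒪.IsSec x a)
    (h : 𝒪.IsVectSec x ξ) : 𝒪.IsVectSec x (fun z => a z • ξ z) := by
  filter_upwards [h.eventually, ha.eventually] with z h1 h2 g hg
  exact h2.mul (IsVectSec.act h1 hg)

lemma isVectSec_zero : 𝒪.IsVectSec x (fun _ => 0) :=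
  Eventually.of_forall fun z _ _ => 𝒪.isSec_zero z

lemma IsVectSec.lie {ξ η : ∀ z, 𝒪.T z} (h : 𝒪.IsVectSec x ξ) (h' : 𝒪.IsVectSec x η) :
    𝒪.IsVectSec x (fun z => ⁅ξ z, η z⁆) := by
  filter_upwards [h.eventually, h'.eventually] with z h1 h2 g hg
  exact (IsVectSec.act h1 (IsVectSec.act h2 hg)).sub (IsVectSec.act h2 (IsVectSec.act h1 hg))

lemma exists_isVectSec (ξ : 𝒪.T x) : ∃ η : ∀ z, 𝒪.T z, 𝒪.IsVectSec x η ∧ η x = ξ := by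
  classical
  obtain ⟨_, F, hF, rfl⟩ := ξ
  have hF' : ∀ᶠ z in 𝓝 x, 𝒪.IsDerSec z F := Filter.Eventually.eventually_nhds hF
  have hmem : ∀ z, 𝒪.IsDerSec z F → F z ∈ 𝒪.vectorFields z := fun z hz => ⟨F, hz, rfl⟩
  refine ⟨fun z => if h : 𝒪.IsDerSec z F then ⟨F z, hmem z h⟩ else 0, ?_, ?_⟩
  · filter_upwards [hF, hF'.eventually_nhds] with z h1 h2 g hg
    refine (h1 g hg).congr ?_
    filter_upwards [h2] with w hw
    simp [hw]
  · exact dif_pos hF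

/-! ### Local coordinates -/

/-- The functions `c i` and the vector fields `p i` form, near `x`, a system of local coordinates
with its partial derivatives: `p i (c j) = δ i j`, and every function `g` near a point `z` has a
Hadamard expansion `g = k + ∑ i, (c i - c i(z)) * h i`. -/
structure IsCoord (𝒪 : FunctionSheaf K X) (x : X) {d : ℕ} (c : Fin d → ∀ z, 𝒪.stalk z)
    (p : Fin d → ∀ z, 𝒪.T z) : Prop where
  coord_sec : ∀ i, 𝒪.IsSec x (c i)
  partial_sec : ∀ i, 𝒪.IsVectSec x (p i)
  dual : ∀ᶠ z in 𝓝 x, ∀ i j, act (p i z) (c j z) = if i = j then 1 else 0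
  hadamard : ∀ᶠ z in 𝓝 x, ∀ g : 𝒪.stalk z, ∃ (k : K) (h : Fin d → 𝒪.stalk z),
    g = algebraMap K _ k + ∑ i, (c i z - algebraMap K _ (value (c i z))) * h i

/-- Every point has local coordinates. -/
def HasCoords (𝒪 : FunctionSheaf K X) : Prop :=
  ∀ x, ∃ (d : ℕ) (c : Fin d → ∀ z, 𝒪.stalk z) (p : Fin d → ∀ z, 𝒪.T z), IsCoord 𝒪 x c p

lemma IsCoord.eventually {d : ℕ} {c : Fin d → ∀ z, 𝒪.stalk z} {p : Fin d → ∀ z, 𝒪.T z}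
    (h : IsCoord 𝒪 x c p) : ∀ᶠ z in 𝓝 x, IsCoord 𝒪 z c p := by
  filter_upwards [eventually_all.2 fun i => (h.coord_sec i).eventually,
    eventually_all.2 fun i => (h.partial_sec i).eventually, h.dual.eventually_nhds,
    h.hadamard.eventually_nhds] with z h1 h2 h3 h4 using ⟨h1, h2, h3, h4⟩

end FunctionSheaf

section Chain

variable {𝒪Y : FunctionSheaf K Y} {𝒪X : FunctionSheaf K X} (f : 𝒪Y.Map 𝒪X) {y : Y}

lemma FunctionSheaf.IsSec.comap {g : ∀ z, 𝒪X.stalk z} (hg : 𝒪X.IsSec (f.toFun y) g) :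
    𝒪Y.IsSec y (fun z => f.comap z (g (f.toFun z))) := by
  obtain ⟨s, hs⟩ := hg
  refine ⟨s ∘ f.toFun, ?_⟩
  filter_upwards [f.continuous.tendsto y |>.eventually hs] with z hz
  change Germ.compTendsto (g (f.toFun z)).1 _ (f.continuous.tendsto z) = _
  simp only [hz]
  rfl

lemma value_comap (g : 𝒪X.stalk (f.toFun y)) : value (f.comap y g) = value g := by
  obtain ⟨g, hg⟩ := g
  induction g using Germ.inductionOn
  rfl

lemma comap_algebraMap (k : K) : f.comap y (algebraMap K _ k) = algebraMap K _ k := by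
  refine sub_eq_zero.mp (IsSec.eq_zero_of_value (𝒪 := 𝒪Y) (x := y)
    (g := fun z => f.comap z (algebraMap K _ k) - algebraMap K _ k)
    ((IsSec.comap f (IsSec.const k)).sub (IsSec.const k)) (Eventually.of_forall fun z => ?_))
  rw [value_sub, value_comap, value_algebraMap, value_algebraMap, sub_self]

/-- The chain rule.  Both sides are derivations along `f` which are defined near `y`, and by the
Hadamard expansion at `f z` their values agree at each `z` near `y`; a function is determined by
its values. -/
theorem act_comap {d : ℕ} {c : Fin d → ∀ z, 𝒪X.stalk z} {p : Fin d → ∀ z, 𝒪X.T z}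
    (hc : IsCoord 𝒪X (f.toFun y) c p) (ξ : 𝒪Y.T y) (g : 𝒪X.stalk (f.toFun y)) :
    act ξ (f.comap y g) =
      ∑ i, act ξ (f.comap y (c i _)) * f.comap y (act (p i _) g) := by
  obtain ⟨η, hη, rfl⟩ := exists_isVectSec ξ
  obtain ⟨g, hg, rfl⟩ := 𝒪X.exists_isSec _ g
  refine sub_eq_zero.mp (IsSec.eq_zero_of_value (𝒪 := 𝒪Y) (x := y)
    (g := fun z => act (η z) (f.comap z (g (f.toFun z))) -
      ∑ i, act (η z) (f.comap z (c i _)) * f.comap z (act (p i _) (g (f.toFun z)))) ?_ ?_)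
  · exact (hη.act (hg.comap f)).sub (IsSec.sum _ fun i =>
      (hη.act ((hc.coord_sec i).comap f)).mul (((hc.partial_sec i).act hg).comap f))
  · filter_upwards [f.continuous.tendsto y |>.eventually hc.dual,
      f.continuous.tendsto y |>.eventually hc.hadamard] with z h1 h2
    obtain ⟨k, h, e⟩ := h2 (g (f.toFun z))
    rw [e]
    simp [act_algebraMap, comap_algebraMap, h1, value_comap, apply_ite value]

/-- The identity map. -/
def FunctionSheaf.idMap (𝒪 : FunctionSheaf K X) : 𝒪.Map 𝒪 where
  toFun := id
  continuous := continuous_id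
  pull _ _ h := h

lemma comap_idMap {𝒪 : FunctionSheaf K X} {x : X} (g : 𝒪.stalk x) :
    (idMap 𝒪).comap x g = g := by
  obtain ⟨g, hg⟩ := g
  induction g using Germ.inductionOn
  rfl

end Chain

namespace FunctionSheaf

variable {𝒪 : FunctionSheaf K X} {x : X} {d : ℕ} {c : Fin d → ∀ z, 𝒪.stalk z}
  {p : Fin d → ∀ z, 𝒪.T z}

lemma IsCoord.act_eq (hc : IsCoord 𝒪 x c p) (ξ : 𝒪.T x) (g : 𝒪.stalk x) :
    act ξ g = ∑ i, act ξ (c i x) * act (p i x) g := by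
  have h := act_comap (idMap 𝒪) (y := x) hc ξ g
  rw [comap_idMap] at h
  refine h.trans (Finset.sum_congr rfl fun i _ => ?_)
  exact congrArg₂ (fun a b => act ξ a * b) (comap_idMap _) (comap_idMap _)

lemma T_ext {ξ η : 𝒪.T x} (h : ∀ g, act ξ g = act η g) : ξ = η :=
  Subtype.ext (Derivation.ext h)

lemma IsCoord.T_ext (hc : IsCoord 𝒪 x c p) {ξ η : 𝒪.T x}
    (h : ∀ i, act ξ (c i x) = act η (c i x)) : ξ = η :=
  FunctionSheaf.T_ext fun g => by rw [hc.act_eq ξ, hc.act_eq η]; simp only [h]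

/-- A vector field is the combination of the partial derivatives whose coefficients are its values
on the coordinates. -/
lemma IsCoord.eq_sum (hc : IsCoord 𝒪 x c p) (ξ : 𝒪.T x) :
    ξ = ∑ i, act ξ (c i x) • p i x :=
  FunctionSheaf.T_ext fun g => by rw [hc.act_eq ξ]; simp

lemma IsCoord.dual_at (hc : IsCoord 𝒪 x c p) (i j : Fin d) :
    act (p i x) (c j x) = if i = j then 1 else 0 := hc.dual.self_of_nhds i j

lemma IsCoord.lie_eq_zero (hc : IsCoord 𝒪 x c p) (i j : Fin d) : ⁅p i x, p j x⁆ = 0 := by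
  refine hc.T_ext fun k => ?_
  have h : ∀ a b : Fin d, act (p a x) (if b = k then 1 else 0) = 0 := fun a b => by
    split_ifs <;> simp
  rw [act_lie, hc.dual_at, hc.dual_at, h, h]
  simp

lemma vectSec_eventuallyEq (hX : HasCoords 𝒪) {ξ η : ∀ z, 𝒪.T z} (hξ : 𝒪.IsVectSec x ξ)
    (hη : 𝒪.IsVectSec x η) (h : ξ x = η x) : ∀ᶠ z in 𝓝 x, ξ z = η z := by
  obtain ⟨d, c, p, hc⟩ := hX x
  have h' : ∀ i, ∀ᶠ z in 𝓝 x, act (ξ z) (c i z) = act (η z) (c i z) := fun i =>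
    (isSheaf_stalk 𝒪).separated x _ _ (hξ.act (hc.coord_sec i)) (hη.act (hc.coord_sec i))
      (congrArg (fun v => act v (c i x)) h)
  filter_upwards [eventually_all.2 h', hc.eventually] with z h1 h2
  exact h2.T_ext h1

end FunctionSheaf

/-! ### Alternating maps given by their components -/

section Components

variable {R M : Type*} [CommRing R] [AddCommGroup M] [Module R M] {d k : ℕ}

/-- A family of scalars indexed by `k`-tuples of indices which is alternating in the tuple: the
components of an alternating map. -/
structure IsAlternatingFamily (A : (Fin k → Fin d) → R) : Prop where
  eq_zero : ∀ (J : Fin k → Fin d) (a b : Fin k), a ≠ b → J a = J b → A J = 0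
  swap : ∀ (J : Fin k → Fin d) (a b : Fin k), a ≠ b → A (J ∘ Equiv.swap a b) = -A J

lemma isAlternatingFamily_apply (θ : M [⋀^Fin k]→ₗ[R] R) (v : Fin d → M) :
    IsAlternatingFamily fun J : Fin k → Fin d => θ fun i => v (J i) where
  eq_zero _ _ _ hab h := θ.map_eq_zero_of_eq _ (congrArg v h) hab
  swap J _ _ hab := θ.map_swap (fun i => v (J i)) hab

/-- The alternating map with components `A` in the coordinates `l`. -/
def altOfComponents (l : Fin d → M →ₗ[R] R) (A : (Fin k → Fin d) → R)
    (hA : IsAlternatingFamily A) : M [⋀^Fin k]→ₗ[R] R :=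
  { ∑ J : Fin k → Fin d,
      A J • (MultilinearMap.mkPiAlgebra R (Fin k) R).compLinearMap (fun i => l (J i)) with
    map_eq_zero_of_eq' := by
      classical
      intro v a b h hab
      simp only [MultilinearMap.toFun_eq_coe, sum_apply, smul_apply, MultilinearMap.compLinearMap_apply,
        MultilinearMap.mkPiAlgebra_apply, smul_eq_mul]
      have hp : ∀ J : Fin k → Fin d,
          ∏ i, l ((J ∘ Equiv.swap a b) i) (v i) = ∏ i, l (J i) (v i) := fun J => by
        rw [← Equiv.prod_comp (Equiv.swap a b) fun i => l (J i) (v i)]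
        refine Finset.prod_congr rfl fun i _ => ?_
        congr 1
        by_cases hia : i = a
        · subst hia; simp [h]
        · by_cases hib : i = b
          · subst hib; simp [h]
          · rw [Equiv.swap_apply_of_ne_of_ne hia hib]
      refine Finset.sum_involution (fun J _ => J ∘ Equiv.swap a b) (fun J _ => ?_)
        (fun J _ hJ e => hJ ?_) (fun _ _ => Finset.mem_univ _) (fun J _ => ?_)
      · rw [hp, hA.swap J a b hab]
        ring
      · have e' := congrFun e a
        simp only [Function.comp_apply, Equiv.swap_apply_left] at e'
        rw [hA.eq_zero J a b hab e'.symm, zero_mul]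
      · funext i
        simp }

lemma altOfComponents_apply (l : Fin d → M →ₗ[R] R) (A : (Fin k → Fin d) → R)
    (hA : IsAlternatingFamily A) (v : Fin k → M) :
    altOfComponents l A hA v = ∑ J : Fin k → Fin d, (∏ i, l (J i) (v i)) * A J := by
  change (∑ J : Fin k → Fin d,
      A J • (MultilinearMap.mkPiAlgebra R (Fin k) R).compLinearMap (fun i => l (J i))) v = _
  simp only [sum_apply, smul_apply,
    MultilinearMap.compLinearMap_apply, MultilinearMap.mkPiAlgebra_apply, smul_eq_mul]
  exact Finset.sum_congr rfl fun J _ => mul_comm _ _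

lemma alternatingMap_expand (θ : M [⋀^Fin k]→ₗ[R] R) {m : ℕ} (h : Fin k → Fin m → R)
    (v : Fin k → Fin m → M) :
    θ (fun i => ∑ j, h i j • v i j) =
      ∑ J : Fin k → Fin m, (∏ i, h i (J i)) * θ fun i => v i (J i) := by
  classical
  refine (θ.toMultilinearMap.map_sum fun i j => h i j • v i j).trans ?_
  exact Finset.sum_congr rfl fun J _ => θ.toMultilinearMap.map_smul_univ _ _

end Components

/-! ### Sections of the sheaves of differential forms -/

namespace FunctionSheaf

variable {𝒪 : FunctionSheaf K X} {x : X} {d k : ℕ} {c : Fin d → ∀ z, 𝒪.stalk z}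
  {p : Fin d → ∀ z, 𝒪.T z}

lemma IsCoord.form_apply (hc : IsCoord 𝒪 x c p) (θ : 𝒪.Form x k) (ξ : Fin k → 𝒪.T x) :
    θ ξ = ∑ J : Fin k → Fin d, (∏ i, act (ξ i) (c (J i) x)) * θ fun i => p (J i) x := by
  refine Eq.trans (congrArg θ (funext fun i => hc.eq_sum (ξ i))) ?_
  exact alternatingMap_expand θ (fun i j => act (ξ i) (c j x)) fun _ j => p j x

lemma IsCoord.form_ext (hc : IsCoord 𝒪 x c p) {θ θ' : 𝒪.Form x k}
    (h : ∀ J : Fin k → Fin d, θ (fun i => p (J i) x) = θ' fun i => p (J i) x) : θ = θ' := by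
  ext ξ
  rw [hc.form_apply θ, hc.form_apply θ']
  simp only [h]

lemma IsFormSec.apply {θ : ∀ z, 𝒪.Form z k} (h : 𝒪.IsFormSec x k θ) {ξ : Fin k → ∀ z, 𝒪.T z}
    (hξ : ∀ i, 𝒪.IsVectSec x (ξ i)) : 𝒪.IsSec x fun z => θ z fun i => ξ i z :=
  h.self_of_nhds ξ hξ

lemma IsFormSec.eventually {θ : ∀ z, 𝒪.Form z k} (h : 𝒪.IsFormSec x k θ) :
    ∀ᶠ z in 𝓝 x, 𝒪.IsFormSec z k θ :=
  Filter.Eventually.eventually_nhds h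

lemma IsCoord.isFormSec_iff (hc : IsCoord 𝒪 x c p) {θ : ∀ z, 𝒪.Form z k} :
    𝒪.IsFormSec x k θ ↔ ∀ J : Fin k → Fin d, 𝒪.IsSec x fun z => θ z fun i => p (J i) z := by
  refine ⟨fun h J => h.apply fun i => hc.partial_sec (J i), fun h => ?_⟩
  filter_upwards [hc.eventually, eventually_all.2 fun J => (h J).eventually] with z h1 h2 ξ hξ
  have h3 : 𝒪.IsSec z fun w => ∑ J : Fin k → Fin d,
      (∏ i, act (ξ i w) (c (J i) w)) * θ w fun i => p (J i) w :=
    IsSec.sum Finset.univ fun J => IsSec.mul (IsSec.prod Finset.univ fun i =>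
      (hξ i).act (h1.coord_sec (J i))) (h2 J)
  refine h3.congr ?_
  filter_upwards [h1.eventually] with w hw
  exact (hw.form_apply (θ w) fun i => ξ i w).symm

lemma IsFormSec.congr {θ θ' : ∀ z, 𝒪.Form z k} (h : 𝒪.IsFormSec x k θ)
    (e : ∀ᶠ z in 𝓝 x, θ z = θ' z) : 𝒪.IsFormSec x k θ' := by
  filter_upwards [h.eventually, e.eventually_nhds] with z h1 h2 ξ hξ
  refine (h1.apply hξ).congr ?_
  filter_upwards [h2] with w hw
  rw [hw]

lemma IsFormSec.add {θ θ' : ∀ z, 𝒪.Form z k} (h : 𝒪.IsFormSec x k θ) (h' : 𝒪.IsFormSec x k θ') :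
    𝒪.IsFormSec x k fun z => θ z + θ' z := by
  filter_upwards [h.eventually, h'.eventually] with z h1 h2 ξ hξ
  exact (h1.apply hξ).add (h2.apply hξ)

lemma IsFormSec.neg {θ : ∀ z, 𝒪.Form z k} (h : 𝒪.IsFormSec x k θ) :
    𝒪.IsFormSec x k fun z => -θ z := by
  filter_upwards [h.eventually] with z h1 ξ hξ
  exact (h1.apply hξ).neg

lemma IsFormSec.smul {a : ∀ z, 𝒪.stalk z} {θ : ∀ z, 𝒪.Form z k} (ha : 𝒪.IsSec x a)
    (h : 𝒪.IsFormSec x k θ) : 𝒪.IsFormSec x k fun z => a z • θ z := by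
  filter_upwards [h.eventually, ha.eventually] with z h1 h2 ξ hξ
  exact h2.mul (h1.apply hξ)

lemma isFormSec_zero : 𝒪.IsFormSec x k fun _ => 0 :=
  Eventually.of_forall fun z _ _ => 𝒪.isSec_zero z

lemma IsFormSec.sum {ι : Type*} (s : Finset ι) {θ : ι → ∀ z, 𝒪.Form z k}
    (h : ∀ i, 𝒪.IsFormSec x k (θ i)) : 𝒪.IsFormSec x k fun z => ∑ i ∈ s, θ i z := by
  classical
  induction s using Finset.induction_on with
  | empty => simpa using isFormSec_zero
  | insert a s ha ih => simpa only [Finset.sum_insert ha] using (h a).add ih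

lemma contract_apply (ξ : 𝒪.T x) (θ : 𝒪.Form x (k + 1)) (v : Fin k → 𝒪.T x) :
    contract ξ θ v = θ (Matrix.vecCons ξ v) := rfl

lemma form_sum_apply {ι : Type*} (s : Finset ι) (θ : ι → 𝒪.Form x k) (v : Fin k → 𝒪.T x) :
    (∑ i ∈ s, θ i) v = ∑ i ∈ s, θ i v :=
  map_sum (AddMonoidHom.mk' (fun θ : 𝒪.Form x k => θ v) fun _ _ => rfl) θ s

lemma IsFormSec.contract {θ : ∀ z, 𝒪.Form z (k + 1)} {ξ : ∀ z, 𝒪.T z}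
    (h : 𝒪.IsFormSec x (k + 1) θ) (hξ : 𝒪.IsVectSec x ξ) :
    𝒪.IsFormSec x k fun z => contract (ξ z) (θ z) := by
  filter_upwards [h.eventually, hξ.eventually] with z h1 h2 η hη
  refine (h1.apply (ξ := Matrix.vecCons ξ η) (Fin.cases h2 hη)).congr
    (Eventually.of_forall fun w => ?_)
  rw [contract_apply]
  congr 1
  funext i
  refine Fin.cases rfl (fun j => rfl) i

lemma IsFormSec.apply1 {α : ∀ z, 𝒪.Form z 1} {ξ : ∀ z, 𝒪.T z} (h : 𝒪.IsFormSec x 1 α)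
    (hξ : 𝒪.IsVectSec x ξ) : 𝒪.IsSec x fun z => α z ![ξ z] := by
  refine (h.apply (ξ := ![ξ]) (Fin.cases hξ (fun i => i.elim0))).congr
    (Eventually.of_forall fun w => congrArg (α w) ?_)
  funext i
  fin_cases i
  rfl

lemma IsFormSec.apply2 {α : ∀ z, 𝒪.Form z 2} {ξ η : ∀ z, 𝒪.T z} (h : 𝒪.IsFormSec x 2 α)
    (hξ : 𝒪.IsVectSec x ξ) (hη : 𝒪.IsVectSec x η) : 𝒪.IsSec x fun z => α z ![ξ z, η z] :=
  (h.contract hξ).apply1 hη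

@[simp] lemma oneForm_apply (α : 𝒪.T x →ₗ[𝒪.stalk x] 𝒪.stalk x) (ξ : 𝒪.T x) :
    oneForm α ![ξ] = α ξ := rfl

@[simp] lemma d0_apply (g : 𝒪.stalk x) (ξ : 𝒪.T x) : d0 g ![ξ] = act ξ g := rfl

lemma d1_apply (α : 𝒪.Form x 1) (ξ η : 𝒪.T x) :
    d1 α ![ξ, η] = act ξ (α ![η]) - act η (α ![ξ]) - α ![⁅ξ, η⁆] := rfl

lemma d2_apply (θ : 𝒪.Form x 2) (ξ η ζ : 𝒪.T x) :
    d2 θ ![ξ, η, ζ] = act ξ (θ ![η, ζ]) - act η (θ ![ξ, ζ]) + act ζ (θ ![ξ, η])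
      - θ ![⁅ξ, η⁆, ζ] + θ ![⁅ξ, ζ⁆, η] - θ ![⁅η, ζ⁆, ξ] := rfl

lemma lieDeriv_apply (ξ : 𝒪.T x) (α : 𝒪.Form x 1) (η : 𝒪.T x) :
    lieDeriv ξ α ![η] = act ξ (α ![η]) - α ![⁅ξ, η⁆] := by
  change d1 α ![ξ, η] + act η (α ![ξ]) = _
  rw [d1_apply]
  ring

lemma form1_ext {α β : 𝒪.Form x 1} (h : ∀ ξ, α ![ξ] = β ![ξ]) : α = β := by
  ext ξ
  have e : ξ = ![ξ 0] := funext fun i => by fin_cases i; rfl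
  rw [e, h]

lemma form2_ext {α β : 𝒪.Form x 2} (h : ∀ ξ η, α ![ξ, η] = β ![ξ, η]) : α = β := by
  ext ξ
  have e : ξ = ![ξ 0, ξ 1] := funext fun i => by fin_cases i <;> rfl
  rw [e, h]

lemma form3_ext {α β : 𝒪.Form x 3} (h : ∀ ξ η ζ, α ![ξ, η, ζ] = β ![ξ, η, ζ]) : α = β := by
  ext ξ
  have e : ξ = ![ξ 0, ξ 1, ξ 2] := funext fun i => by fin_cases i <;> rfl
  rw [e, h]

lemma isFormSec_one_iff {α : ∀ z, 𝒪.Form z 1} (h : ∀ᶠ z in 𝓝 x, ∀ ξ : ∀ z, 𝒪.T z,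
    𝒪.IsVectSec z ξ → 𝒪.IsSec z fun w => α w ![ξ w]) : 𝒪.IsFormSec x 1 α := by
  filter_upwards [h] with z hz ξ hξ
  refine (hz _ (hξ 0)).congr (Eventually.of_forall fun w => congrArg (α w) ?_)
  exact funext fun i => by fin_cases i; rfl

lemma IsSec.d0 {g : ∀ z, 𝒪.stalk z} (hg : 𝒪.IsSec x g) : 𝒪.IsFormSec x 1 fun z => d0 (g z) := by
  refine isFormSec_one_iff ?_
  filter_upwards [hg.eventually] with z hz ξ hξ
  exact hξ.act hz

lemma IsFormSec.d1 {α : ∀ z, 𝒪.Form z 1} (h : 𝒪.IsFormSec x 1 α) :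
    𝒪.IsFormSec x 2 fun z => d1 (α z) := by
  filter_upwards [h.eventually] with z hz ξ hξ
  exact (((hξ 0).act (hz.apply1 (hξ 1))).sub ((hξ 1).act (hz.apply1 (hξ 0)))).sub
    (hz.apply1 ((hξ 0).lie (hξ 1)))

lemma IsFormSec.d2 {α : ∀ z, 𝒪.Form z 2} (h : 𝒪.IsFormSec x 2 α) :
    𝒪.IsFormSec x 3 fun z => d2 (α z) := by
  filter_upwards [h.eventually] with z hz ξ hξ
  exact ((((((hξ 0).act (hz.apply2 (hξ 1) (hξ 2))).sub ((hξ 1).act (hz.apply2 (hξ 0) (hξ 2)))).add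
    ((hξ 2).act (hz.apply2 (hξ 0) (hξ 1)))).sub (hz.apply2 ((hξ 0).lie (hξ 1)) (hξ 2))).add
    (hz.apply2 ((hξ 0).lie (hξ 2)) (hξ 1))).sub (hz.apply2 ((hξ 1).lie (hξ 2)) (hξ 0))

lemma IsFormSec.lieDeriv {α : ∀ z, 𝒪.Form z 1} {ξ : ∀ z, 𝒪.T z} (h : 𝒪.IsFormSec x 1 α)
    (hξ : 𝒪.IsVectSec x ξ) : 𝒪.IsFormSec x 1 fun z => lieDeriv (ξ z) (α z) :=
  (h.d1.contract hξ).add (h.apply1 hξ).d0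

lemma isSheaf_form (hX : HasCoords 𝒪) (k : ℕ) :
    IsSheaf (fun x => 𝒪.Form x k) (fun x θ => 𝒪.IsFormSec x k θ) where
  isOpen _ _ h := h.eventually
  congr _ _ _ h e := h.congr e
  separated x θ θ' h h' e := by
    obtain ⟨d, c, p, hc⟩ := hX x
    have : ∀ J : Fin k → Fin d, ∀ᶠ z in 𝓝 x, θ z (fun i => p (J i) z) = θ' z fun i => p (J i) z :=
      fun J => (isSheaf_stalk 𝒪).separated x _ _ (hc.isFormSec_iff.1 h J)
        (hc.isFormSec_iff.1 h' J) (by rw [e])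
    filter_upwards [eventually_all.2 this, hc.eventually] with z h1 h2 using h2.form_ext h1
  extend x θ := by
    classical
    obtain ⟨d, c, p, hc⟩ := hX x
    -- The components extend to sections, which are still alternating near `x`.
    choose A hA hAx using fun J : Fin k → Fin d => 𝒪.exists_isSec x (θ fun i => p (J i) x)
    have hθ := isAlternatingFamily_apply θ fun i => p i x
    have sep : ∀ g h : ∀ z, 𝒪.stalk z, 𝒪.IsSec x g → 𝒪.IsSec x h → g x = h x →
        ∀ᶠ z in 𝓝 x, g z = h z := fun g h => (isSheaf_stalk 𝒪).separated x g h
    have alt : ∀ᶠ z in 𝓝 x, IsAlternatingFamily fun J => A J z := by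
      have h0 : ∀ J a b, ∀ᶠ z in 𝓝 x, a ≠ b → J a = J b → A J z = 0 := fun J a b => by
        by_cases hab : a ≠ b
        · by_cases hJ : J a = J b
          · filter_upwards [sep _ _ (hA J) (𝒪.isSec_zero x)
              ((hAx J).trans (hθ.eq_zero J a b hab hJ))] with z hz _ _ using hz
          · exact Eventually.of_forall fun z _ h => absurd h hJ
        · exact Eventually.of_forall fun z h => absurd h hab
      have h1 : ∀ J a b, ∀ᶠ z in 𝓝 x, a ≠ b → A (J ∘ Equiv.swap a b) z = -A J z := fun J a b => by
        by_cases hab : a ≠ b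
        · filter_upwards [sep _ _ (hA (J ∘ Equiv.swap a b)) (hA J).neg
            ((hAx _).trans ((hθ.swap J a b hab).trans (congrArg Neg.neg (hAx J).symm)))]
            with z hz _ using hz
        · exact Eventually.of_forall fun z h => absurd h hab
      filter_upwards [eventually_all.2 fun J => eventually_all.2 fun a => eventually_all.2 (h0 J a),
        eventually_all.2 fun J => eventually_all.2 fun a => eventually_all.2 (h1 J a)]
        with z h0 h1 using ⟨h0, h1⟩
    have key : ∀ z, IsCoord 𝒪 z c p → ∀ h : IsAlternatingFamily fun J => A J z,
        ∀ J : Fin k → Fin d,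
        altOfComponents (fun i => actLin (c i z)) _ h (fun i => p (J i) z) = A J z := by
      intro z hz h J
      rw [altOfComponents_apply, Finset.sum_eq_single J]
      · simp [hz.dual_at]
      · intro L _ hL
        obtain ⟨i, hi⟩ : ∃ i, L i ≠ J i := by
          by_contra hcon
          push Not at hcon
          exact hL (funext hcon)
        rw [Finset.prod_eq_zero (Finset.mem_univ i), zero_mul]
        simp [hz.dual_at, hi.symm]
      · simp
    refine ⟨fun z => if h : IsAlternatingFamily fun J => A J z then
      altOfComponents (fun i => actLin (c i z)) _ h else 0, hc.isFormSec_iff.2 fun J => ?_, ?_⟩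
    · refine (hA J).congr ?_
      filter_upwards [alt, hc.eventually] with z h1 h2
      rw [dif_pos h1, key z h2]
    · refine hc.form_ext fun J => ?_
      beta_reduce
      rw [dif_pos alt.self_of_nhds, key x hc, hAx]

end FunctionSheaf

/-! ### The differential of a map -/

section Pullback

variable {𝒪Y : FunctionSheaf K Y} {𝒪X : FunctionSheaf K X} (f : 𝒪Y.Map 𝒪X) {y : Y}
  {d : ℕ} {c : Fin d → ∀ z, 𝒪X.stalk z} {p : Fin d → ∀ z, 𝒪X.T z}

lemma smul_stalk_def (g : 𝒪X.stalk (f.toFun y)) (h : 𝒪Y.stalk y) : g • h = f.comap y g * h := rfl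

@[simp] lemma actAlong_tmul (h : 𝒪Y.stalk y) (v : 𝒪X.T (f.toFun y)) (g : 𝒪X.stalk (f.toFun y)) :
    actAlong f y (h ⊗ₜ v) g = h * f.comap y (act v g) := rfl

lemma actAlong_sum {ι : Type*} (s : Finset ι) (t : ι → PullStalk f y (𝒪X.T (f.toFun y)))
    (g : 𝒪X.stalk (f.toFun y)) :
    actAlong f y (∑ i ∈ s, t i) g = ∑ i ∈ s, actAlong f y (t i) g := by
  rw [map_sum, Finset.sum_apply]

@[simp] lemma actAlong_sum_tmul {m : ℕ} (h : Fin m → 𝒪Y.stalk y) (v : Fin m → 𝒪X.T (f.toFun y))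
    (g : 𝒪X.stalk (f.toFun y)) :
    actAlong f y (∑ i, h i ⊗ₜ v i) g = ∑ i, h i * f.comap y (act (v i) g) := by
  rw [actAlong_sum]
  rfl

lemma pullStalk_eq_sum (hc : IsCoord 𝒪X (f.toFun y) c p)
    (t : PullStalk f y (𝒪X.T (f.toFun y))) :
    t = ∑ i, actAlong f y t (c i _) ⊗ₜ p i _ := by
  induction t using TensorProduct.induction_on with
  | zero => simp
  | add t s ht hs =>
    simp only [map_add, Pi.add_apply, TensorProduct.add_tmul, Finset.sum_add_distrib, ← ht, ← hs]
  | tmul h v =>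
    conv_lhs => rw [hc.eq_sum v]
    rw [TensorProduct.tmul_sum]
    refine Finset.sum_congr rfl fun i _ => ?_
    rw [← TensorProduct.smul_tmul, smul_stalk_def, mul_comm, actAlong_tmul]

lemma pullStalk_ext (hc : IsCoord 𝒪X (f.toFun y) c p)
    {t s : PullStalk f y (𝒪X.T (f.toFun y))}
    (h : ∀ i, actAlong f y t (c i _) = actAlong f y s (c i _)) : t = s := by
  rw [pullStalk_eq_sum f hc t, pullStalk_eq_sum f hc s]
  simp only [h]

lemma isDifferential_coord (hc : IsCoord 𝒪X (f.toFun y) c p) (ξ : 𝒪Y.T y) :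
    IsDifferential f y ξ (∑ i, act ξ (f.comap y (c i _)) ⊗ₜ p i _) := by
  intro g
  rw [actAlong_sum_tmul, act_comap f hc ξ g]

lemma IsDifferential.unique (hX : HasCoords 𝒪X) {ξ : 𝒪Y.T y}
    {t s : PullStalk f y (𝒪X.T (f.toFun y))}
    (ht : IsDifferential f y ξ t) (hs : IsDifferential f y ξ s) : t = s := by
  obtain ⟨d, c, p, hc⟩ := hX (f.toFun y)
  exact pullStalk_ext f hc fun i => (ht _).trans (hs _).symm

lemma exists_isDifferential (hX : HasCoords 𝒪X) (ξ : 𝒪Y.T y) :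
    ∃ (m : ℕ) (h : Fin m → 𝒪Y.stalk y) (v : Fin m → 𝒪X.T (f.toFun y)),
      IsDifferential f y ξ (∑ i, h i ⊗ₜ v i) := by
  obtain ⟨d, c, p, hc⟩ := hX (f.toFun y)
  exact ⟨d, _, _, isDifferential_coord f hc ξ⟩

lemma IsDifferential.act_comap {ξ : 𝒪Y.T y} {m : ℕ} {h : Fin m → 𝒪Y.stalk y}
    {v : Fin m → 𝒪X.T (f.toFun y)} (H : IsDifferential f y ξ (∑ i, h i ⊗ₜ v i))
    (g : 𝒪X.stalk (f.toFun y)) :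
    act ξ (f.comap y g) = ∑ i, h i * f.comap y (act (v i) g) := by
  rw [← H g, actAlong_sum_tmul]

lemma IsDifferential.lie {ξ η : 𝒪Y.T y} {m l : ℕ} {h : Fin m → 𝒪Y.stalk y}
    {v : Fin m → 𝒪X.T (f.toFun y)} {j : Fin l → 𝒪Y.stalk y}
    {w : Fin l → 𝒪X.T (f.toFun y)} (H : IsDifferential f y ξ (∑ i, h i ⊗ₜ v i))
    (H' : IsDifferential f y η (∑ i, j i ⊗ₜ w i)) :
    IsDifferential f y ⁅ξ, η⁆ (∑ i, ∑ k, (h i * j k) ⊗ₜ ⁅v i, w k⁆ - ∑ i, act η (h i) ⊗ₜ v i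
        + ∑ k, act ξ (j k) ⊗ₜ w k) := by
  intro g
  rw [map_add, map_sub, Pi.add_apply, Pi.sub_apply, actAlong_sum, actAlong_sum_tmul,
    actAlong_sum_tmul, act_lie, H.act_comap, H'.act_comap, act_sum, act_sum]
  simp only [actAlong_sum, actAlong_tmul, act_mul, H.act_comap, H'.act_comap, act_lie, map_sub,
    mul_sub, Finset.sum_sub_distrib, Finset.sum_add_distrib, Finset.mul_sum]
  rw [Finset.sum_comm (γ := Fin l)]
  have e1 : ∀ i k, h i * j k * f.comap y (act (v i) (act (w k) g)) =
      j k * (h i * f.comap y (act (v i) (act (w k) g))) := fun i k => by ring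
  have e2 : ∀ i k, h i * j k * f.comap y (act (w k) (act (v i) g)) =
      h i * (j k * f.comap y (act (w k) (act (v i) g))) := fun i k => by ring
  simp only [e1, e2]
  ring

/-! ### Inverse images of differential forms -/

theorem existsUnique_isFormPullback (hX : HasCoords 𝒪X) {k : ℕ} (θ : 𝒪X.Form (f.toFun y) k) :
    ∃! θ', IsFormPullback f y θ θ' := by
  classical
  obtain ⟨d, c, p, hc⟩ := hX (f.toFun y)
  have hA : IsAlternatingFamily fun J : Fin k → Fin d => f.comap y (θ fun i => p (J i) _) :=
    ⟨fun J a b hab h => by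
      rw [(isAlternatingFamily_apply θ fun i => p i _).eq_zero J a b hab h, map_zero],
     fun J a b hab => by
      rw [(isAlternatingFamily_apply θ fun i => p i _).swap J a b hab, map_neg]⟩
  refine ⟨altOfComponents (fun i => actLin (f.comap y (c i _))) _ hA, ?_, ?_⟩
  · intro ξ m h v H
    rw [altOfComponents_apply]
    have e : ∀ J : Fin k → Fin m, f.comap y (θ fun i => v i (J i)) =
        ∑ L : Fin k → Fin d, (∏ i, f.comap y (act (v i (J i)) (c (L i) _))) *
          f.comap y (θ fun i => p (L i) _) := fun J => by
      rw [hc.form_apply θ, map_sum]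
      simp only [map_mul, map_prod]
    simp only [e, Finset.mul_sum, actLin_apply]
    rw [Finset.sum_comm]
    refine Finset.sum_congr rfl fun L _ => ?_
    have e' : ∀ i, act (ξ i) (f.comap y (c (L i) _)) =
        ∑ j, h i j * f.comap y (act (v i j) (c (L i) _)) := fun i => (H i).act_comap f _
    simp only [e', ← mul_assoc, ← Finset.prod_mul_distrib]
    rw [Finset.prod_univ_sum, Fintype.piFinset_univ, Finset.sum_mul]
  · intro θ' h
    ext ξ
    rw [h ξ d _ _ fun i => isDifferential_coord f hc (ξ i), altOfComponents_apply]
    rfl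

lemma isFormPullback_pullForm (hX : HasCoords 𝒪X) {k : ℕ} (θ : 𝒪X.Form (f.toFun y) k) :
    IsFormPullback f y θ (pullForm f y θ) :=
  Classical.epsilon_spec (existsUnique_isFormPullback f hX θ).exists

lemma pullForm_apply_coord (hX : HasCoords 𝒪X) (hc : IsCoord 𝒪X (f.toFun y) c p)
    {k : ℕ} (θ : 𝒪X.Form (f.toFun y) k) (ξ : Fin k → 𝒪Y.T y) :
    pullForm f y θ ξ = ∑ J : Fin k → Fin d,
      (∏ i, act (ξ i) (f.comap y (c (J i) _))) * f.comap y (θ fun i => p (J i) _) :=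
  isFormPullback_pullForm f hX θ ξ d _ _ fun i => isDifferential_coord f hc (ξ i)

lemma pullForm_add (hX : HasCoords 𝒪X) {k : ℕ} (θ θ' : 𝒪X.Form (f.toFun y) k) :
    pullForm f y (θ + θ') = pullForm f y θ + pullForm f y θ' := by
  obtain ⟨d, c, p, hc⟩ := hX (f.toFun y)
  ext ξ
  simp only [pullForm_apply_coord f hX hc, AlternatingMap.add_apply, map_add, mul_add,
    Finset.sum_add_distrib]

lemma pullForm_smul (hX : HasCoords 𝒪X) {k : ℕ} (g : 𝒪X.stalk (f.toFun y))
    (θ : 𝒪X.Form (f.toFun y) k) : pullForm f y (g • θ) = f.comap y g • pullForm f y θ := by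
  obtain ⟨d, c, p, hc⟩ := hX (f.toFun y)
  ext ξ
  simp only [pullForm_apply_coord f hX hc, AlternatingMap.smul_apply, smul_eq_mul, map_mul,
    Finset.mul_sum]
  exact Finset.sum_congr rfl fun J _ => by ring

/-- Pull-back of forms, as a homomorphism of groups. -/
def pullFormHom (hX : HasCoords 𝒪X) (y : Y) (k : ℕ) :
    𝒪X.Form (f.toFun y) k →+ 𝒪Y.Form y k :=
  AddMonoidHom.mk' (pullForm f y) (pullForm_add f hX)

lemma pullForm_zero (hX : HasCoords 𝒪X) {k : ℕ} :
    pullForm f y (0 : 𝒪X.Form (f.toFun y) k) = 0 := map_zero (pullFormHom f hX y k)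

lemma pullForm_sub (hX : HasCoords 𝒪X) {k : ℕ} (θ θ' : 𝒪X.Form (f.toFun y) k) :
    pullForm f y (θ - θ') = pullForm f y θ - pullForm f y θ' := map_sub (pullFormHom f hX y k) θ θ'

lemma pullForm_sum (hX : HasCoords 𝒪X) {k : ℕ} {ι : Type*} (s : Finset ι)
    (θ : ι → 𝒪X.Form (f.toFun y) k) : pullForm f y (∑ i ∈ s, θ i) = ∑ i ∈ s, pullForm f y (θ i) :=
  map_sum (pullFormHom f hX y k) θ s

lemma FunctionSheaf.IsFormSec.pullForm (hX : HasCoords 𝒪X) {k : ℕ} {θ : ∀ x, 𝒪X.Form x k}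
    (h : 𝒪X.IsFormSec (f.toFun y) k θ) :
    𝒪Y.IsFormSec y k fun z => pullForm f z (θ (f.toFun z)) := by
  obtain ⟨d, c, p, hc⟩ := hX (f.toFun y)
  have hf := f.continuous.tendsto y
  filter_upwards [hf.eventually hc.eventually, hf.eventually h.eventually] with z h1 h2 ξ hξ
  have h3 : 𝒪Y.IsSec z fun w => ∑ J : Fin k → Fin d,
      (∏ i, act (ξ i w) (f.comap w (c (J i) _))) *
        f.comap w (θ (f.toFun w) fun i => p (J i) _) :=
    IsSec.sum Finset.univ fun J => IsSec.mul (IsSec.prod Finset.univ fun i =>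
      (hξ i).act ((h1.coord_sec (J i)).comap f))
      ((h2.apply fun i => h1.partial_sec (J i)).comap f)
  refine h3.congr ?_
  filter_upwards [f.continuous.tendsto z |>.eventually h1.eventually] with w hw
  exact (pullForm_apply_coord f hX hw (θ (f.toFun w)) fun i => ξ i w).symm

/-- If `df(ξ) = ∑ i, h i ⊗ v i`, then `ι_ξ (f^*θ) = ∑ i, h i f^*(ι_{v i} θ)`. -/
lemma contract_pullForm (hX : HasCoords 𝒪X) {ξ : 𝒪Y.T y} {m : ℕ} {h : Fin m → 𝒪Y.stalk y}
    {v : Fin m → 𝒪X.T (f.toFun y)} (H : IsDifferential f y ξ (∑ i, h i ⊗ₜ v i)) {k : ℕ}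
    (θ : 𝒪X.Form (f.toFun y) (k + 1)) :
    contract ξ (pullForm f y θ) = ∑ i, h i • pullForm f y (contract (v i) θ) := by
  obtain ⟨d, c, p, hc⟩ := hX (f.toFun y)
  -- Both sides are expanded in the components of `θ`.
  have key : ∀ ζ : Fin k → 𝒪Y.T y, contract ξ (pullForm f y θ) ζ =
      ∑ a, act ξ (f.comap y (c a _)) * pullForm f y (contract (p a _) θ) ζ := by
    intro ζ
    rw [contract_apply, pullForm_apply_coord f hX hc,
      ← (Fin.consEquiv fun _ : Fin (k + 1) => Fin d).sum_comp, Fintype.sum_prod_type]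
    refine Finset.sum_congr rfl fun a _ => ?_
    rw [pullForm_apply_coord f hX hc, Finset.mul_sum]
    refine Finset.sum_congr rfl fun J _ => ?_
    rw [Fin.prod_univ_succ, ← mul_assoc]
    refine congrArg₂ (· * ·) rfl (congrArg _ ?_)
    rw [contract_apply]
    congr 1
    funext i
    refine Fin.cases rfl (fun j => rfl) i
  ext ζ
  rw [key]
  have e : ∀ i, contract (v i) θ = ∑ a, act (v i) (c a _) • contract (p a _) θ := fun i => by
    conv_lhs => rw [hc.eq_sum (v i)]
    simp only [contract, map_sum, map_smul]
  simp only [e, H.act_comap, pullForm_sum f hX, pullForm_smul f hX, form_sum_apply,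
    AlternatingMap.smul_apply, Finset.mul_sum, Finset.sum_mul, smul_eq_mul]
  rw [Finset.sum_comm]
  exact Finset.sum_congr rfl fun i _ => Finset.sum_congr rfl fun a _ => by ring

lemma pullForm_zero_form (hX : HasCoords 𝒪X) (θ : 𝒪X.Form (f.toFun y) 0) (v : Fin 0 → 𝒪Y.T y) :
    pullForm f y θ v = f.comap y (θ ![]) := by
  obtain ⟨d, c, p, hc⟩ := hX (f.toFun y)
  rw [pullForm_apply_coord f hX hc]
  simp only [Finset.univ_eq_empty, Finset.prod_empty, one_mul, Finset.univ_unique,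
    Finset.sum_singleton]
  exact congrArg (fun v => f.comap y (θ v)) (Subsingleton.elim _ _)

lemma pullForm_one_apply (hX : HasCoords 𝒪X) {ξ : 𝒪Y.T y} {m : ℕ} {h : Fin m → 𝒪Y.stalk y}
    {v : Fin m → 𝒪X.T (f.toFun y)} (H : IsDifferential f y ξ (∑ i, h i ⊗ₜ v i))
    (γ : 𝒪X.Form (f.toFun y) 1) :
    pullForm f y γ ![ξ] = ∑ i, h i * f.comap y (γ ![v i]) := by
  have e := congrArg (fun α : 𝒪Y.Form y 0 => α ![]) (contract_pullForm f hX H γ)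
  simp only [form_sum_apply, AlternatingMap.smul_apply, pullForm_zero_form f hX, smul_eq_mul] at e
  exact e

lemma pullForm_d0 (hX : HasCoords 𝒪X) (g : 𝒪X.stalk (f.toFun y)) :
    pullForm f y (d0 g) = d0 (f.comap y g) := by
  refine form1_ext fun ξ => ?_
  obtain ⟨m, h, v, H⟩ := exists_isDifferential f hX ξ
  rw [pullForm_one_apply f hX H, d0_apply, H.act_comap]
  rfl

end Pullback

/-! ### Pull-back and the de Rham differential -/

section ContractionSums

variable {S : Type*} [CommRing S] {d : ℕ}

/-- The contraction `∑ i, a i * B i`. -/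
def con (B a : Fin d → S) : S := ∑ i, a i * B i

lemma con_add (B C a : Fin d → S) : con (fun i => B i + C i) a = con B a + con C a := by
  simp [con, mul_add, Finset.sum_add_distrib]

lemma con_sub (B C a : Fin d → S) : con (fun i => B i - C i) a = con B a - con C a := by
  simp [con, mul_sub, Finset.sum_sub_distrib]

lemma con_neg (B a : Fin d → S) : con (fun i => -B i) a = -con B a := by
  simp [con]

lemma con_zero (a : Fin d → S) : con (fun _ => 0) a = 0 := by
  simp [con]

lemma con_vec_sub (B a b : Fin d → S) : con B (fun i => a i - b i) = con B a - con B b := by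
  simp [con, sub_mul, Finset.sum_sub_distrib]

lemma con_swap (B : Fin d → Fin d → S) (a b : Fin d → S) :
    con (fun i => con (B i) b) a = con (fun j => con (fun i => B i j) a) b := by
  simp only [con, Finset.mul_sum]
  rw [Finset.sum_comm]
  exact Finset.sum_congr rfl fun i _ => Finset.sum_congr rfl fun j _ => by ring

/-- Contraction of a bilinear form with two vectors. -/
def con2 (B : Fin d → Fin d → S) (a b : Fin d → S) : S := con (fun i => con (B i) b) a

/-- Contraction of a trilinear form with three vectors. -/
def con3 (B : Fin d → Fin d → Fin d → S) (a b e : Fin d → S) : S :=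
  con (fun i => con2 (B i) b e) a

/-- Contraction of a quadrilinear form with four vectors. -/
def con4 (B : Fin d → Fin d → Fin d → Fin d → S) (a b e g : Fin d → S) : S :=
  con (fun i => con3 (B i) b e g) a

lemma con2_swap (B : Fin d → Fin d → S) (a b : Fin d → S) :
    con2 B a b = con2 (fun i j => B j i) b a := con_swap B a b

lemma con3_swap (B : Fin d → Fin d → Fin d → S) (a b e : Fin d → S) :
    con3 B a b e = con3 (fun i j => B j i) b a e := con_swap (fun i j => con (B i j) e) a b

lemma con3_swap' (B : Fin d → Fin d → Fin d → S) (a b e : Fin d → S) :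
    con3 B a b e = con3 (fun i j k => B i k j) a e b :=
  congrArg (fun F => con F a) (funext fun i => con2_swap (B i) b e)

lemma con4_swap (B : Fin d → Fin d → Fin d → Fin d → S) (a b e g : Fin d → S) :
    con4 B a b e g = con4 (fun i j => B j i) b a e g := con_swap (fun i j => con2 (B i j) e g) a b

lemma con4_swap' (B : Fin d → Fin d → Fin d → Fin d → S) (a b e g : Fin d → S) :
    con4 B a b e g = con4 (fun i j k => B i k j) a e b g :=
  congrArg (fun F => con F a) (funext fun i => con3_swap (B i) b e g)

lemma con4_swap'' (B : Fin d → Fin d → Fin d → Fin d → S) (a b e g : Fin d → S) :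
    con4 B a b e g = con4 (fun i j k l => B i j l k) a b g e :=
  congrArg (fun F => con F a) (funext fun i => con3_swap' (B i) b e g)

end ContractionSums

namespace FunctionSheaf

variable {𝒪 : FunctionSheaf K X} {x : X} {d : ℕ}

lemma act_con (ξ : 𝒪.T x) (B a : Fin d → 𝒪.stalk x) :
    act ξ (con B a) = con B (fun i => act ξ (a i)) + con (fun i => act ξ (B i)) a := by
  simp only [con, act_sum, act_mul, Finset.sum_add_distrib]
  rw [add_comm]

lemma act_con2 (ξ : 𝒪.T x) (B : Fin d → Fin d → 𝒪.stalk x) (a b : Fin d → 𝒪.stalk x) :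
    act ξ (con2 B a b) = con2 B (fun i => act ξ (a i)) b + con2 B a (fun i => act ξ (b i)) +
      con2 (fun i j => act ξ (B i j)) a b := by
  simp only [con2, act_con, con_add]
  ring

lemma act_con3 (ξ : 𝒪.T x) (B : Fin d → Fin d → Fin d → 𝒪.stalk x) (a b e : Fin d → 𝒪.stalk x) :
    act ξ (con3 B a b e) = con3 B (fun i => act ξ (a i)) b e + con3 B a (fun i => act ξ (b i)) e +
      con3 B a b (fun i => act ξ (e i)) + con3 (fun i j k => act ξ (B i j k)) a b e := by
  simp only [con3, act_con, act_con2, con_add]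
  ring

lemma form3_swap (H : 𝒪.Form x 3) (ξ η ζ : 𝒪.T x) : H ![ξ, η, ζ] = -H ![η, ξ, ζ] := by
  rw [← H.map_swap ![η, ξ, ζ] (i := 0) (j := 1) (by decide)]
  congr 1
  funext i
  fin_cases i <;> rfl

lemma form3_swap' (H : 𝒪.Form x 3) (ξ η ζ : 𝒪.T x) : H ![ξ, η, ζ] = -H ![ξ, ζ, η] := by
  rw [← H.map_swap ![ξ, ζ, η] (i := 1) (j := 2) (by decide)]
  congr 1
  funext i
  fin_cases i <;> rfl

lemma lie_lie' (a b e : 𝒪.T x) : ⁅⁅a, b⁆, e⁆ = ⁅a, ⁅b, e⁆⁆ - ⁅b, ⁅a, e⁆⁆ :=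
  Subtype.ext (lie_lie a.1 b.1 e.1)

lemma lie_neg_right (ξ η : 𝒪.T x) : ⁅ξ, -η⁆ = -⁅ξ, η⁆ := Subtype.ext (lie_neg ξ.1 η.1)

lemma isClosedForm_d2 (θ : 𝒪.Form x 2) : IsClosedForm (d2 θ) := by
  have cyc : ∀ a b e : 𝒪.T x, ⁅e, ⁅a, b⁆⁆ = ⁅b, ⁅a, e⁆⁆ - ⁅a, ⁅b, e⁆⁆ := fun a b e => by
    rw [lie_neg_swap, lie_lie', neg_sub]
  intro a b e g
  simp only [d2_apply, act_add, act_sub, act_lie, lie_lie', lie_neg_swap g a, lie_neg_swap g b,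
    lie_neg_swap g e, lie_neg_swap e a, lie_neg_swap e b, lie_neg_swap b a, lie_neg_right,
    cyc a b e, cyc a b g, cyc a e g, cyc b e g, map_sub_fst, map_neg_fst,
    form2_swap θ ⁅e, g⁆, form2_swap θ ⁅b, g⁆, form2_swap θ ⁅b, e⁆ ⁅a, g⁆]
  ring

lemma act_lie_fun (ξ η : 𝒪.T x) (a : Fin d → 𝒪.stalk x) :
    (fun i => act ⁅ξ, η⁆ (a i)) = fun i => act ξ (act η (a i)) - act η (act ξ (a i)) :=
  funext fun i => act_lie ξ η (a i)

end FunctionSheaf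

section Pullback

variable {𝒪Y : FunctionSheaf K Y} {𝒪X : FunctionSheaf K X} (f : 𝒪Y.Map 𝒪X) {y : Y}
  {d : ℕ} {c : Fin d → ∀ z, 𝒪X.stalk z} {p : Fin d → ∀ z, 𝒪X.T z}

/-- The components of `df(ξ)` in the coordinates `c`. -/
def comp (c : Fin d → ∀ z, 𝒪X.stalk z) (ξ : 𝒪Y.T y) (i : Fin d) : 𝒪Y.stalk y :=
  act ξ (f.comap y (c i (f.toFun y)))

lemma comp_lie (ξ η : 𝒪Y.T y) :
    comp f c ⁅ξ, η⁆ = fun i => act ξ (comp f c η i) - act η (comp f c ξ i) :=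
  act_lie_fun ξ η _

lemma act_comap_con (hc : IsCoord 𝒪X (f.toFun y) c p) (ξ : 𝒪Y.T y) (g : 𝒪X.stalk (f.toFun y)) :
    act ξ (f.comap y g) = con (fun l => f.comap y (act (p l _) g)) (comp f c ξ) :=
  act_comap f hc ξ g

lemma pullForm_one_con (hX : HasCoords 𝒪X) (hc : IsCoord 𝒪X (f.toFun y) c p)
    (γ : 𝒪X.Form (f.toFun y) 1) (ξ : 𝒪Y.T y) :
    pullForm f y γ ![ξ] = con (fun i => f.comap y (γ ![p i _])) (comp f c ξ) :=
  pullForm_one_apply f hX (isDifferential_coord f hc ξ) γ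

lemma pullForm_contract_coord (hX : HasCoords 𝒪X) (hc : IsCoord 𝒪X (f.toFun y) c p) {k : ℕ}
    (θ : 𝒪X.Form (f.toFun y) (k + 1)) (ξ : 𝒪Y.T y) (v : Fin k → 𝒪Y.T y) :
    pullForm f y θ (Matrix.vecCons ξ v) =
      con (fun i => pullForm f y (contract (p i _) θ) v) (comp f c ξ) := by
  rw [← contract_apply, contract_pullForm f hX (isDifferential_coord f hc ξ), form_sum_apply]
  rfl

lemma pullForm_two_con (hX : HasCoords 𝒪X) (hc : IsCoord 𝒪X (f.toFun y) c p)
    (θ : 𝒪X.Form (f.toFun y) 2) (ξ η : 𝒪Y.T y) :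
    pullForm f y θ ![ξ, η] =
      con2 (fun i j => f.comap y (θ ![p i _, p j _])) (comp f c ξ) (comp f c η) := by
  rw [pullForm_contract_coord f hX hc]
  simp only [pullForm_one_con f hX hc]
  rfl

lemma pullForm_three_con (hX : HasCoords 𝒪X) (hc : IsCoord 𝒪X (f.toFun y) c p)
    (θ : 𝒪X.Form (f.toFun y) 3) (ξ η ζ : 𝒪Y.T y) :
    pullForm f y θ ![ξ, η, ζ] = con3 (fun i j k => f.comap y (θ ![p i _, p j _, p k _]))
      (comp f c ξ) (comp f c η) (comp f c ζ) := by
  rw [pullForm_contract_coord f hX hc]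
  simp only [pullForm_two_con f hX hc]
  rfl

/-- In coordinates the vector fields `p i` commute, so only the derivatives of the components of `γ`
and, on the other side, second derivatives of the `f^*c i` occur; the latter cancel with the term
of the commutator. -/
theorem pullForm_d1 (hX : HasCoords 𝒪X) (γ : 𝒪X.Form (f.toFun y) 1) :
    pullForm f y (d1 γ) = d1 (pullForm f y γ) := by
  obtain ⟨d, c, p, hc⟩ := hX (f.toFun y)
  refine form2_ext fun ξ η => ?_
  have hL : pullForm f y (d1 γ) ![ξ, η] =
      con2 (fun i j => f.comap y (act (p i _) (γ ![p j _]))) (comp f c ξ) (comp f c η) -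
      con2 (fun i j => f.comap y (act (p j _) (γ ![p i _]))) (comp f c ξ) (comp f c η) := by
    rw [pullForm_two_con f hX hc]
    simp only [d1_apply, hc.lie_eq_zero, map_zero_fst, sub_zero, map_sub, con2, con_sub]
  rw [hL, con2_swap, d1_apply]
  simp only [pullForm_one_con f hX hc, act_con, comp_lie, con_vec_sub, act_comap_con f hc]
  simp only [con2]
  ring

theorem pullForm_d2 (hX : HasCoords 𝒪X) (θ : 𝒪X.Form (f.toFun y) 2) :
    pullForm f y (d2 θ) = d2 (pullForm f y θ) := by
  obtain ⟨d, c, p, hc⟩ := hX (f.toFun y)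
  refine form3_ext fun ξ η ζ => ?_
  set B : Fin d → Fin d → Fin d → 𝒪Y.stalk y :=
    fun i j l => f.comap y (act (p l _) (θ ![p i _, p j _])) with hB
  set A : Fin d → Fin d → 𝒪Y.stalk y := fun i j => f.comap y (θ ![p i _, p j _]) with hA
  have hL : pullForm f y (d2 θ) ![ξ, η, ζ] =
      con3 (fun i j k => B j k i) (comp f c ξ) (comp f c η) (comp f c ζ) -
      con3 (fun i j k => B i k j) (comp f c ξ) (comp f c η) (comp f c ζ) +
      con3 B (comp f c ξ) (comp f c η) (comp f c ζ) := by
    rw [pullForm_three_con f hX hc]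
    simp only [d2_apply, hc.lie_eq_zero, map_zero_fst, sub_zero, add_zero, map_sub, map_add,
      con3, con2, con_sub, con_add, hB]
  have hact : ∀ υ : 𝒪Y.T y, ∀ a b : Fin d → 𝒪Y.stalk y,
      act υ (con2 A a b) = con2 A (fun i => act υ (a i)) b + con2 A a (fun i => act υ (b i)) +
        con3 B a b (comp f c υ) := fun υ a b => by
    rw [act_con2]
    simp only [hA, act_comap_con f hc]
    rfl
  have hsw : ∀ a b : Fin d → 𝒪Y.stalk y, con2 A a b = -con2 A b a := fun a b => by
    rw [con2_swap]
    simp only [hA, con2, ← con_neg, ← map_neg]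
    simp only [← form2_swap]
  have hvs : ∀ a b e : Fin d → 𝒪Y.stalk y,
      con2 A (fun i => a i - b i) e = con2 A a e - con2 A b e := fun a b e => con_vec_sub _ a b
  have e1 := con3_swap' B (comp f c ξ) (comp f c ζ) (comp f c η)
  have e2 := (con3_swap' B (comp f c η) (comp f c ζ) (comp f c ξ)).trans
    (con3_swap (fun i j k => B i k j) (comp f c η) (comp f c ξ) (comp f c ζ))
  rw [hL, d2_apply]
  simp only [pullForm_two_con f hX hc, comp_lie, ← hA, hvs, hact]
  linear_combination e1 - e2 - hsw (comp f c η) (fun i => act ξ (comp f c ζ i))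
    + hsw (comp f c ξ) (fun i => act η (comp f c ζ i))
    - hsw (comp f c ξ) (fun i => act ζ (comp f c η i))

/-- The components of `H` in coordinates satisfy the cocycle condition `hBz`; the remaining terms,
derivatives of the components of `df`, cancel as in `pullForm_d2`. -/
lemma isClosedForm_pullForm (hX : HasCoords 𝒪X) {H : 𝒪X.Form (f.toFun y) 3}
    (hH : IsClosedForm H) : IsClosedForm (pullForm f y H) := by
  obtain ⟨d, c, p, hc⟩ := hX (f.toFun y)
  intro ξ₀ ξ₁ ξ₂ ξ₃
  set B : Fin d → Fin d → Fin d → Fin d → 𝒪Y.stalk y :=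
    fun i j k l => f.comap y (act (p l _) (H ![p i _, p j _, p k _])) with hB
  set A : Fin d → Fin d → Fin d → 𝒪Y.stalk y :=
    fun i j k => f.comap y (H ![p i _, p j _, p k _]) with hA
  have hBz : ∀ i j k l, B j k l i - B i k l j + B i j l k - B i j k l = 0 := fun i j k l => by
    have h := congrArg (f.comap y) (hH (p i _) (p j _) (p k _) (p l _))
    simpa only [hc.lie_eq_zero, map_zero_fst, sub_zero, add_zero, map_sub, map_add, map_zero]
      using h
  have hB4 : ∀ x₀ x₁ x₂ x₃ : Fin d → 𝒪Y.stalk y, con4 B x₁ x₂ x₃ x₀ - con4 B x₀ x₂ x₃ x₁ +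
      con4 B x₀ x₁ x₃ x₂ - con4 B x₀ x₁ x₂ x₃ = 0 := fun x₀ x₁ x₂ x₃ => by
    rw [con4_swap'' B x₁, con4_swap' _ x₁, con4_swap _ x₁, con4_swap'' B x₀ x₂, con4_swap' _ x₀ x₂,
      con4_swap'' B x₀ x₁ x₃]
    simp only [con4, con3, con2, ← con_sub, ← con_add, hBz, con_zero]
  have hact : ∀ υ : 𝒪Y.T y, ∀ a b e : Fin d → 𝒪Y.stalk y,
      act υ (con3 A a b e) = con3 A (fun i => act υ (a i)) b e +
        con3 A a (fun i => act υ (b i)) e + con3 A a b (fun i => act υ (e i)) +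
        con4 B a b e (comp f c υ) := fun υ a b e => by
    rw [act_con3]
    simp only [hA, act_comap_con f hc]
    rfl
  have hsw : ∀ a b e : Fin d → 𝒪Y.stalk y, con3 A a b e = -con3 A b a e := fun a b e => by
    rw [con3_swap]
    simp only [hA, con3, con2, ← con_neg, ← map_neg]
    simp only [← form3_swap]
  have hsw' : ∀ a b e : Fin d → 𝒪Y.stalk y, con3 A a b e = -con3 A a e b := fun a b e => by
    rw [con3_swap']
    simp only [hA, con3, con2, ← con_neg, ← map_neg]
    simp only [← form3_swap']
  have hcyc : ∀ a b e : Fin d → 𝒪Y.stalk y, con3 A a b e = con3 A e a b := fun a b e => by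
    rw [hsw', hsw, neg_neg]
  have hvs : ∀ a b e g : Fin d → 𝒪Y.stalk y,
      con3 A (fun i => a i - b i) e g = con3 A a e g - con3 A b e g :=
    fun a b e g => con_vec_sub _ a b
  simp only [pullForm_three_con f hX hc, comp_lie, ← hA, hvs, hact]
  linear_combination hB4 (comp f c ξ₀) (comp f c ξ₁) (comp f c ξ₂) (comp f c ξ₃)
    + hsw (comp f c ξ₁) (fun i => act ξ₀ (comp f c ξ₂ i)) (comp f c ξ₃)
    + hcyc (comp f c ξ₁) (comp f c ξ₂) (fun i => act ξ₀ (comp f c ξ₃ i))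
    - hsw (comp f c ξ₀) (fun i => act ξ₁ (comp f c ξ₂ i)) (comp f c ξ₃)
    - hcyc (comp f c ξ₀) (comp f c ξ₂) (fun i => act ξ₁ (comp f c ξ₃ i))
    + hsw (comp f c ξ₀) (fun i => act ξ₂ (comp f c ξ₁ i)) (comp f c ξ₃)
    + hcyc (comp f c ξ₀) (comp f c ξ₁) (fun i => act ξ₂ (comp f c ξ₃ i))
    - hsw (comp f c ξ₀) (fun i => act ξ₃ (comp f c ξ₁ i)) (comp f c ξ₂)
    - hcyc (comp f c ξ₀) (comp f c ξ₁) (fun i => act ξ₃ (comp f c ξ₂ i))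

end Pullback

/-! ### The standard Courant algebroid twisted by a closed `3`-form -/

namespace FunctionSheaf

variable {𝒪 : FunctionSheaf K X} {x : X}

/-- The form component of the `H`-twisted bracket of `(α, ξ)` and `(β, η)` on `Ω¹ ⊕ T`:
`L_ξ β - ι_η dα + ι_η ι_ξ H`. -/
def twist (H : 𝒪.Form x 3) (α : 𝒪.Form x 1) (ξ : 𝒪.T x) (β : 𝒪.Form x 1) (η : 𝒪.T x) :
    𝒪.Form x 1 :=
  lieDeriv ξ β - contract η (d1 α) + contract η (contract ξ H)

lemma twist_apply (H : 𝒪.Form x 3) (α : 𝒪.Form x 1) (ξ : 𝒪.T x) (β : 𝒪.Form x 1) (η ζ : 𝒪.T x) :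
    twist H α ξ β η ![ζ] = act ξ (β ![ζ]) - β ![⁅ξ, ζ⁆] -
      (act η (α ![ζ]) - act ζ (α ![η]) - α ![⁅η, ζ⁆]) + H ![ξ, η, ζ] := by
  have h : twist H α ξ β η ![ζ] = lieDeriv ξ β ![ζ] - d1 α ![η, ζ] + H ![ξ, η, ζ] := rfl
  rw [h, lieDeriv_apply, d1_apply]

lemma zero_lie' (ξ : 𝒪.T x) : ⁅(0 : 𝒪.T x), ξ⁆ = 0 := Subtype.ext (zero_lie ξ.1)

lemma lie_zero' (ξ : 𝒪.T x) : ⁅ξ, (0 : 𝒪.T x)⁆ = 0 := Subtype.ext (lie_zero ξ.1)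

lemma form3_cyc (H : 𝒪.Form x 3) (ξ η ζ : 𝒪.T x) : H ![ξ, η, ζ] = H ![ζ, ξ, η] := by
  rw [form3_swap', form3_swap, neg_neg]

/-- The value at `υ` of the defect of the Leibniz identity is, up to terms that cancel, the value
of `dH` on the four vector fields. -/
lemma twist_leibniz_sub (H : 𝒪.Form x 3) (α β γ : 𝒪.Form x 1) (ξ η ζ υ : 𝒪.T x) :
    twist H α ξ (twist H β η γ ζ) ⁅η, ζ⁆ ![υ] -
      (twist H (twist H α ξ β η) ⁅ξ, η⁆ γ ζ ![υ] + twist H β η (twist H α ξ γ ζ) ⁅ξ, ζ⁆ ![υ]) =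
    act ξ (H ![η, ζ, υ]) - act η (H ![ξ, ζ, υ]) + act ζ (H ![ξ, η, υ]) - act υ (H ![ξ, η, ζ])
      - H ![⁅ξ, η⁆, ζ, υ] + H ![⁅ξ, ζ⁆, η, υ] - H ![⁅ξ, υ⁆, η, ζ]
      - H ![⁅η, ζ⁆, ξ, υ] + H ![⁅η, υ⁆, ξ, ζ] - H ![⁅ζ, υ⁆, ξ, η] := by
  simp only [twist_apply, act_add, act_sub, act_lie, lie_lie', map_sub_fst]
  rw [form3_cyc H η ζ ⁅ξ, υ⁆, form3_cyc H ξ η ⁅ζ, υ⁆, form3_cyc H ξ ζ ⁅η, υ⁆,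
    form3_swap H ξ ⁅η, ζ⁆, form3_swap H η ⁅ξ, ζ⁆]
  ring

lemma twist_leibniz {H : 𝒪.Form x 3} (hH : IsClosedForm H) (α β γ : 𝒪.Form x 1)
    (ξ η ζ : 𝒪.T x) :
    twist H α ξ (twist H β η γ ζ) ⁅η, ζ⁆ =
      twist H (twist H α ξ β η) ⁅ξ, η⁆ γ ζ + twist H β η (twist H α ξ γ ζ) ⁅ξ, ζ⁆ :=
  form1_ext fun υ => sub_eq_zero.mp ((twist_leibniz_sub H α β γ ξ η ζ υ).trans (hH ξ η ζ υ))

lemma form3_add_snd (H : 𝒪.Form x 3) (ξ η η' ζ : 𝒪.T x) :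
    H ![ξ, η + η', ζ] = H ![ξ, η, ζ] + H ![ξ, η', ζ] := by
  rw [form3_swap, map_add_fst, form3_swap H ξ η, form3_swap H ξ η']
  ring

lemma form3_smul_snd (H : 𝒪.Form x 3) (a : 𝒪.stalk x) (ξ η ζ : 𝒪.T x) :
    H ![ξ, a • η, ζ] = a * H ![ξ, η, ζ] := by
  rw [form3_swap, map_smul_fst, form3_swap H ξ η]
  ring

lemma twist_add_left (H : 𝒪.Form x 3) (α α' β : 𝒪.Form x 1) (ξ ξ' η : 𝒪.T x) :
    twist H (α + α') (ξ + ξ') β η = twist H α ξ β η + twist H α' ξ' β η := by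
  refine form1_ext fun υ => ?_
  simp only [AlternatingMap.add_apply, twist_apply, act_add_left, act_add, lie_add_left,
    map_add_fst]
  ring

lemma twist_add_right (H : 𝒪.Form x 3) (α β β' : 𝒪.Form x 1) (ξ η η' : 𝒪.T x) :
    twist H α ξ (β + β') (η + η') = twist H α ξ β η + twist H α ξ β' η' := by
  refine form1_ext fun υ => ?_
  simp only [AlternatingMap.add_apply, twist_apply, act_add_left, act_add, lie_add_left,
    map_add_fst, form3_add_snd]
  ring

lemma twist_smul_right (H : 𝒪.Form x 3) (g : 𝒪.stalk x) (α β : 𝒪.Form x 1) (ξ η : 𝒪.T x) :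
    twist H α ξ (g • β) (g • η) = g • twist H α ξ β η + act ξ g • β := by
  refine form1_ext fun υ => ?_
  simp only [AlternatingMap.add_apply, AlternatingMap.smul_apply, smul_eq_mul, twist_apply,
    act_smul_left, act_mul, lie_smul_left, map_sub_fst, map_smul_fst, form3_smul_snd]
  ring

lemma twist_const_left (H : 𝒪.Form x 3) (k : K) (α β : 𝒪.Form x 1) (ξ η : 𝒪.T x) :
    twist H (algebraMap K (𝒪.stalk x) k • α) (algebraMap K (𝒪.stalk x) k • ξ) β η =
      algebraMap K (𝒪.stalk x) k • twist H α ξ β η := by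
  refine form1_ext fun υ => ?_
  simp only [AlternatingMap.smul_apply, smul_eq_mul, twist_apply, act_smul_left, act_mul,
    lie_smul_left, map_sub_fst, map_smul_fst, act_algebraMap]
  ring

lemma twist_symm (H : 𝒪.Form x 3) (α β : 𝒪.Form x 1) (ξ η : 𝒪.T x) :
    twist H α ξ β η + twist H β η α ξ = d0 (α ![η] + β ![ξ]) := by
  refine form1_ext fun υ => ?_
  simp only [AlternatingMap.add_apply, twist_apply, d0_apply, act_add]
  rw [form3_swap H η ξ]
  ring

lemma twist_coanchor (H : 𝒪.Form x 3) (α β : 𝒪.Form x 1) (ξ : 𝒪.T x) :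
    twist H α ξ β 0 = lieDeriv ξ β := by
  refine form1_ext fun υ => ?_
  rw [twist_apply, lieDeriv_apply, form3_swap, map_zero_fst, map_zero_fst, zero_lie', map_zero_fst]
  simp

lemma twist_pairing (H : 𝒪.Form x 3) (α β γ : 𝒪.Form x 1) (ξ η ζ : 𝒪.T x) :
    (twist H α ξ β η ![ζ] + γ ![⁅ξ, η⁆]) + (β ![⁅ξ, ζ⁆] + twist H α ξ γ ζ ![η]) =
      act ξ (β ![ζ] + γ ![η]) := by
  simp only [twist_apply, act_add]
  rw [form3_swap' H ξ ζ η, lie_neg_swap ζ η, map_neg_fst]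
  ring

lemma IsFormSec.twist {H : ∀ z, 𝒪.Form z 3} {α β : ∀ z, 𝒪.Form z 1} {ξ η : ∀ z, 𝒪.T z}
    (hH : 𝒪.IsFormSec x 3 H) (hα : 𝒪.IsFormSec x 1 α) (hξ : 𝒪.IsVectSec x ξ)
    (hβ : 𝒪.IsFormSec x 1 β) (hη : 𝒪.IsVectSec x η) :
    𝒪.IsFormSec x 1 fun z => twist (H z) (α z) (ξ z) (β z) (η z) := by
  have h := ((hβ.lieDeriv hξ).add (hα.d1.contract hη).neg).add ((hH.contract hξ).contract hη)
  simp only [← sub_eq_add_neg] at h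
  exact h

end FunctionSheaf

/-- `Ψ` identifies the stalk of `Q` at `x` with `Ω¹ ⊕ T`, with the standard anchor, co-anchor and
pairing and the `H`-twisted bracket. -/
structure IsTwisted {𝒪 : FunctionSheaf K X} (Q : CourantData 𝒪) (x : X) (H : 𝒪.Form x 3)
    (Ψ : Q.stalk x ≃ₗ[𝒪.stalk x] 𝒪.Form x 1 × 𝒪.T x) : Prop where
  anchor : ∀ p, Q.anchor x p = (Ψ p).2
  coanchor : ∀ α, Ψ (Q.coanchor x α) = (α, 0)
  pairing : ∀ p q, Q.pairing p q = (Ψ p).1 ![(Ψ q).2] + (Ψ q).1 ![(Ψ p).2]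
  bracket : ∀ p q, Ψ (Q.bracket p q) =
    (twist H (Ψ p).1 (Ψ p).2 (Ψ q).1 (Ψ q).2, ⁅(Ψ p).2, (Ψ q).2⁆)

/-- `Q` is, near `x`, isomorphic to a standard Courant algebroid twisted by a closed `3`-form. -/
def IsLocallyTwisted {𝒪 : FunctionSheaf K X} (Q : CourantData 𝒪) (x : X) : Prop :=
  ∃ (H : ∀ z, 𝒪.Form z 3) (Ψ : ∀ z, Q.stalk z ≃ₗ[𝒪.stalk z] 𝒪.Form z 1 × 𝒪.T z),
    (∀ z, IsClosedForm (H z)) ∧ (∀ z, IsTwisted Q z (H z) (Ψ z)) ∧ 𝒪.IsFormSec x 3 H ∧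
    ∀ᶠ z in 𝓝 x, ∀ s, Q.IsSec z s ↔
      𝒪.IsFormSec z 1 (fun w => (Ψ w (s w)).1) ∧ 𝒪.IsVectSec z fun w => (Ψ w (s w)).2

/-- The axioms of an exact Courant algebroid are conditions on stalks and on sections near a point,
so they can be checked for the twisted bracket on `Ω¹ ⊕ T`. -/
theorem isExactCourant_of_isLocallyTwisted {𝒪 : FunctionSheaf K X} (hX : HasCoords 𝒪)
    {Q : CourantData 𝒪} (h : ∀ x, IsLocallyTwisted Q x) : Q.IsExactCourant where
  isSheaf :=
    { isOpen := fun x s hs => by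
        obtain ⟨H, Ψ, -, -, -, hsec⟩ := h x
        obtain ⟨h1, h2⟩ := (hsec.self_of_nhds s).1 hs
        filter_upwards [hsec, h1.eventually, h2.eventually] with z hz h3 h4
        exact (hz s).2 ⟨h3, h4⟩
      congr := fun x s t hs e => by
        obtain ⟨H, Ψ, -, -, -, hsec⟩ := h x
        obtain ⟨h1, h2⟩ := (hsec.self_of_nhds s).1 hs
        exact (hsec.self_of_nhds t).2 ⟨h1.congr (e.mono fun z hz => by rw [hz]),
          h2.congr (e.mono fun z hz => by rw [hz])⟩
      extend := fun x a => by
        obtain ⟨H, Ψ, -, -, -, hsec⟩ := h x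
        obtain ⟨α, hα, hαx⟩ := (isSheaf_form hX 1).extend x (Ψ x a).1
        obtain ⟨ξ, hξ, hξx⟩ := exists_isVectSec (Ψ x a).2
        refine ⟨fun z => (Ψ z).symm (α z, ξ z), (hsec.self_of_nhds _).2 ?_, ?_⟩
        · simpa only [LinearEquiv.apply_symm_apply] using ⟨hα, hξ⟩
        · simp only [hαx, hξx, Prod.mk.eta, LinearEquiv.symm_apply_apply]
      separated := fun x s t hs ht e => by
        obtain ⟨H, Ψ, -, -, -, hsec⟩ := h x
        obtain ⟨h1, h2⟩ := (hsec.self_of_nhds s).1 hs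
        obtain ⟨h3, h4⟩ := (hsec.self_of_nhds t).1 ht
        filter_upwards [(isSheaf_form hX 1).separated x _ _ h1 h3 (by rw [e]),
          vectSec_eventuallyEq hX h2 h4 (by rw [e])] with z h5 h6
        exact (Ψ z).injective (Prod.ext h5 h6) }
  add_sec x s t hs ht := by
    obtain ⟨H, Ψ, -, -, -, hsec⟩ := h x
    obtain ⟨h1, h2⟩ := (hsec.self_of_nhds s).1 hs
    obtain ⟨h3, h4⟩ := (hsec.self_of_nhds t).1 ht
    refine (hsec.self_of_nhds _).2 ?_
    simpa only [map_add] using ⟨h1.add h3, h2.add h4⟩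
  smul_sec x g s hg hs := by
    obtain ⟨H, Ψ, -, -, -, hsec⟩ := h x
    obtain ⟨h1, h2⟩ := (hsec.self_of_nhds s).1 hs
    refine (hsec.self_of_nhds _).2 ?_
    simpa only [map_smul] using ⟨IsFormSec.smul hg h1, IsVectSec.smul hg h2⟩
  bracket_sec x s t hs ht := by
    obtain ⟨H, Ψ, -, hT, hH, hsec⟩ := h x
    obtain ⟨h1, h2⟩ := (hsec.self_of_nhds s).1 hs
    obtain ⟨h3, h4⟩ := (hsec.self_of_nhds t).1 ht
    refine (hsec.self_of_nhds _).2 ?_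
    simpa only [(hT _).bracket] using ⟨hH.twist h1 h2 h3 h4, h2.lie h4⟩
  pairing_sec x s t hs ht := by
    obtain ⟨H, Ψ, -, hT, -, hsec⟩ := h x
    obtain ⟨h1, h2⟩ := (hsec.self_of_nhds s).1 hs
    obtain ⟨h3, h4⟩ := (hsec.self_of_nhds t).1 ht
    simpa only [(hT _).pairing] using (h1.apply1 h4).add (h3.apply1 h2)
  anchor_sec x s hs := by
    obtain ⟨H, Ψ, -, hT, -, hsec⟩ := h x
    simpa only [(hT _).anchor] using ((hsec.self_of_nhds s).1 hs).2
  coanchor_sec x α hα := by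
    obtain ⟨H, Ψ, -, hT, -, hsec⟩ := h x
    refine (hsec.self_of_nhds _).2 ?_
    simpa only [(hT _).coanchor] using ⟨hα, isVectSec_zero⟩
  bracket_add_left x p q r := by
    obtain ⟨H, Ψ, -, hT, -, -⟩ := h x
    apply (Ψ x).injective
    simp only [(hT x).bracket, map_add, Prod.fst_add, Prod.snd_add, twist_add_left, lie_add_left,
      Prod.mk_add_mk]
  bracket_add_right x p q r := by
    obtain ⟨H, Ψ, -, hT, -, -⟩ := h x
    apply (Ψ x).injective
    simp only [(hT x).bracket, map_add, Prod.fst_add, Prod.snd_add, twist_add_right,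
      lie_add_right, Prod.mk_add_mk]
  bracket_const_left x k p q := by
    obtain ⟨H, Ψ, -, hT, -, -⟩ := h x
    apply (Ψ x).injective
    simp only [(hT x).bracket, map_smul, Prod.smul_fst, Prod.smul_snd, twist_const_left,
      lie_smul_left, act_algebraMap, zero_smul, sub_zero, Prod.smul_mk]
  bracket_const_right x k p q := by
    obtain ⟨H, Ψ, -, hT, -, -⟩ := h x
    apply (Ψ x).injective
    simp only [(hT x).bracket, map_smul, Prod.smul_fst, Prod.smul_snd, twist_smul_right,
      lie_smul_right, act_algebraMap, zero_smul, add_zero, Prod.smul_mk]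
  bracket_bracket x p q r := by
    obtain ⟨H, Ψ, hc, hT, -, -⟩ := h x
    apply (Ψ x).injective
    simp only [(hT x).bracket, map_add, Prod.mk_add_mk]
    refine Prod.ext (twist_leibniz (hc x) _ _ _ _ _ _) ?_
    rw [lie_lie', sub_add_cancel]
  pairing_add_left x p q r := by
    obtain ⟨H, Ψ, -, hT, -, -⟩ := h x
    simp only [(hT x).pairing, map_add, Prod.fst_add, Prod.snd_add, AlternatingMap.add_apply,
      map_add_fst]
    ring
  pairing_smul_left x g p q := by
    obtain ⟨H, Ψ, -, hT, -, -⟩ := h x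
    simp only [(hT x).pairing, map_smul, Prod.smul_fst, Prod.smul_snd, AlternatingMap.smul_apply,
      map_smul_fst, smul_eq_mul]
    ring
  pairing_comm x p q := by
    obtain ⟨H, Ψ, -, hT, -, -⟩ := h x
    simp only [(hT x).pairing]
    ring
  anchor_bracket x p q := by
    obtain ⟨H, Ψ, -, hT, -, -⟩ := h x
    simp only [(hT x).anchor, (hT x).bracket]
  anchor_coanchor x α := by
    obtain ⟨H, Ψ, -, hT, -, -⟩ := h x
    simp only [(hT x).anchor, (hT x).coanchor]
  bracket_smul x g p q := by
    obtain ⟨H, Ψ, -, hT, -, -⟩ := h x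
    apply (Ψ x).injective
    simp only [(hT x).bracket, (hT x).anchor, map_add, map_smul, Prod.smul_fst, Prod.smul_snd,
      twist_smul_right, lie_smul_right]
    rfl
  pairing_invariant x p q r := by
    obtain ⟨H, Ψ, -, hT, -, -⟩ := h x
    simp only [(hT x).pairing, (hT x).bracket, (hT x).anchor]
    exact twist_pairing _ _ _ _ _ _ _
  bracket_coanchor x p α := by
    obtain ⟨H, Ψ, -, hT, -, -⟩ := h x
    apply (Ψ x).injective
    simp only [(hT x).bracket, (hT x).coanchor, (hT x).anchor, twist_coanchor]
    refine Prod.ext rfl ?_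
    exact lie_zero' _
  pairing_coanchor x p α := by
    obtain ⟨H, Ψ, -, hT, -, -⟩ := h x
    simp only [(hT x).pairing, (hT x).coanchor, (hT x).anchor, map_zero_fst, zero_add]
  bracket_symm x p q := by
    obtain ⟨H, Ψ, -, hT, -, -⟩ := h x
    apply (Ψ x).injective
    simp only [(hT x).bracket, (hT x).coanchor, (hT x).pairing, map_add, Prod.mk_add_mk,
      twist_symm]
    rw [lie_neg_swap, neg_add_cancel]
  coanchor_injective x α β e := by
    obtain ⟨H, Ψ, -, hT, -, -⟩ := h x
    have e' := congrArg (Ψ x) e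
    rw [(hT x).coanchor, (hT x).coanchor] at e'
    exact congrArg Prod.fst e'
  ker_anchor x := by
    obtain ⟨H, Ψ, -, hT, -, -⟩ := h x
    ext p
    rw [LinearMap.mem_ker, (hT x).anchor, LinearMap.mem_range]
    constructor
    · intro hp
      exact ⟨(Ψ x p).1, (Ψ x).injective (by rw [(hT x).coanchor]; exact Prod.ext rfl hp.symm)⟩
    · rintro ⟨α, rfl⟩
      rw [(hT x).coanchor]
  anchor_surjective x ξ := by
    obtain ⟨H, Ψ, -, hT, -, -⟩ := h x
    exact ⟨(Ψ x).symm (0, ξ), by rw [(hT x).anchor, LinearEquiv.apply_symm_apply]⟩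

/-! ### Connections on exact Courant algebroids -/

section Connections

variable {𝒪 : FunctionSheaf K X} {x : X} {Q : CourantData 𝒪}

lemma eq_zero_of_add_self {a : 𝒪.stalk x} (h : a + a = 0) : a = 0 := by
  have h2 : algebraMap K (𝒪.stalk x) 2⁻¹ * algebraMap K (𝒪.stalk x) 2 = 1 := by
    rw [← map_mul, inv_mul_cancel₀ two_ne_zero, map_one]
  calc a = (algebraMap K (𝒪.stalk x) 2⁻¹ * algebraMap K (𝒪.stalk x) 2) * a := by rw [h2, one_mul]
    _ = algebraMap K (𝒪.stalk x) 2⁻¹ * (a + a) := by rw [map_ofNat]; ring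
    _ = 0 := by rw [h, mul_zero]

namespace CourantData.IsCourant

variable (hQ : Q.IsCourant)
include hQ

lemma pairing_add_right (p q r : Q.stalk x) :
    Q.pairing p (q + r) = Q.pairing p q + Q.pairing p r := by
  rw [hQ.pairing_comm, hQ.pairing_add_left, hQ.pairing_comm _ q, hQ.pairing_comm _ r]

lemma pairing_smul_right (g : 𝒪.stalk x) (p q : Q.stalk x) :
    Q.pairing p (g • q) = g * Q.pairing p q := by
  rw [hQ.pairing_comm, hQ.pairing_smul_left, hQ.pairing_comm]

lemma coanchor_pairing (α : 𝒪.Form x 1) (p : Q.stalk x) :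
    Q.pairing (Q.coanchor x α) p = α ![Q.anchor x p] := by
  rw [hQ.pairing_comm, hQ.pairing_coanchor]

lemma sec_zero : Q.IsSec x fun _ => 0 := by
  simpa only [map_zero] using hQ.coanchor_sec x (fun _ => 0) isFormSec_zero

lemma sec_sum {ι : Type*} (s : Finset ι) {q : ι → ∀ z, Q.stalk z} (h : ∀ i, Q.IsSec x (q i)) :
    Q.IsSec x fun z => ∑ i ∈ s, q i z := by
  classical
  induction s using Finset.induction_on with
  | empty => simpa using hQ.sec_zero
  | insert a s ha ih => simpa only [Finset.sum_insert ha] using hQ.add_sec x _ _ (h a) ih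

end CourantData.IsCourant

/-- The pairing, as a bilinear map. -/
def pairingLin (hQ : Q.IsCourant) (x : X) :
    Q.stalk x →ₗ[𝒪.stalk x] Q.stalk x →ₗ[𝒪.stalk x] 𝒪.stalk x :=
  LinearMap.mk₂ _ Q.pairing (hQ.pairing_add_left x) (hQ.pairing_smul_left x)
    hQ.pairing_add_right hQ.pairing_smul_right

/-- The `1`-form `ζ ↦ ⟨q, D ζ⟩`. -/
def connForm (hQ : Q.IsCourant) (D : Conn Q x) : Q.stalk x →ₗ[𝒪.stalk x] 𝒪.Form x 1 where
  toFun q := oneForm (pairingLin hQ x q ∘ₗ D.1)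
  map_add' p q := form1_ext fun ξ => by
    rw [AlternatingMap.add_apply, oneForm_apply, oneForm_apply, oneForm_apply]
    exact hQ.pairing_add_left x p q _
  map_smul' g q := form1_ext fun ξ => by
    rw [RingHom.id_apply, AlternatingMap.smul_apply, oneForm_apply, oneForm_apply]
    exact hQ.pairing_smul_left x g q _

@[simp] lemma connForm_apply (hQ : Q.IsCourant) (D : Conn Q x) (q : Q.stalk x) (ξ : 𝒪.T x) :
    connForm hQ D q ![ξ] = Q.pairing q (D.1 ξ) := rfl

lemma connForm_conn (hQ : Q.IsCourant) (D : Conn Q x) (ξ : 𝒪.T x) :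
    connForm hQ D (D.1 ξ) = 0 :=
  form1_ext fun η => D.2.isotropic ξ η

lemma connForm_coanchor (hQ : Q.IsCourant) (D : Conn Q x) (α : 𝒪.Form x 1) :
    connForm hQ D (Q.coanchor x α) = α :=
  form1_ext fun η => by rw [connForm_apply, hQ.coanchor_pairing, D.2.anchor]

lemma conn_add_coanchor (hQ : Q.IsExactCourant) (D : Conn Q x) (q : Q.stalk x) :
    D.1 (Q.anchor x q) + Q.coanchor x (connForm hQ.toIsCourant D q) = q := by
  have h : q - D.1 (Q.anchor x q) ∈ LinearMap.ker (Q.anchor x) := by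
    rw [LinearMap.mem_ker, map_sub, D.2.anchor, sub_self]
  rw [hQ.ker_anchor] at h
  obtain ⟨α, hα⟩ := h
  have h' := congrArg (connForm hQ.toIsCourant D) hα
  rw [connForm_coanchor, map_sub, connForm_conn, sub_zero] at h'
  rw [← h', hα, add_sub_cancel]

/-- A connection splits `Q` into `Ω¹ ⊕ T`. -/
def connEquiv (hQ : Q.IsExactCourant) (D : Conn Q x) :
    Q.stalk x ≃ₗ[𝒪.stalk x] 𝒪.Form x 1 × 𝒪.T x where
  toLinearMap := (connForm hQ.toIsCourant D).prod (Q.anchor x)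
  invFun a := D.1 a.2 + Q.coanchor x a.1
  left_inv q := conn_add_coanchor hQ D q
  right_inv a := by
    refine Prod.ext ?_ ?_
    · change connForm hQ.toIsCourant D (D.1 a.2 + Q.coanchor x a.1) = _
      rw [map_add, connForm_conn, connForm_coanchor, zero_add]
    · change Q.anchor x (D.1 a.2 + Q.coanchor x a.1) = _
      rw [map_add, D.2.anchor, hQ.anchor_coanchor, add_zero]

lemma connEquiv_apply (hQ : Q.IsExactCourant) (D : Conn Q x) (q : Q.stalk x) :
    connEquiv hQ D q = (connForm hQ.toIsCourant D q, Q.anchor x q) := rfl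

lemma bracket_isotropic (hQ : Q.IsCourant) {p q : Q.stalk x} (h : Q.pairing p q = 0) :
    Q.bracket q p = -Q.bracket p q := by
  have h0 : d0 (0 : 𝒪.stalk x) = 0 := form1_ext fun ξ => act_zero ξ
  have e := hQ.bracket_symm x p q
  rw [h, h0, map_zero] at e
  exact eq_neg_of_add_eq_zero_right e

/-- The curvature as the `3`-form `(ξ, η, ζ) ↦ ⟨{D ξ, D η}, D ζ⟩`. -/
def curvForm (hQ : Q.IsCourant) (D : Conn Q x) : 𝒪.Form x 3 :=
  mkForm3 (fun ξ η ζ => Q.pairing (Q.bracket (D.1 ξ) (D.1 η)) (D.1 ζ))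
    (fun ξ ξ' η ζ => by rw [map_add, hQ.bracket_add_left, hQ.pairing_add_left])
    (fun a ξ η ζ => by
      have e : ∀ p q : Q.stalk x, Q.pairing (-p) q = -Q.pairing p q := fun p q =>
        congrArg (fun F => F q) (map_neg (pairingLin hQ x) p)
      rw [map_smul, bracket_isotropic hQ (p := D.1 η), hQ.bracket_smul,
        bracket_isotropic hQ (D.2.isotropic ξ η), e, hQ.pairing_add_left, hQ.pairing_smul_left,
        hQ.pairing_smul_left, D.2.isotropic, e]
      · ring
      · rw [hQ.pairing_smul_right, D.2.isotropic, mul_zero])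
    (fun ξ ζ => by
      refine eq_zero_of_add_self ?_
      conv_lhs => enter [2]; rw [bracket_isotropic hQ (D.2.isotropic ξ ξ)]
      rw [← hQ.pairing_add_left, add_neg_cancel]
      exact congrArg (fun F => F (D.1 ζ)) (map_zero (pairingLin hQ x)))
    (fun ξ η ζ => by
      rw [bracket_isotropic hQ (D.2.isotropic η ξ)]
      exact congrArg (fun F => F (D.1 ζ)) (map_neg (pairingLin hQ x) _))
    (fun ξ η ζ => by
      have h := hQ.pairing_invariant x (D.1 ξ) (D.1 η) (D.1 ζ)
      rw [D.2.isotropic, act_zero, hQ.pairing_comm x (D.1 η)] at h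
      exact eq_neg_of_add_eq_zero_left h)

lemma curvForm_apply (hQ : Q.IsCourant) (D : Conn Q x) (ξ η ζ : 𝒪.T x) :
    curvForm hQ D ![ξ, η, ζ] = Q.pairing (Q.bracket (D.1 ξ) (D.1 η)) (D.1 ζ) := rfl

lemma coanchor_bracket (hQ : Q.IsCourant) (α : 𝒪.Form x 1) (q : Q.stalk x) :
    Q.bracket (Q.coanchor x α) q =
      Q.coanchor x (d0 (α ![Q.anchor x q]) - lieDeriv (Q.anchor x q) α) := by
  have e := hQ.bracket_symm x (Q.coanchor x α) q
  rw [hQ.bracket_coanchor, hQ.coanchor_pairing] at e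
  rw [map_sub, ← e, add_sub_cancel_right]

/-- In the splitting by a connection, the bracket is the standard one twisted by the curvature. -/
lemma isTwisted_connEquiv (hQ : Q.IsExactCourant) (D : Conn Q x) :
    IsTwisted Q x (curvForm hQ.toIsCourant D) (connEquiv hQ D) where
  anchor _ := rfl
  coanchor α := Prod.ext (connForm_coanchor _ D α) (hQ.anchor_coanchor x α)
  pairing p q := by
    rw [connEquiv_apply, connEquiv_apply]
    conv_lhs => rw [← conn_add_coanchor hQ D q]
    rw [hQ.pairing_add_right, hQ.pairing_coanchor]
    rfl
  bracket p q := by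
    refine Prod.ext (form1_ext fun ζ => ?_) (hQ.anchor_bracket x p q)
    have h1 := hQ.pairing_invariant x p q (D.1 ζ)
    have h2 := conn_add_coanchor hQ D p
    have h3 := conn_add_coanchor hQ D q
    rw [connEquiv_apply, connEquiv_apply, connEquiv_apply]
    simp only [connForm_apply]
    rw [twist_apply, curvForm_apply, connForm_apply, connForm_apply, connForm_apply,
      connForm_apply, connForm_apply, ← h1]
    have h4 : Q.pairing q (Q.bracket p (D.1 ζ)) =
        Q.pairing (D.1 (Q.anchor x q)) (Q.bracket p (D.1 ζ)) +
          Q.pairing q (D.1 ⁅Q.anchor x p, ζ⁆) := by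
      conv_lhs => rw [← h3]
      rw [hQ.pairing_add_left, hQ.coanchor_pairing, hQ.anchor_bracket, D.2.anchor, connForm_apply]
    have h5 : Q.pairing (D.1 (Q.anchor x q)) (Q.bracket p (D.1 ζ)) =
        Q.pairing (D.1 (Q.anchor x q)) (Q.bracket (D.1 (Q.anchor x p)) (D.1 ζ)) +
        (act (Q.anchor x q) (Q.pairing p (D.1 ζ)) -
          (act ζ (Q.pairing p (D.1 (Q.anchor x q))) - Q.pairing p (D.1 ⁅ζ, Q.anchor x q⁆))) := by
      conv_lhs => rw [← h2]
      rw [hQ.bracket_add_left, hQ.pairing_add_right, coanchor_bracket hQ.toIsCourant,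
        hQ.pairing_coanchor, D.2.anchor, D.2.anchor, sub_eq_add_neg (d0 _),
        AlternatingMap.add_apply, AlternatingMap.neg_apply, lieDeriv_apply, d0_apply]
      simp only [connForm_apply]
      ring
    have h6 := hQ.pairing_invariant x (D.1 (Q.anchor x p)) (D.1 (Q.anchor x q)) (D.1 ζ)
    rw [D.2.isotropic, act_zero] at h6
    have h7 : Q.pairing p (D.1 ⁅ζ, Q.anchor x q⁆) = -Q.pairing p (D.1 ⁅Q.anchor x q, ζ⁆) := by
      rw [lie_neg_swap, map_neg]
      exact map_neg (pairingLin hQ.toIsCourant x p) _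
    rw [h4, h5, h7]
    linear_combination -h6

lemma IsTwisted.isClosedForm {H : 𝒪.Form x 3}
    {Ψ : Q.stalk x ≃ₗ[𝒪.stalk x] 𝒪.Form x 1 × 𝒪.T x} (h : IsTwisted Q x H Ψ)
    (hQ : Q.IsCourant) : IsClosedForm H := by
  intro ξ η ζ υ
  have e := congrArg (fun q => (Ψ q).1 ![υ])
    (hQ.bracket_bracket x (Ψ.symm (0, ξ)) (Ψ.symm (0, η)) (Ψ.symm (0, ζ)))
  simp only [map_add, h.bracket, LinearEquiv.apply_symm_apply, Prod.fst_add,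
    AlternatingMap.add_apply] at e
  exact (twist_leibniz_sub H 0 0 0 ξ η ζ υ).symm.trans (sub_eq_zero.mpr e)

lemma isCurvature_curvForm (hQ : Q.IsExactCourant) (D : Conn Q x) :
    IsCurvature D (curvForm hQ.toIsCourant D) := by
  intro ξ η
  apply (connEquiv hQ D).injective
  rw [(isTwisted_connEquiv hQ D).coanchor]
  refine Prod.ext (form1_ext fun ζ => ?_) ?_
  · change connForm _ D (_ - _) ![ζ] = _
    rw [map_sub, connForm_conn, sub_zero]
    rfl
  · change Q.anchor x (_ - _) = 0
    rw [map_sub, hQ.anchor_bracket, D.2.anchor, D.2.anchor, D.2.anchor, sub_self]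

lemma existsUnique_isCurvature (hQ : Q.IsExactCourant) (D : Conn Q x) : ∃! H, IsCurvature D H := by
  refine ⟨_, isCurvature_curvForm hQ D, fun H hH => form3_ext fun ξ η ζ => ?_⟩
  have e := hQ.coanchor_injective x ((hH ξ η).symm.trans (isCurvature_curvForm hQ D ξ η))
  exact congrArg (fun α : 𝒪.Form x 1 => α ![ζ]) e

lemma IsCurvature.eq_curvature (hQ : Q.IsExactCourant) {D : Conn Q x} {H : 𝒪.Form x 3}
    (h : IsCurvature D H) : curvature D = H :=
  (existsUnique_isCurvature hQ D).unique
    (Classical.epsilon_spec (existsUnique_isCurvature hQ D).exists) h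

lemma curvature_eq_curvForm (hQ : Q.IsExactCourant) (D : Conn Q x) :
    curvature D = curvForm hQ.toIsCourant D :=
  (isCurvature_curvForm hQ D).eq_curvature hQ

lemma isClosedForm_curvature (hQ : Q.IsExactCourant) (D : Conn Q x) :
    IsClosedForm (curvature D) := by
  rw [curvature_eq_curvForm hQ]
  exact (isTwisted_connEquiv hQ D).isClosedForm hQ.toIsCourant

/-! ### The sheaf of connections -/

section Frame

variable {d : ℕ} {c : Fin d → ∀ z, 𝒪.stalk z} {p : Fin d → ∀ z, 𝒪.T z}

/-- The connection that sends the coordinate vector fields to the elements `q i`. -/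
def connOfFrame (hQ : Q.IsCourant) (hc : IsCoord 𝒪 x c p) (q : Fin d → Q.stalk x)
    (hq : ∀ i, Q.anchor x (q i) = p i x) (hp : ∀ i j, Q.pairing (q i) (q j) = 0) : Conn Q x :=
  ⟨∑ i, (actLin (c i x)).smulRight (q i), fun ξ => by
      simp only [LinearMap.sum_apply, LinearMap.smulRight_apply, map_sum, map_smul, hq]
      exact (hc.eq_sum ξ).symm,
    fun ξ η => by
      change pairingLin hQ x _ _ = 0
      have h : ∀ i j, pairingLin hQ x (q i) (q j) = 0 := hp
      simp [LinearMap.sum_apply, map_sum, h]⟩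

lemma connOfFrame_apply (hQ : Q.IsCourant) (hc : IsCoord 𝒪 x c p) (q : Fin d → Q.stalk x)
    (hq : ∀ i, Q.anchor x (q i) = p i x) (hp : ∀ i j, Q.pairing (q i) (q j) = 0) (i : Fin d) :
    (connOfFrame hQ hc q hq hp).1 (p i x) = q i := by
  change (∑ j, (actLin (c j x)).smulRight (q j)) (p i x) = q i
  simp [LinearMap.sum_apply, hc.dual_at]

lemma conn_ext_frame (hc : IsCoord 𝒪 x c p) {D D' : Conn Q x}
    (h : ∀ i, D.1 (p i x) = D'.1 (p i x)) : D = D' := by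
  refine Subtype.ext (LinearMap.ext fun ξ => ?_)
  rw [hc.eq_sum ξ, map_sum, map_sum]
  simp only [map_smul, h]

lemma isConnSec_iff (hQ : Q.IsCourant) (hc : IsCoord 𝒪 x c p) {D : ∀ z, Conn Q z} :
    IsConnSec Q x D ↔ ∀ i, Q.IsSec x fun z => (D z).1 (p i z) := by
  refine ⟨fun h i => h.self_of_nhds _ (hc.partial_sec i), fun h => ?_⟩
  filter_upwards [hc.eventually, eventually_all.2 fun i => hQ.isSheaf.isOpen x _ (h i)]
    with z h1 h2 ξ hξ
  refine hQ.isSheaf.congr z _ _ (hQ.sec_sum Finset.univ fun i =>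
    hQ.smul_sec z _ _ (hξ.act (h1.coord_sec i)) (h2 i)) ?_
  filter_upwards [h1.eventually] with w hw
  conv_rhs => rw [hw.eq_sum (ξ w), map_sum]
  simp only [map_smul]

end Frame

lemma nonempty_conn (hX : HasCoords 𝒪) (hQ : Q.IsExactCourant) (x : X) : Nonempty (Conn Q x) := by
  obtain ⟨d, c, p, hc⟩ := hX x
  choose q hq using fun i => hQ.anchor_surjective x (p i x)
  -- Lifts of the coordinate vector fields are made isotropic by subtracting half of their pairings.
  set e := algebraMap K (𝒪.stalk x) 2⁻¹ with he
  have he2 : e + e = 1 := by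
    rw [he, ← map_add, ← two_mul, mul_inv_cancel₀ two_ne_zero, map_one]
  set γ : Fin d → 𝒪.Form x 1 := fun i => ∑ j, (e * Q.pairing (q i) (q j)) • d0 (c j x) with hγ
  have hγp : ∀ i k, γ i ![p k x] = e * Q.pairing (q i) (q k) := fun i k => by
    simp only [hγ, form_sum_apply, AlternatingMap.smul_apply, d0_apply, hc.dual_at, smul_eq_mul]
    simp
  refine ⟨connOfFrame hQ.toIsCourant hc (fun i => q i + Q.coanchor x (-γ i)) (fun i => ?_)
    fun i k => ?_⟩
  · rw [map_add, hq, hQ.anchor_coanchor, add_zero]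
  · rw [hQ.pairing_add_left, hQ.pairing_add_right, hQ.pairing_coanchor, hQ.coanchor_pairing,
      map_add, hq, hq, hQ.anchor_coanchor, add_zero, AlternatingMap.neg_apply,
      AlternatingMap.neg_apply, hγp, hγp, hQ.pairing_comm x (q k)]
    linear_combination -Q.pairing (q i) (q k) * he2

/-- The values of a connection on the coordinate vector fields are extended to sections of `Q`.  The
conditions on anchors and pairings hold at `x`, hence near `x`. -/
lemma exists_isConnSec (hX : HasCoords 𝒪) (hQ : Q.IsExactCourant) (D : Conn Q x) :
    ∃ D' : ∀ z, Conn Q z, IsConnSec Q x D' ∧ D' x = D := by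
  classical
  obtain ⟨d, c, p, hc⟩ := hX x
  choose q hq hqx using fun i => hQ.isSheaf.extend x (D.1 (p i x))
  have h1 : ∀ i, ∀ᶠ z in 𝓝 x, Q.anchor z (q i z) = p i z := fun i =>
    vectSec_eventuallyEq hX (hQ.anchor_sec x _ (hq i)) (hc.partial_sec i)
      (by rw [hqx, D.2.anchor])
  have h2 : ∀ i j, ∀ᶠ z in 𝓝 x, Q.pairing (q i z) (q j z) = 0 := fun i j =>
    (isSheaf_stalk 𝒪).separated x _ _ (hQ.pairing_sec x _ _ (hq i) (hq j)) (𝒪.isSec_zero x)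
      (by rw [hqx, hqx, D.2.isotropic])
  have h3 : ∀ᶠ z in 𝓝 x, IsCoord 𝒪 z c p ∧ (∀ i, Q.anchor z (q i z) = p i z) ∧
      ∀ i j, Q.pairing (q i z) (q j z) = 0 := by
    filter_upwards [hc.eventually, eventually_all.2 h1,
      eventually_all.2 fun i => eventually_all.2 (h2 i)] with z a b e using ⟨a, b, e⟩
  refine ⟨fun z => if h : IsCoord 𝒪 z c p ∧ (∀ i, Q.anchor z (q i z) = p i z) ∧
      ∀ i j, Q.pairing (q i z) (q j z) = 0 then
    connOfFrame hQ.toIsCourant h.1 (fun i => q i z) h.2.1 h.2.2 else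
    (nonempty_conn hX hQ z).some, (isConnSec_iff hQ.toIsCourant hc).2 fun i => ?_,
    conn_ext_frame hc fun i => ?_⟩
  · refine hQ.isSheaf.congr x _ _ (hq i) ?_
    filter_upwards [h3] with z hz
    rw [dif_pos hz]
    exact (connOfFrame_apply hQ.toIsCourant hz.1 (fun i => q i z) hz.2.1 hz.2.2 i).symm
  · beta_reduce
    rw [dif_pos h3.self_of_nhds]
    exact (connOfFrame_apply hQ.toIsCourant hc (fun i => q i x) h3.self_of_nhds.2.1
      h3.self_of_nhds.2.2 i).trans (hqx i)

/-- An element of `Q` is a section if and only if its components in the splitting by a section of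
the sheaf of connections are sections. -/
lemma IsConnSec.isSec_iff (hQ : Q.IsExactCourant) {D : ∀ z, Conn Q z} (hD : IsConnSec Q x D)
    (s : ∀ z, Q.stalk z) : Q.IsSec x s ↔
      𝒪.IsFormSec x 1 (fun z => connForm hQ.toIsCourant (D z) (s z)) ∧
        𝒪.IsVectSec x fun z => Q.anchor z (s z) := by
  constructor
  · refine fun hs => ⟨isFormSec_one_iff ?_, hQ.anchor_sec x s hs⟩
    filter_upwards [hQ.isSheaf.isOpen x s hs, hD] with z h1 h2 ξ hξ
    exact hQ.pairing_sec z _ _ h1 (h2 ξ hξ)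
  · rintro ⟨h1, h2⟩
    refine hQ.isSheaf.congr x _ _ (hQ.add_sec x _ _ (hD.self_of_nhds _ h2)
      (hQ.coanchor_sec x _ h1)) (Eventually.of_forall fun z => conn_add_coanchor hQ (D z) (s z))

lemma IsConnSec.curvature (hQ : Q.IsExactCourant) {D : ∀ z, Conn Q z} (hD : IsConnSec Q x D) :
    𝒪.IsFormSec x 3 fun z => curvature (D z) := by
  simp only [curvature_eq_curvForm hQ]
  filter_upwards [hD] with z h ξ hξ
  exact hQ.pairing_sec z _ _ (hQ.bracket_sec z _ _ (h _ (hξ 0)) (h _ (hξ 1))) (h _ (hξ 2))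

lemma isSheaf_conn (hX : HasCoords 𝒪) (hQ : Q.IsExactCourant) :
    IsSheaf (Conn Q) (IsConnSec Q) where
  isOpen _ _ h := Filter.Eventually.eventually_nhds h
  congr x s t h e := by
    filter_upwards [h, e.eventually_nhds] with z h1 h2 ξ hξ
    refine hQ.isSheaf.congr z _ _ (h1 ξ hξ) ?_
    filter_upwards [h2] with w hw
    rw [hw]
  extend x D := exists_isConnSec hX hQ D
  separated x s t hs ht e := by
    obtain ⟨d, c, p, hc⟩ := hX x
    have h : ∀ i, ∀ᶠ z in 𝓝 x, (s z).1 (p i z) = (t z).1 (p i z) := fun i =>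
      hQ.isSheaf.separated x _ _ ((isConnSec_iff hQ.toIsCourant hc).1 hs i)
        ((isConnSec_iff hQ.toIsCourant hc).1 ht i) (by rw [e])
    filter_upwards [hc.eventually, eventually_all.2 h] with z h1 h2
    exact conn_ext_frame h1 h2

end Connections

/-! ### The torsor of connections -/

section ConnTorsor

variable {𝒪 : FunctionSheaf K X} {x : X}

lemma curvature_vadd (Q : ECA 𝒪) (θ : 𝒪.Form x 2) (D : Conn Q.toCourantData x) :
    curvature ((connData Q).vadd θ D : Conn Q.toCourantData x) = d2 θ + curvature D := by
  have hQ := Q.isExact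
  have hT := isTwisted_connEquiv hQ D
  refine IsCurvature.eq_curvature hQ fun ξ η => ?_
  have hval : ∀ ζ, ((connData Q).vadd θ D : Conn Q.toCourantData x).1 ζ =
      D.1 ζ + Q.coanchor x (contract ζ θ) := fun ζ => rfl
  have hD : ∀ ζ, connEquiv hQ D (D.1 ζ) = (0, ζ) := fun ζ =>
    Prod.ext (connForm_conn hQ.toIsCourant D ζ) (D.2.anchor ζ)
  apply (connEquiv hQ D).injective
  simp only [hval, map_sub, hT.bracket, map_add, hT.coanchor, hD, Prod.mk_add_mk, zero_add,
    add_zero]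
  refine Prod.ext (form1_ext fun ζ => ?_) (sub_self _)
  change twist _ _ _ _ _ ![ζ] - θ ![⁅ξ, η⁆, ζ] = d2 θ ![ξ, η, ζ] + curvature D ![ξ, η, ζ]
  rw [twist_apply, d2_apply, curvature_eq_curvForm hQ]
  simp only [contract_apply]
  rw [form2_swap θ η ⁅ξ, ζ⁆, form2_swap θ ξ ⁅η, ζ⁆]
  ring

lemma existsUnique_vadd (Q : ECA 𝒪) (D D' : Conn Q.toCourantData x) :
    ∃! θ : 𝒪.Form x 2, (connData Q).vadd θ D = D' := by
  have hQ := Q.isExact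
  have hT := isTwisted_connEquiv hQ D
  have hsw : ∀ ξ η, connForm hQ.toIsCourant D (D'.1 ξ) ![η] =
      -connForm hQ.toIsCourant D (D'.1 η) ![ξ] := fun ξ η => by
    have h := hT.pairing (D'.1 ξ) (D'.1 η)
    rw [D'.2.isotropic, connEquiv_apply, connEquiv_apply, D'.2.anchor, D'.2.anchor] at h
    exact eq_neg_of_add_eq_zero_left h.symm
  have hvadd : ∀ (θ : 𝒪.Form x 2) ζ, ((connData Q).vadd θ D : Conn Q.toCourantData x).1 ζ =
      D.1 ζ + Q.coanchor x (contract ζ θ) := fun _ _ => rfl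
  refine ⟨mkForm2 (fun ξ η => connForm hQ.toIsCourant D (D'.1 ξ) ![η])
    (fun ξ ξ' η => by rw [map_add, map_add, AlternatingMap.add_apply])
    (fun a ξ η => by rw [map_smul, map_smul, AlternatingMap.smul_apply, smul_eq_mul])
    (fun ξ => eq_zero_of_add_self (by conv_lhs => enter [2]; rw [hsw]
                                      exact add_neg_cancel _)) hsw,
    Subtype.ext (LinearMap.ext fun ξ => ?_), fun θ hθ => form2_ext fun ξ η => ?_⟩
  · rw [hvadd, ← conn_add_coanchor hQ D (D'.1 ξ), D'.2.anchor]
    refine congrArg (fun α => D.1 ξ + Q.coanchor x α) (form1_ext fun η => rfl)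
  · have h := congrArg (fun D' : Conn Q.toCourantData x => connForm hQ.toIsCourant D (D'.1 ξ)) hθ
    simp only [hvadd, map_add, connForm_conn, connForm_coanchor, zero_add] at h
    exact congrArg (fun α : 𝒪.Form x 1 => α ![η]) h

lemma isTorsor_connData (hX : HasCoords 𝒪) (Q : ECA 𝒪) : (connData Q).IsTorsor where
  isSheaf := isSheaf_conn hX Q.isExact
  nonempty x := nonempty_conn hX Q.isExact x
  vadd_sec x θ D hθ hD := by
    change ∀ᶠ z in 𝓝 x, _
    filter_upwards [hθ.eventually, hD] with z h1 h2 ξ hξ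
    exact Q.isExact.add_sec z _ _ (h2 ξ hξ) (Q.isExact.coanchor_sec z _ (h1.contract hξ))
  zero_vadd x D := Subtype.ext (LinearMap.ext fun ξ => by
    change D.1 ξ + Q.coanchor x (contract ξ 0) = _
    have h : contract ξ (0 : 𝒪.Form x 2) = 0 := form1_ext fun η => rfl
    rw [h, map_zero, add_zero])
  add_vadd x θ θ' D := Subtype.ext (LinearMap.ext fun ξ => by
    change D.1 ξ + Q.coanchor x (contract ξ (θ + θ')) =
      D.1 ξ + Q.coanchor x (contract ξ θ') + Q.coanchor x (contract ξ θ)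
    have h : contract ξ (θ + θ') = contract ξ θ' + contract ξ θ :=
      form1_ext fun η => add_comm _ _
    rw [h, map_add, add_assoc])
  simply_transitive x D D' := existsUnique_vadd Q D D'
  curv_sec x D hD := IsConnSec.curvature Q.isExact hD
  curv_closed x D := isClosedForm_curvature Q.isExact D
  curv_vadd x θ D := curvature_vadd Q θ D

/-- A morphism of exact Courant algebroids preserves the pairing.  For `a = ⟨p, q⟩` and
`b = ⟨φ p, φ q⟩` the symmetric part of the bracket gives `d(g a) = d(g b)` for all functions `g`,
so `a - b` is annihilated by all `ξ g`. -/
lemma hom_pairing (hX : HasCoords 𝒪) {Q P : ECA 𝒪} (φ : ECA.Hom Q P) (p q : Q.stalk x) :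
    P.pairing (φ.toFun x p) (φ.toFun x q) = Q.pairing p q := by
  obtain ⟨d, c, v, hc⟩ := hX x
  have hQ := Q.isExact
  have hP := P.isExact
  have hd : ∀ r : Q.stalk x,
      d0 (P.pairing (φ.toFun x r) (φ.toFun x q)) = d0 (Q.pairing r q) := fun r => by
    apply hP.coanchor_injective x
    rw [← hP.bracket_symm, ← φ.isHom.map_bracket, ← φ.isHom.map_bracket, ← map_add,
      hQ.bracket_symm, φ.isHom.map_coanchor]
  have hsm : ∀ (g : 𝒪.stalk x) (ξ : 𝒪.T x),
      act ξ g * (P.pairing (φ.toFun x p) (φ.toFun x q) - Q.pairing p q) = 0 := fun g ξ => by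
    have h1 := congrArg (fun α : 𝒪.Form x 1 => α ![ξ]) (hd (g • p))
    have h2 := congrArg (fun α : 𝒪.Form x 1 => α ![ξ]) (hd p)
    simp only [map_smul, hP.pairing_smul_left, hQ.pairing_smul_left, d0_apply, act_mul] at h1 h2
    linear_combination h1 - g * h2
  rcases Nat.eq_zero_or_pos d with rfl | hpos
  · -- Without coordinates there are no nonzero vector fields, and `Q` is zero.
    have hT : ∀ ξ : 𝒪.T x, ξ = 0 := fun ξ => hc.T_ext fun i => i.elim0
    have hq : q = 0 := by
      obtain ⟨D⟩ := nonempty_conn hX hQ x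
      have hf : connForm hQ.toIsCourant D q = 0 := form1_ext fun ξ => by
        rw [hT ξ, map_zero_fst, map_zero_fst]
      rw [← conn_add_coanchor hQ D q, hf, hT (Q.anchor x q), map_zero, map_zero, add_zero]
    rw [hq, map_zero]
    exact (map_zero (pairingLin hP.toIsCourant x _)).trans
      (map_zero (pairingLin hQ.toIsCourant x _)).symm
  · have h := hsm (c ⟨0, hpos⟩ x) (v ⟨0, hpos⟩ x)
    rw [hc.dual_at, if_pos rfl, one_mul] at h
    exact sub_eq_zero.mp h

theorem connectionsWellDefined (hX : HasCoords 𝒪) : ConnectionsWellDefined 𝒪 :=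
  have hconn : ∀ {Q P : ECA 𝒪} (φ : ECA.Hom Q P) {x : X} (D : Conn Q.toCourantData x),
      IsConnection P.toCourantData x (φ.toFun x ∘ₗ D.1) := fun φ _ D =>
    ⟨fun ξ => (φ.isHom.map_anchor _ _).trans (D.2.anchor ξ),
      fun ξ η => (hom_pairing hX φ _ _).trans (D.2.isotropic ξ η)⟩
  { existsUnique_curvature := fun Q x D => existsUnique_isCurvature Q.isExact D
    isTorsor := isTorsor_connData hX
    isConnection := hconn
    isTorsorHom := fun {Q P} φ =>
      { map_sec := fun x D hD => by
          change ∀ᶠ z in 𝓝 x, _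
          filter_upwards [hD] with z h ξ hξ
          exact φ.isHom.map_sec z _ (h ξ hξ)
        map_vadd := fun x θ D => Subtype.ext (LinearMap.ext fun ξ => by
          change φ.toFun x (D.1 ξ + Q.coanchor x (contract ξ θ)) =
            φ.toFun x (D.1 ξ) + P.coanchor x (contract ξ θ)
          rw [map_add, φ.isHom.map_coanchor])
        map_curv := fun x (D : Conn Q.toCourantData x) =>
          IsCurvature.eq_curvature P.isExact (D := ⟨_, hconn φ D⟩) fun ξ η => by
            change P.bracket (φ.toFun x (D.1 ξ)) (φ.toFun x (D.1 η)) - φ.toFun x (D.1 ⁅ξ, η⁆) = _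
            rw [← φ.isHom.map_bracket, ← map_sub, isCurvature_curvForm Q.isExact D ξ η,
              φ.isHom.map_coanchor, ← curvature_eq_curvForm Q.isExact]
            rfl } }

end ConnTorsor

/-! ### The inverse image of an exact Courant algebroid -/

section InverseImage

variable {𝒪Y : FunctionSheaf K Y} {𝒪X : FunctionSheaf K X} (f : 𝒪Y.Map 𝒪X) {y : Y}

/-- The differential `df : T_Y → f^*T_X`. -/
def differential (hX : HasCoords 𝒪X) (y : Y) :
    𝒪Y.T y →ₗ[𝒪Y.stalk y] PullStalk f y (𝒪X.T (f.toFun y)) where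
  toFun ξ := ∑ i, (exists_isDifferential f hX ξ).choose_spec.choose i ⊗ₜ
    (exists_isDifferential f hX ξ).choose_spec.choose_spec.choose i
  map_add' ξ η := by
    refine ((exists_isDifferential f hX (ξ + η)).choose_spec.choose_spec.choose_spec).unique f hX
      fun g => ?_
    rw [map_add, Pi.add_apply, (exists_isDifferential f hX ξ).choose_spec.choose_spec.choose_spec g,
      (exists_isDifferential f hX η).choose_spec.choose_spec.choose_spec g]
    rfl
  map_smul' a ξ := by
    refine ((exists_isDifferential f hX (a • ξ)).choose_spec.choose_spec.choose_spec).unique f hX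
      fun g => ?_
    rw [RingHom.id_apply, map_smul, Pi.smul_apply,
      (exists_isDifferential f hX ξ).choose_spec.choose_spec.choose_spec g]
    rfl

lemma isDifferential_differential (hX : HasCoords 𝒪X) (ξ : 𝒪Y.T y) :
    IsDifferential f y ξ (differential f hX y ξ) :=
  (exists_isDifferential f hX ξ).choose_spec.choose_spec.choose_spec

variable {Q : CourantData 𝒪X}

instance isScalarTower_form (k : ℕ) :
    IsScalarTower (𝒪X.stalk (f.toFun y)) (𝒪Y.stalk y) (𝒪Y.Form y k) :=
  ⟨fun a b θ => by
    ext v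
    exact smul_assoc a b (θ v)⟩

/-- The map `f^*Q → Ω¹_Y` induced by `q ↦ f^*⟨q, D(·)⟩`. -/
def pullConnForm (hX : HasCoords 𝒪X) (hQ : Q.IsCourant) (D : Conn Q (f.toFun y)) :
    PullStalk f y (Q.stalk (f.toFun y)) →ₗ[𝒪Y.stalk y] 𝒪Y.Form y 1 :=
  LinearMap.liftBaseChange (𝒪Y.stalk y)
    { toFun := fun q => pullForm f y (connForm hQ D q)
      map_add' := fun p q => by rw [map_add, pullForm_add f hX]
      map_smul' := fun a q => by
        rw [map_smul, pullForm_smul f hX]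
        rfl }

@[simp] lemma pullConnForm_tmul (hX : HasCoords 𝒪X) (hQ : Q.IsCourant) (D : Conn Q (f.toFun y))
    (h : 𝒪Y.stalk y) (q : Q.stalk (f.toFun y)) :
    pullConnForm f hX hQ D (h ⊗ₜ q) = h • pullForm f y (connForm hQ D q) := rfl

lemma pullConnForm_conn (hX : HasCoords 𝒪X) (hQ : Q.IsCourant) (D : Conn Q (f.toFun y))
    (t : PullStalk f y (𝒪X.T (f.toFun y))) :
    pullConnForm f hX hQ D (D.1.baseChange (𝒪Y.stalk y) t) = 0 := by
  induction t using TensorProduct.induction_on with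
  | zero => simp
  | add t s ht hs => rw [map_add, map_add, ht, hs, add_zero]
  | tmul h v =>
    rw [LinearMap.baseChange_tmul, pullConnForm_tmul, connForm_conn, pullForm_zero f hX, smul_zero]

lemma triple_mem_relations (hX : HasCoords 𝒪X) (hQ : Q.IsExactCourant) (D : Conn Q (f.toFun y))
    (u : PullStalk f y (Q.stalk (f.toFun y))) :
    triple f y Q (pullConnForm f hX hQ.toIsCourant D u)
      (D.1.baseChange (𝒪Y.stalk y) ((Q.anchor (f.toFun y)).baseChange (𝒪Y.stalk y) u) - u) 0 ∈
      relations f y Q := by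
  induction u using TensorProduct.induction_on with
  | zero =>
    convert (relations f y Q).zero_mem
    simp only [map_zero, sub_zero]
    rfl
  | add u v hu hv =>
    convert (relations f y Q).add_mem hu hv using 1
    refine Prod.ext (map_add _ _ _) (Prod.ext ?_ (add_zero 0).symm)
    change _ - (u + v) = (_ - u) + (_ - v)
    rw [map_add, map_add]
    abel
  | tmul h q =>
    convert (relations f y Q).smul_mem h (Submodule.subset_span
      ⟨connForm hQ.toIsCourant D q, rfl⟩) using 1
    refine Prod.ext rfl (Prod.ext ?_ (smul_zero h).symm)
    change _ = h • (-((1 : 𝒪Y.stalk y) ⊗ₜ[𝒪X.stalk (f.toFun y)]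
      Q.coanchor _ (connForm hQ.toIsCourant D q)) : PullStalk f y (Q.stalk (f.toFun y)))
    have e : D.1 (Q.anchor _ q) - q = -Q.coanchor _ (connForm hQ.toIsCourant D q) := by
      rw [sub_eq_iff_eq_add, ← sub_eq_neg_add, eq_sub_iff_add_eq]
      exact conn_add_coanchor hQ D q
    rw [LinearMap.baseChange_tmul, LinearMap.baseChange_tmul, ← TensorProduct.tmul_sub,
      ← TensorProduct.tmul_neg, TensorProduct.smul_tmul', smul_eq_mul, mul_one]
    exact congrArg (fun r => h ⊗ₜ[𝒪X.stalk (f.toFun y)] r) e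

/-- The map `(α, u, ξ) ↦ (α + f^*⟨u, D(·)⟩, ξ)` on the ambient module. -/
def ambientSplit (hX : HasCoords 𝒪X) (hQ : Q.IsCourant) (D : Conn Q (f.toFun y)) :
    Ambient f y Q →ₗ[𝒪Y.stalk y] 𝒪Y.Form y 1 × 𝒪Y.T y where
  toFun m := (m.1 + pullConnForm f hX hQ D m.2.1, m.2.2)
  map_add' m m' := Prod.ext (by
    change m.1 + m'.1 + pullConnForm f hX hQ D (m.2.1 + m'.2.1) = _ + _
    rw [map_add]
    exact add_add_add_comm _ _ _ _) rfl
  map_smul' a m := Prod.ext (by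
    change a • m.1 + pullConnForm f hX hQ D (a • m.2.1) = a • (_ + _)
    rw [map_smul, smul_add]) rfl

lemma ambientSplit_relations (hX : HasCoords 𝒪X) (hQ : Q.IsCourant) (D : Conn Q (f.toFun y)) :
    relations f y Q ≤ LinearMap.ker (ambientSplit f hX hQ D) := by
  rw [relations, Submodule.span_le]
  rintro _ ⟨γ, rfl⟩
  refine Prod.ext ?_ rfl
  change pullForm f y γ + pullConnForm f hX hQ D (-(1 ⊗ₜ Q.coanchor _ γ)) = 0
  rw [map_neg, pullConnForm_tmul, connForm_coanchor, one_smul, add_neg_cancel]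

lemma baseChange_anchor_conn (D : Conn Q (f.toFun y)) (t : PullStalk f y (𝒪X.T (f.toFun y))) :
    (Q.anchor (f.toFun y)).baseChange (𝒪Y.stalk y) (D.1.baseChange (𝒪Y.stalk y) t) = t := by
  induction t using TensorProduct.induction_on with
  | zero => simp
  | add t s ht hs => rw [map_add, map_add, ht, hs]
  | tmul h v => rw [LinearMap.baseChange_tmul, LinearMap.baseChange_tmul, D.2.anchor]

lemma conn_mem_fiberProduct (D : Conn Q (f.toFun y)) (α : 𝒪Y.Form y 1)
    {ξ : 𝒪Y.T y} {t : PullStalk f y (𝒪X.T (f.toFun y))} (ht : IsDifferential f y ξ t) :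
    triple f y Q α (D.1.baseChange (𝒪Y.stalk y) t) ξ ∈ fiberProduct f y Q :=
  fun g => Eq.trans (congrArg (fun u => actAlong f y u g) (baseChange_anchor_conn f D t)) (ht g)

/-- A connection on `Q` splits `f⁺⁺Q` into `Ω¹_Y ⊕ T_Y`. -/
def inverseEquiv (hX : HasCoords 𝒪X) (hQ : Q.IsExactCourant) (D : Conn Q (f.toFun y)) :
    InverseStalk f y Q ≃ₗ[𝒪Y.stalk y] 𝒪Y.Form y 1 × 𝒪Y.T y where
  toLinearMap := Submodule.liftQ _
    (ambientSplit f hX hQ.toIsCourant D ∘ₗ (fiberProduct f y Q).subtype)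
    fun _ hm => ambientSplit_relations f hX hQ.toIsCourant D hm
  invFun a := Submodule.Quotient.mk ⟨triple f y Q a.1
    (D.1.baseChange (𝒪Y.stalk y) (differential f hX y a.2)) a.2,
    conn_mem_fiberProduct f D a.1 (isDifferential_differential f hX a.2)⟩
  left_inv s := by
    induction s using Submodule.Quotient.induction_on with
    | _ m =>
      obtain ⟨⟨α, u, ξ⟩, hm⟩ := m
      have hd : differential f hX y ξ = (Q.anchor (f.toFun y)).baseChange (𝒪Y.stalk y) u :=
        (isDifferential_differential f hX ξ).unique f hX hm
      refine (Submodule.Quotient.eq _).2 ?_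
      have h := triple_mem_relations f hX hQ D u
      rw [← hd] at h
      change triple f y Q _ _ _ - _ ∈ relations f y Q
      convert h using 1
      refine Prod.ext ?_ (Prod.ext rfl (sub_self ξ))
      exact add_sub_cancel_left α _
  right_inv a := by
    refine Prod.ext ?_ rfl
    change a.1 + pullConnForm f hX hQ.toIsCourant D _ = a.1
    exact (congrArg (a.1 + ·) (pullConnForm_conn f hX hQ.toIsCourant D _)).trans (add_zero _)

end InverseImage

section InverseOperations

variable {𝒪Y : FunctionSheaf K Y} {𝒪X : FunctionSheaf K X} (f : 𝒪Y.Map 𝒪X) {y : Y}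
  {Q : CourantData 𝒪X}

lemma exists_eq_sum_tmul (M : Type u) [AddCommGroup M] [Module (𝒪X.stalk (f.toFun y)) M]
    (u : PullStalk f y M) :
    ∃ (m : ℕ) (h : Fin m → 𝒪Y.stalk y) (q : Fin m → M), u = ∑ i, h i ⊗ₜ q i := by
  induction u using TensorProduct.induction_on with
  | zero => exact ⟨0, Fin.elim0, Fin.elim0, by simp⟩
  | tmul h q => exact ⟨1, fun _ => h, fun _ => q, by simp⟩
  | add u v hu hv =>
    obtain ⟨m, h, q, rfl⟩ := hu
    obtain ⟨l, j, p, rfl⟩ := hv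
    exact ⟨m + l, Fin.append h j, Fin.append q p, by simp [Fin.sum_univ_add]⟩

lemma exists_isClass (s : InverseStalk f y Q) :
    ∃ (m : ℕ) (α : 𝒪Y.Form y 1) (h : Fin m → 𝒪Y.stalk y) (q : Fin m → Q.stalk (f.toFun y))
      (ξ : 𝒪Y.T y), IsClass s α (∑ i, h i ⊗ₜ q i) ξ := by
  induction s using Submodule.Quotient.induction_on with
  | _ m =>
    obtain ⟨⟨α, u, ξ⟩, hm⟩ := m
    obtain ⟨m, h, q, rfl⟩ := exists_eq_sum_tmul f _ u
    exact ⟨m, α, h, q, ξ, hm, rfl⟩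

variable {f}

lemma IsClass.isDifferential {s : InverseStalk f y Q} {α : 𝒪Y.Form y 1} {m : ℕ}
    {h : Fin m → 𝒪Y.stalk y} {q : Fin m → Q.stalk (f.toFun y)} {ξ : 𝒪Y.T y}
    (H : IsClass s α (∑ i, h i ⊗ₜ q i) ξ) :
    IsDifferential f y ξ (∑ i, h i ⊗ₜ Q.anchor _ (q i)) := by
  obtain ⟨hm, -⟩ := H
  have h' : IsDifferential f y ξ ((Q.anchor (f.toFun y)).baseChange (𝒪Y.stalk y)
    (∑ i, h i ⊗ₜ q i)) := hm
  rw [map_sum] at h'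
  exact h'

lemma IsClass.inverseEquiv_eq (hX : HasCoords 𝒪X) (hQ : Q.IsExactCourant)
    (D : Conn Q (f.toFun y)) {s : InverseStalk f y Q} {α : 𝒪Y.Form y 1}
    {u : PullStalk f y (Q.stalk (f.toFun y))} {ξ : 𝒪Y.T y} (H : IsClass s α u ξ) :
    inverseEquiv f hX hQ D s = (α + pullConnForm f hX hQ.toIsCourant D u, ξ) := by
  obtain ⟨hm, rfl⟩ := H
  rfl

lemma IsClass.inverseEquiv_sum (hX : HasCoords 𝒪X) (hQ : Q.IsExactCourant)
    (D : Conn Q (f.toFun y)) {s : InverseStalk f y Q} {α : 𝒪Y.Form y 1} {m : ℕ}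
    {h : Fin m → 𝒪Y.stalk y} {q : Fin m → Q.stalk (f.toFun y)} {ξ : 𝒪Y.T y}
    (H : IsClass s α (∑ i, h i ⊗ₜ q i) ξ) :
    inverseEquiv f hX hQ D s =
      (α + ∑ i, h i • pullForm f y (connForm hQ.toIsCourant D (q i)), ξ) := by
  rw [H.inverseEquiv_eq hX hQ D, map_sum]
  rfl

lemma IsPairing.eq_pairing (hX : HasCoords 𝒪X) (hQ : Q.IsExactCourant)
    (D : Conn Q (f.toFun y)) {s t : InverseStalk f y Q} {b : 𝒪Y.stalk y} (H : IsPairing s t b) :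
    b = (inverseEquiv f hX hQ D s).1 ![(inverseEquiv f hX hQ D t).2] +
      (inverseEquiv f hX hQ D t).1 ![(inverseEquiv f hX hQ D s).2] := by
  obtain ⟨m, α, h, q, ξ, l, β, j, p, η, hs, ht, rfl⟩ := H
  rw [hs.inverseEquiv_sum hX hQ D, ht.inverseEquiv_sum hX hQ D]
  simp only [AlternatingMap.add_apply, form_sum_apply, AlternatingMap.smul_apply,
    pullForm_one_apply f hX hs.isDifferential, pullForm_one_apply f hX ht.isDifferential,
    smul_eq_mul, (isTwisted_connEquiv hQ D).pairing, connEquiv_apply, map_add, mul_add,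
    Finset.sum_add_distrib, Finset.mul_sum]
  have e1 : ∀ i k, h i * j k * f.comap y (connForm hQ.toIsCourant D (q i) ![Q.anchor _ (p k)]) =
    h i * (j k * f.comap y (connForm hQ.toIsCourant D (q i) ![Q.anchor _ (p k)])) :=
    fun i k => mul_assoc _ _ _
  have e2 : ∀ i k, h i * j k * f.comap y (connForm hQ.toIsCourant D (p k) ![Q.anchor _ (q i)]) =
    j k * (h i * f.comap y (connForm hQ.toIsCourant D (p k) ![Q.anchor _ (q i)])) :=
    fun i k => by ring
  simp only [e1, e2]
  rw [Finset.sum_comm (γ := Fin m) (f := fun i k => j k * (h i *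
    f.comap y (connForm hQ.toIsCourant D (p k) ![Q.anchor _ (q i)])))]
  ring

variable (f)

/-- `L_ξ (f^*δ)` in terms of `df(ξ) = ∑ i, h i ⊗ v i`. -/
lemma lieDeriv_pullForm (hX : HasCoords 𝒪X) {ξ : 𝒪Y.T y} {m : ℕ} {h : Fin m → 𝒪Y.stalk y}
    {v : Fin m → 𝒪X.T (f.toFun y)} (H : IsDifferential f y ξ (∑ i, h i ⊗ₜ v i))
    (δ : 𝒪X.Form (f.toFun y) 1) (ζ : 𝒪Y.T y) :
    lieDeriv ξ (pullForm f y δ) ![ζ] = ∑ i, h i * pullForm f y (lieDeriv (v i) δ) ![ζ] +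
      ∑ i, f.comap y (δ ![v i]) * act ζ (h i) := by
  have h1 : ∀ i, pullForm f y (lieDeriv (v i) δ) ![ζ] =
      pullForm f y (contract (v i) (d1 δ)) ![ζ] + act ζ (f.comap y (δ ![v i])) := fun i => by
    rw [lieDeriv, pullForm_add f hX, pullForm_d0 f hX]
    rfl
  have h2 : lieDeriv ξ (pullForm f y δ) ![ζ] =
      contract ξ (d1 (pullForm f y δ)) ![ζ] + act ζ (pullForm f y δ ![ξ]) := rfl
  rw [h2, ← pullForm_d1 f hX, contract_pullForm f hX H, pullForm_one_apply f hX H]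
  simp only [h1, form_sum_apply, AlternatingMap.smul_apply, act_sum, act_mul, smul_eq_mul, mul_add,
    Finset.sum_add_distrib]
  simp only [mul_comm (act ζ (h _))]
  ring

lemma contract_d1_pullForm (hX : HasCoords 𝒪X) {η : 𝒪Y.T y} {l : ℕ} {j : Fin l → 𝒪Y.stalk y}
    {w : Fin l → 𝒪X.T (f.toFun y)} (H : IsDifferential f y η (∑ k, j k ⊗ₜ w k))
    (γ : 𝒪X.Form (f.toFun y) 1) (ζ : 𝒪Y.T y) :
    contract η (d1 (pullForm f y γ)) ![ζ] =
      ∑ k, j k * pullForm f y (contract (w k) (d1 γ)) ![ζ] := by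
  rw [← pullForm_d1 f hX, contract_pullForm f hX H]
  simp only [form_sum_apply, AlternatingMap.smul_apply, smul_eq_mul]

lemma contract_contract_pullForm (hX : HasCoords 𝒪X) {ξ η : 𝒪Y.T y} {m l : ℕ}
    {h : Fin m → 𝒪Y.stalk y} {v : Fin m → 𝒪X.T (f.toFun y)}
    (H : IsDifferential f y ξ (∑ i, h i ⊗ₜ v i)) {j : Fin l → 𝒪Y.stalk y}
    {w : Fin l → 𝒪X.T (f.toFun y)} (H' : IsDifferential f y η (∑ k, j k ⊗ₜ w k))
    (θ : 𝒪X.Form (f.toFun y) 3) (ζ : 𝒪Y.T y) :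
    pullForm f y θ ![ξ, η, ζ] =
      ∑ i, ∑ k, h i * (j k * pullForm f y (contract (w k) (contract (v i) θ)) ![ζ]) := by
  have e : pullForm f y θ ![ξ, η, ζ] = contract ξ (pullForm f y θ) ![η, ζ] := rfl
  rw [e, contract_pullForm f hX H, form_sum_apply]
  refine Finset.sum_congr rfl fun i _ => ?_
  have e' : pullForm f y (contract (v i) θ) ![η, ζ] =
    contract η (pullForm f y (contract (v i) θ)) ![ζ] := rfl
  rw [AlternatingMap.smul_apply, e', contract_pullForm f hX H', form_sum_apply, smul_eq_mul,
    Finset.mul_sum]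
  simp only [AlternatingMap.smul_apply, smul_eq_mul]

/-- The value of the twisted bracket on forms `∑ h i f^*(γ i)` and `∑ j k f^*(δ k)`, where
`df(ξ) = ∑ i, h i ⊗ v i` and `df(η) = ∑ k, j k ⊗ w k`. -/
lemma twist_pullForm (hX : HasCoords 𝒪X) {ξ η : 𝒪Y.T y} {m l : ℕ}
    {h : Fin m → 𝒪Y.stalk y} {v : Fin m → 𝒪X.T (f.toFun y)}
    (hξ : IsDifferential f y ξ (∑ i, h i ⊗ₜ v i)) {j : Fin l → 𝒪Y.stalk y}
    {w : Fin l → 𝒪X.T (f.toFun y)} (hη : IsDifferential f y η (∑ k, j k ⊗ₜ w k))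
    (H : 𝒪X.Form (f.toFun y) 3) (γ : Fin m → 𝒪X.Form (f.toFun y) 1)
    (δ : Fin l → 𝒪X.Form (f.toFun y) 1) :
    twist (pullForm f y H) (∑ i, h i • pullForm f y (γ i)) ξ (∑ k, j k • pullForm f y (δ k)) η =
      (∑ i, ∑ k, (j k * f.comap y (γ i ![w k] + δ k ![v i])) • d0 (h i)) +
      (∑ i, ∑ k, (h i * j k) • pullForm f y (twist H (γ i) (v i) (δ k) (w k)) -
        ∑ i, act η (h i) • pullForm f y (γ i) + ∑ k, act ξ (j k) • pullForm f y (δ k)) := by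
  refine form1_ext fun ζ => ?_
  have eL : ∀ (a : 𝒪Y.stalk y) (β : 𝒪Y.Form y 1),
      act ξ (a * β ![ζ]) - a * β ![⁅ξ, ζ⁆] = act ξ a * β ![ζ] + a * lieDeriv ξ β ![ζ] := by
    intro a β
    rw [lieDeriv_apply, act_mul]
    ring
  have eD : ∀ (a : 𝒪Y.stalk y) (α : 𝒪Y.Form y 1),
      act η (a * α ![ζ]) - act ζ (a * α ![η]) - a * α ![⁅η, ζ⁆] =
        act η a * α ![ζ] - α ![η] * act ζ a + a * contract η (d1 α) ![ζ] := by
    intro a α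
    have e : contract η (d1 α) ![ζ] = d1 α ![η, ζ] := rfl
    rw [e, d1_apply, act_mul, act_mul]
    ring
  have eT : ∀ i k, pullForm f y (twist H (γ i) (v i) (δ k) (w k)) ![ζ] =
      pullForm f y (lieDeriv (v i) (δ k)) ![ζ] - pullForm f y (contract (w k) (d1 (γ i))) ![ζ] +
        pullForm f y (contract (w k) (contract (v i) H)) ![ζ] := fun i k => by
    rw [twist, pullForm_add f hX, pullForm_sub f hX]
    rfl
  have hL : twist (pullForm f y H) (∑ i, h i • pullForm f y (γ i)) ξ
      (∑ k, j k • pullForm f y (δ k)) η ![ζ] =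
      ∑ k, (act ξ (j k) * pullForm f y (δ k) ![ζ] + j k * lieDeriv ξ (pullForm f y (δ k)) ![ζ]) -
      ∑ i, (act η (h i) * pullForm f y (γ i) ![ζ] - pullForm f y (γ i) ![η] * act ζ (h i) +
        h i * contract η (d1 (pullForm f y (γ i))) ![ζ]) + pullForm f y H ![ξ, η, ζ] := by
    rw [twist_apply]
    simp only [form_sum_apply, AlternatingMap.smul_apply, smul_eq_mul, act_sum,
      ← Finset.sum_sub_distrib, eL, eD]
  have hsub : ∀ α β : 𝒪Y.Form y 1, (α - β) ![ζ] = α ![ζ] - β ![ζ] := fun _ _ => rfl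
  rw [hL, contract_contract_pullForm f hX hξ hη]
  simp only [lieDeriv_pullForm f hX hξ, contract_d1_pullForm f hX hη,
    pullForm_one_apply f hX hη, AlternatingMap.add_apply, hsub, form_sum_apply,
    AlternatingMap.smul_apply, smul_eq_mul, d0_apply, eT, map_add, mul_add, mul_sub, add_mul,
    Finset.mul_sum, Finset.sum_mul, Finset.sum_add_distrib, Finset.sum_sub_distrib]
  rw [Finset.sum_comm (γ := Fin l) (f := fun k i => j k * (h i *
      pullForm f y (lieDeriv (v i) (δ k)) ![ζ])),
    Finset.sum_comm (γ := Fin l) (f := fun k i => j k * (f.comap y (δ k ![v i]) * act ζ (h i)))]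
  have e1 : ∀ i k, j k * (h i * pullForm f y (lieDeriv (v i) (δ k)) ![ζ]) =
      h i * j k * pullForm f y (lieDeriv (v i) (δ k)) ![ζ] := fun i k => by ring
  simp only [e1, ← mul_assoc]
  ring

lemma existsUnique_isPairing (hX : HasCoords 𝒪X) (hQ : Q.IsExactCourant)
    (s t : InverseStalk f y Q) : ∃! b, IsPairing s t b := by
  obtain ⟨D⟩ := nonempty_conn hX hQ (f.toFun y)
  obtain ⟨m, α, h, q, ξ, hs⟩ := exists_isClass f s
  obtain ⟨l, β, j, p, η, ht⟩ := exists_isClass f t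
  refine ⟨_, ⟨m, α, h, q, ξ, l, β, j, p, η, hs, ht, rfl⟩, fun b hb => ?_⟩
  rw [hb.eq_pairing hX hQ D]
  exact (IsPairing.eq_pairing hX hQ D ⟨m, α, h, q, ξ, l, β, j, p, η, hs, ht, rfl⟩).symm

/-- The formula for the bracket gives an element of the fibre product, because the anchor of `Q`
preserves brackets and `df` is compatible with commutators. -/
lemma exists_isBracket (hQ : Q.IsExactCourant) (s t : InverseStalk f y Q) :
    ∃ r, IsBracket s t r := by
  obtain ⟨m, α, h, q, ξ, hs⟩ := exists_isClass f s
  obtain ⟨l, β, j, p, η, ht⟩ := exists_isClass f t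
  refine ⟨_, m, α, h, q, ξ, l, β, j, p, η, hs, ht, ?_, rfl⟩
  have key : ∀ α u, IsDifferential f y ⁅ξ, η⁆ ((Q.anchor (f.toFun y)).baseChange (𝒪Y.stalk y) u) →
    triple f y Q α u ⁅ξ, η⁆ ∈ fiberProduct f y Q := fun _ _ h => h
  refine key _ _ ?_
  have e := hs.isDifferential.lie f ht.isDifferential
  simp only [← hQ.anchor_bracket] at e
  simp only [map_add, map_sub, map_sum, LinearMap.baseChange_tmul]
  exact e

/-- In the splitting by `D` any bracket given by representatives is the twisted bracket.  In
particular it does not depend on the representatives. -/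
lemma IsBracket.inverseEquiv_eq (hX : HasCoords 𝒪X) (hQ : Q.IsExactCourant)
    (D : Conn Q (f.toFun y)) {s t r : InverseStalk f y Q} (H : IsBracket s t r) :
    inverseEquiv f hX hQ D r =
      (twist (pullForm f y (curvForm hQ.toIsCourant D)) (inverseEquiv f hX hQ D s).1
        (inverseEquiv f hX hQ D s).2 (inverseEquiv f hX hQ D t).1 (inverseEquiv f hX hQ D t).2,
        ⁅(inverseEquiv f hX hQ D s).2, (inverseEquiv f hX hQ D t).2⁆) := by
  obtain ⟨m, α, h, q, ξ, l, β, j, p, η, hs, ht, hr⟩ := H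
  rw [hs.inverseEquiv_sum hX hQ D, ht.inverseEquiv_sum hX hQ D, hr.inverseEquiv_eq hX hQ D]
  refine Prod.ext ?_ rfl
  have hB : ∀ i k, connForm hQ.toIsCourant D (Q.bracket (q i) (p k)) =
      twist (curvForm hQ.toIsCourant D) (connForm hQ.toIsCourant D (q i)) (Q.anchor _ (q i))
        (connForm hQ.toIsCourant D (p k)) (Q.anchor _ (p k)) := fun i k =>
    congrArg Prod.fst ((isTwisted_connEquiv hQ D).bracket (q i) (p k))
  have hP : ∀ i k, Q.pairing (q i) (p k) =
      connForm hQ.toIsCourant D (q i) ![Q.anchor _ (p k)] +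
        connForm hQ.toIsCourant D (p k) ![Q.anchor _ (q i)] := fun i k =>
    (isTwisted_connEquiv hQ D).pairing (q i) (p k)
  simp only [map_add, map_sub, map_sum, pullConnForm_tmul, hB, hP]
  have h0 : ∀ θ : 𝒪Y.Form y 3, twist θ (α + ∑ i, h i • pullForm f y (connForm hQ.toIsCourant D (q i)))
      ξ (β + ∑ k, j k • pullForm f y (connForm hQ.toIsCourant D (p k))) η =
      lieDeriv ξ β - contract η (d1 α) +
        twist θ (∑ i, h i • pullForm f y (connForm hQ.toIsCourant D (q i))) ξ
          (∑ k, j k • pullForm f y (connForm hQ.toIsCourant D (p k))) η := fun θ => by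
    have e1 : ∀ α α' : 𝒪Y.Form y 1, contract η (d1 (α + α')) =
        contract η (d1 α) + contract η (d1 α') := fun α α' => form1_ext fun ζ => by
      change d1 (α + α') ![η, ζ] = d1 α ![η, ζ] + d1 α' ![η, ζ]
      simp only [d1_apply, AlternatingMap.add_apply, act_add]
      ring
    have e2 : ∀ β β' : 𝒪Y.Form y 1, lieDeriv ξ (β + β') = lieDeriv ξ β + lieDeriv ξ β' :=
      fun β β' => form1_ext fun ζ => by
        simp only [lieDeriv_apply, AlternatingMap.add_apply, act_add]
        ring
    rw [twist, twist, e1, e2]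
    abel
  rw [h0, twist_pullForm f hX hs.isDifferential ht.isDifferential]
  simp only [map_add]
  abel

lemma existsUnique_isBracket (hX : HasCoords 𝒪X) (hQ : Q.IsExactCourant)
    (s t : InverseStalk f y Q) : ∃! r, IsBracket s t r := by
  obtain ⟨D⟩ := nonempty_conn hX hQ (f.toFun y)
  obtain ⟨r, hr⟩ := exists_isBracket f hQ s t
  refine ⟨r, hr, fun r' hr' => (inverseEquiv f hX hQ D).injective ?_⟩
  rw [hr.inverseEquiv_eq f hX hQ D, hr'.inverseEquiv_eq f hX hQ D]

lemma isPairing_pairing (hX : HasCoords 𝒪X) (hQ : Q.IsExactCourant)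
    (s t : InverseStalk f y Q) : IsPairing s t ((inverseData f Q).pairing (x := y) s t) :=
  Classical.epsilon_spec (existsUnique_isPairing f hX hQ s t).exists

lemma isBracket_bracket (hQ : Q.IsExactCourant)
    (s t : InverseStalk f y Q) : IsBracket s t ((inverseData f Q).bracket (x := y) s t) :=
  Classical.epsilon_spec (exists_isBracket f hQ s t)

/-- A connection on `Q` with curvature `H` identifies `f⁺⁺Q` with the standard Courant algebroid
on `Y` twisted by `f^*H`. -/
theorem isTwisted_inverseEquiv (hX : HasCoords 𝒪X) (hQ : Q.IsExactCourant)
    (D : Conn Q (f.toFun y)) :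
    IsTwisted (inverseData f Q) y (pullForm f y (curvForm hQ.toIsCourant D))
      (inverseEquiv f hX hQ D) where
  anchor s := by
    induction s using Submodule.Quotient.induction_on with
    | _ m => rfl
  coanchor α := Prod.ext
    ((congrArg (α + ·) (map_zero (pullConnForm f hX hQ.toIsCourant D))).trans (add_zero α)) rfl
  pairing s t := (isPairing_pairing f hX hQ s t).eq_pairing hX hQ D
  bracket s t := (isBracket_bracket f hQ s t).inverseEquiv_eq f hX hQ D

/-- Conversely, given sections `α` and `ξ`, a section of `f⁺⁺Q` with these components is the class of
`(α, ∑ ξ(f^*c i) ⊗ D(p i), ξ)`, by the formula for `df(ξ)` in coordinates. -/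
lemma isInverseSec_iff (hX : HasCoords 𝒪X) (hQ : Q.IsExactCourant) {D : ∀ x, Conn Q x}
    (hD : IsConnSec Q (f.toFun y) D) (s : ∀ z, InverseStalk f z Q) :
    IsInverseSec f y Q s ↔
      𝒪Y.IsFormSec y 1 (fun z => (inverseEquiv f hX hQ (D (f.toFun z)) (s z)).1) ∧
        𝒪Y.IsVectSec y fun z => (inverseEquiv f hX hQ (D (f.toFun z)) (s z)).2 := by
  constructor
  · rintro ⟨m, α, h, q, ξ, hα, hh, hq, hξ, hs⟩
    have e : ∀ᶠ z in 𝓝 y, (α z + ∑ i, h i z • pullForm f z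
        (connForm hQ.toIsCourant (D (f.toFun z)) (q i (f.toFun z))), ξ z) =
        inverseEquiv f hX hQ (D (f.toFun z)) (s z) :=
      hs.mono fun z hz => (hz.inverseEquiv_sum hX hQ _).symm
    refine ⟨IsFormSec.congr (hα.add (IsFormSec.sum Finset.univ fun i => IsFormSec.smul (hh i)
      (IsFormSec.pullForm f hX ((hD.isSec_iff hQ (q i)).1 (hq i)).1))) (e.mono fun z hz => ?_),
      hξ.congr (e.mono fun z hz => ?_)⟩
    · exact congrArg Prod.fst hz
    · exact congrArg Prod.snd hz
  · rintro ⟨hα, hξ⟩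
    obtain ⟨d, c, p, hc⟩ := hX (f.toFun y)
    refine ⟨d, _, fun i z => act (inverseEquiv f hX hQ (D (f.toFun z)) (s z)).2
      (f.comap z (c i _)), fun i x => (D x).1 (p i x), _, hα,
      fun i => hξ.act ((hc.coord_sec i).comap f), fun i => hD.self_of_nhds _ (hc.partial_sec i),
      hξ, ?_⟩
    filter_upwards [f.continuous.tendsto y |>.eventually hc.eventually] with z hz
    set a := inverseEquiv f hX hQ (D (f.toFun z)) (s z) with ha
    have hd : differential f hX z a.2 = ∑ i, act a.2 (f.comap z (c i _)) ⊗ₜ p i _ :=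
      (isDifferential_differential f hX a.2).unique f hX (isDifferential_coord f hz a.2)
    have hu : (D (f.toFun z)).1.baseChange (𝒪Y.stalk z) (differential f hX z a.2) =
        ∑ i, act a.2 (f.comap z (c i _)) ⊗ₜ (D (f.toFun z)).1 (p i _) := by
      rw [hd, map_sum]
      rfl
    have hs : s z = (inverseEquiv f hX hQ (D (f.toFun z))).symm a := by
      rw [ha, LinearEquiv.symm_apply_apply]
    rw [← hu]
    exact ⟨conn_mem_fiberProduct f _ _ (isDifferential_differential f hX a.2), hs⟩

lemma isLocallyTwisted_inverseData (hX : HasCoords 𝒪X) (hQ : Q.IsExactCourant) (y : Y) :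
    IsLocallyTwisted (inverseData f Q) y := by
  obtain ⟨D₀⟩ := nonempty_conn hX hQ (f.toFun y)
  obtain ⟨D, hD, -⟩ := exists_isConnSec hX hQ D₀
  have h : 𝒪X.IsFormSec (f.toFun y) 3 fun x => curvForm hQ.toIsCourant (D x) := by
    simpa only [curvature_eq_curvForm hQ] using hD.curvature hQ
  have h' : 𝒪Y.IsFormSec y 3 fun z => pullForm f z (curvForm hQ.toIsCourant (D (f.toFun z))) :=
    IsFormSec.pullForm (θ := fun x => curvForm hQ.toIsCourant (D x)) f hX h
  refine ⟨fun z => pullForm f z (curvForm hQ.toIsCourant (D (f.toFun z))),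
    fun z => inverseEquiv f hX hQ (D (f.toFun z)),
    fun z => isClosedForm_pullForm f hX ((isTwisted_connEquiv hQ _).isClosedForm hQ.toIsCourant),
    fun z => isTwisted_inverseEquiv f hX hQ _, h', ?_⟩
  · have h : ∀ᶠ x in 𝓝 (f.toFun y), IsConnSec Q x D := Filter.Eventually.eventually_nhds hD
    filter_upwards [f.continuous.tendsto y |>.eventually h] with z hz s
    exact isInverseSec_iff f hX hQ hz s

end InverseOperations

section InverseFunctor

variable {𝒪Y : FunctionSheaf K Y} {𝒪X : FunctionSheaf K X} (f : 𝒪Y.Map 𝒪X) {y : Y}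

lemma IsClass.inverseMap {Q P : ECA 𝒪X} (φ : ECA.Hom Q P) {s : InverseStalk f y Q.toCourantData}
    {α : 𝒪Y.Form y 1} {u : PullStalk f y (Q.stalk (f.toFun y))} {ξ : 𝒪Y.T y}
    (H : IsClass s α u ξ) : IsClass (inverseMap f y φ s) α
      ((φ.toFun (f.toFun y)).baseChange (𝒪Y.stalk y) u) ξ := by
  obtain ⟨hm, rfl⟩ := H
  exact ⟨ambientMap_mem f y φ _ hm, rfl⟩

theorem inverseImageWellDefined (hX : HasCoords 𝒪X) (hY : HasCoords 𝒪Y) :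
    InverseImageWellDefined f where
  existsUnique_pairing Q _ s t := existsUnique_isPairing f hX Q.isExact s t
  existsUnique_bracket Q _ s t := existsUnique_isBracket f hX Q.isExact s t
  isExactCourant Q :=
    isExactCourant_of_isLocallyTwisted hY (isLocallyTwisted_inverseData f hX Q.isExact)
  isCourantHom {Q P} φ :=
    { map_sec := by
        rintro y s ⟨m, α, h, q, ξ, hα, hh, hq, hξ, hs⟩
        refine ⟨m, α, h, fun i x => φ.toFun x (q i x), ξ, hα, hh,
          fun i => φ.isHom.map_sec _ _ (hq i), hξ, hs.mono fun z hz => ?_⟩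
        have h := IsClass.inverseMap f φ hz
        rw [map_sum] at h
        exact h
      map_bracket := fun y s t => by
        obtain ⟨m, α, h, q, ξ, l, β, j, p, η, hs, ht, hr⟩ :=
          isBracket_bracket f Q.isExact (y := y) s t
        refine (existsUnique_isBracket f hX P.isExact _ _).unique
          ⟨m, α, h, fun i => φ.toFun _ (q i), ξ, l, β, j, fun k => φ.toFun _ (p k), η, ?_, ?_, ?_⟩
          (isBracket_bracket f P.isExact _ _)
        · have h := IsClass.inverseMap f φ hs
          rw [map_sum] at h
          exact h
        · have h := IsClass.inverseMap f φ ht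
          rw [map_sum] at h
          exact h
        · have h := IsClass.inverseMap f φ hr
          simp only [map_add, map_sub, map_sum, LinearMap.baseChange_tmul,
            φ.isHom.map_bracket] at h
          simp only [hom_pairing hX φ]
          exact h
      map_anchor := fun y s => by
        induction s using Submodule.Quotient.induction_on with
        | _ m => rfl
      map_coanchor := fun y α => by
        refine congrArg Submodule.Quotient.mk (Subtype.ext (Prod.ext rfl (Prod.ext ?_ rfl)))
        exact map_zero (LinearMap.baseChange _ _) }

end InverseFunctor

/-! ### The inverse image of a torsor -/

namespace FunctionSheaf

variable {𝒪 : FunctionSheaf K X} {x : X}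

lemma d2_add (θ θ' : 𝒪.Form x 2) : d2 (θ + θ') = d2 θ + d2 θ' :=
  form3_ext fun ξ η ζ => by
    rw [AlternatingMap.add_apply]
    simp only [d2_apply, AlternatingMap.add_apply, act_add]
    ring

lemma IsClosedForm.add {H H' : 𝒪.Form x 3} (h : IsClosedForm H) (h' : IsClosedForm H') :
    IsClosedForm (H + H') := by
  intro a b e g
  have h1 := h a b e g
  have h2 := h' a b e g
  simp only [AlternatingMap.add_apply, act_add]
  linear_combination h1 + h2

end FunctionSheaf

section TorsorBasics

variable {𝒪 : FunctionSheaf K X} {x : X}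

/-- The `2`-form `s - s₀`. -/
def TorsorData.IsTorsor.diff {C : TorsorData 𝒪} (hC : C.IsTorsor) (s s₀ : C.stalk x) :
    𝒪.Form x 2 := (hC.simply_transitive x s₀ s).choose

lemma TorsorData.IsTorsor.diff_vadd {C : TorsorData 𝒪} (hC : C.IsTorsor) (s s₀ : C.stalk x) :
    C.vadd (hC.diff s s₀) s₀ = s := (hC.simply_transitive x s₀ s).choose_spec.1

lemma TorsorData.IsTorsor.eq_diff {C : TorsorData 𝒪} (hC : C.IsTorsor) {s s₀ : C.stalk x}
    {θ : 𝒪.Form x 2} (h : C.vadd θ s₀ = s) : θ = hC.diff s s₀ :=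
  (hC.simply_transitive x s₀ s).choose_spec.2 θ h

lemma TorsorData.IsTorsor.exists_diff_sec (hX : HasCoords 𝒪) {C : TorsorData 𝒪} (hC : C.IsTorsor)
    {s t : ∀ z, C.stalk z} (hs : C.IsSec x s) (ht : C.IsSec x t) :
    ∃ σ : ∀ z, 𝒪.Form z 2, 𝒪.IsFormSec x 2 σ ∧ ∀ᶠ z in 𝓝 x, C.vadd (σ z) (s z) = t z := by
  obtain ⟨σ, hσ, hσx⟩ := (isSheaf_form hX 2).extend x (hC.diff (t x) (s x))
  refine ⟨σ, hσ, hC.isSheaf.separated x _ _ (hC.vadd_sec x _ _ hσ hs) ht ?_⟩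
  rw [hσx, hC.diff_vadd]

/-- A morphism of torsors is an isomorphism: it is bijective because the actions are simply
transitive, and a section of the target lifts to a section near each point. -/
lemma isIso_of_torsorHom {C D : Torsor 𝒪} (m : C ⟶ D) : IsIso m := by
  let m' : Torsor.Hom C D := m
  have hC := C.isTorsor
  have hD := D.isTorsor
  have hbij : ∀ x, Function.Bijective (m'.toFun x) := fun x => by
    constructor
    · intro s t h
      have e : D.vadd (hC.diff t s) (m'.toFun x s) = m'.toFun x s := by
        rw [← m'.isHom.map_vadd, hC.diff_vadd, h]
      rw [← hC.diff_vadd t s, (hD.eq_diff e).trans (hD.eq_diff (hD.zero_vadd x _)).symm,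
        hC.zero_vadd]
    · intro u
      obtain ⟨s⟩ := hC.nonempty x
      exact ⟨C.vadd (hD.diff u (m'.toFun x s)) s, by rw [m'.isHom.map_vadd, hD.diff_vadd]⟩
  let g : ∀ x, D.stalk x → C.stalk x := fun x => (Equiv.ofBijective _ (hbij x)).symm
  have hmg : ∀ x u, m'.toFun x (g x u) = u := fun x u =>
    (Equiv.ofBijective _ (hbij x)).apply_symm_apply u
  have hgm : ∀ x s, g x (m'.toFun x s) = s := fun x s =>
    (Equiv.ofBijective _ (hbij x)).symm_apply_apply s
  have hg : IsTorsorHom D.toTorsorData C.toTorsorData g :=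
    { map_sec := fun x t ht => by
        obtain ⟨s, hs, hsx⟩ := hC.isSheaf.extend x (g x (t x))
        have e := hD.isSheaf.separated x _ _ (m'.isHom.map_sec x s hs) ht (by rw [hsx, hmg])
        refine hC.isSheaf.congr x s _ hs (e.mono fun z hz => ?_)
        rw [← hz, hgm]
      map_vadd := fun x θ u => by
        apply (hbij x).1
        rw [hmg, m'.isHom.map_vadd, hmg]
      map_curv := fun x u => by
        conv_rhs => rw [← hmg x u]
        rw [m'.isHom.map_curv] }
  exact ⟨⟨⟨g, hg⟩, Torsor.Hom.ext (funext fun x => funext fun s => hgm x s),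
    Torsor.Hom.ext (funext fun x => funext fun u => hmg x u)⟩⟩

end TorsorBasics

section TorsorPullback

variable {𝒪Y : FunctionSheaf K Y} {𝒪X : FunctionSheaf K X} (f : 𝒪Y.Map 𝒪X) {y : Y}
  (C : Torsor 𝒪X)

/-- The curvature `(θ, s) ↦ dθ + f^*c(s)` on `f^*C`. -/
def pullCurv (hX : HasCoords 𝒪X) : PullTorsorStalk f y C → 𝒪Y.Form y 3 :=
  Quot.lift (fun p => d2 p.1 + pullForm f y (C.curv p.2)) (by
    rintro _ _ ⟨θ', θ, s⟩
    change d2 (θ' + _) + _ = d2 θ' + pullForm f y (C.curv (C.vadd θ s))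
    rw [C.isTorsor.curv_vadd, pullForm_add f hX, d2_add, pullForm_d2 f hX, add_assoc])

lemma pullTorsorData_curv_mk (hX : HasCoords 𝒪X) (θ : 𝒪Y.Form y 2) (s : C.stalk (f.toFun y)) :
    (pullTorsorData f C).curv (pullMk f y C θ s) = d2 θ + pullForm f y (C.curv s) := by
  have h : ∃ θ' s', pullMk f y C θ s = pullMk f y C θ' s' ∧
      (pullTorsorData f C).curv (pullMk f y C θ s) = d2 θ' + pullForm f y (C.curv s') :=
    Classical.epsilon_spec (p := fun H => ∃ θ' s', pullMk f y C θ s = pullMk f y C θ' s' ∧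
      H = d2 θ' + pullForm f y (C.curv s')) ⟨_, θ, s, rfl, rfl⟩
  obtain ⟨θ', s', e, h⟩ := h
  rw [h]
  exact (congrArg (pullCurv f C hX) e).symm

variable {C}

/-- The form `θ + f^*(s - s₀)` with which `s₀` represents the class of `(θ, s)`. -/
def pullCoord (hX : HasCoords 𝒪X) (s₀ : C.stalk (f.toFun y)) :
    PullTorsorStalk f y C → 𝒪Y.Form y 2 :=
  Quot.lift (fun p => p.1 + pullForm f y (C.isTorsor.diff p.2 s₀)) (by
    rintro _ _ ⟨θ', θ, s⟩
    change θ' + _ + _ = θ' + pullForm f y (C.isTorsor.diff (C.vadd θ s) s₀)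
    have e : C.isTorsor.diff (C.vadd θ s) s₀ = θ + C.isTorsor.diff s s₀ :=
      (C.isTorsor.eq_diff (by rw [C.isTorsor.add_vadd, C.isTorsor.diff_vadd])).symm
    rw [e, pullForm_add f hX, add_assoc])

lemma pullMk_vadd (θ' : 𝒪Y.Form y 2) (θ : 𝒪X.Form (f.toFun y) 2) (s : C.stalk (f.toFun y)) :
    pullMk f y C θ' (C.vadd θ s) = pullMk f y C (θ' + pullForm f y θ) s :=
  (Quot.sound (PullRel.rel θ' θ s)).symm

lemma pullMk_pullCoord (hX : HasCoords 𝒪X) (s₀ : C.stalk (f.toFun y))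
    (a : PullTorsorStalk f y C) : pullMk f y C (pullCoord f hX s₀ a) s₀ = a := by
  obtain ⟨θ, s⟩ := a
  change pullMk f y C (θ + pullForm f y (C.isTorsor.diff s s₀)) s₀ = pullMk f y C θ s
  rw [← pullMk_vadd, C.isTorsor.diff_vadd]

lemma pullMk_injective (hX : HasCoords 𝒪X) (s₀ : C.stalk (f.toFun y)) :
    Function.Injective fun θ => pullMk f y C θ s₀ := by
  intro θ θ' h
  have e : ∀ θ, pullCoord f hX s₀ (pullMk f y C θ s₀) = θ := fun θ => by
    change θ + pullForm f y (C.isTorsor.diff s₀ s₀) = θ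
    rw [← C.isTorsor.eq_diff (C.isTorsor.zero_vadd _ s₀), pullForm_zero f hX, add_zero]
  rw [← e θ, ← e θ']
  exact congrArg (pullCoord f hX s₀) h

variable (C)

lemma isTorsor_pullTorsorData (hX : HasCoords 𝒪X) (hY : HasCoords 𝒪Y) :
    (pullTorsorData f C).IsTorsor where
  isSheaf :=
    { isOpen := by
        rintro y a ⟨θ, s, hθ, hs, ha⟩
        filter_upwards [hθ.eventually, f.continuous.tendsto y |>.eventually
          (C.isTorsor.isSheaf.isOpen _ s hs), ha.eventually_nhds] with z h1 h2 h3
        exact ⟨θ, s, h1, h2, h3⟩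
      congr := by
        rintro y a b ⟨θ, s, hθ, hs, ha⟩ e
        refine ⟨θ, s, hθ, hs, ?_⟩
        filter_upwards [ha, e] with z h1 h2
        rw [← h2, h1]
      extend := by
        rintro y ⟨θ, s⟩
        obtain ⟨θ, hθ, rfl⟩ := (isSheaf_form hY 2).extend y θ
        obtain ⟨s, hs, rfl⟩ := C.isTorsor.isSheaf.extend _ s
        exact ⟨fun z => pullMk f z C (θ z) (s (f.toFun z)),
          ⟨θ, s, hθ, hs, Eventually.of_forall fun _ => rfl⟩, rfl⟩
      separated := by
        rintro y a b ⟨θ, s, hθ, hs, ha⟩ ⟨θ', s', hθ', hs', hb⟩ e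
        obtain ⟨σ, hσ, hσs⟩ := C.isTorsor.exists_diff_sec hX hs hs'
        have hσs' := f.continuous.tendsto y |>.eventually hσs
        have hp := IsFormSec.pullForm f hX hσ
        have e' : ∀ᶠ z in 𝓝 y, b z =
            pullMk f z C (θ' z + pullForm f z (σ (f.toFun z))) (s (f.toFun z)) := by
          filter_upwards [hσs', hb] with z h1 h2
          rw [h2, ← h1, pullMk_vadd]
        have h0 : θ y = θ' y + pullForm f y (σ (f.toFun y)) := by
          apply pullMk_injective f hX (s (f.toFun y))
          change pullMk f y C _ _ = pullMk f y C _ _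
          rw [← ha.self_of_nhds, ← e'.self_of_nhds, e]
        filter_upwards [(isSheaf_form hY 2).separated y _ _ hθ (hθ'.add hp) h0, ha, e']
          with z h1 h2 h3
        rw [h2, h3, h1] }
  nonempty y := (C.isTorsor.nonempty (f.toFun y)).map fun s => pullMk f y C 0 s
  vadd_sec y η a hη := by
    rintro ⟨θ, s, hθ, hs, ha⟩
    refine ⟨fun z => η z + θ z, s, hη.add hθ, hs, ha.mono fun z hz => ?_⟩
    exact congrArg ((pullTorsorData f C).vadd (η z)) hz
  zero_vadd := by
    rintro y ⟨θ, s⟩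
    exact congrArg (fun θ => pullMk f y C θ s) (zero_add θ)
  add_vadd := by
    rintro y η η' ⟨θ, s⟩
    exact congrArg (fun θ => pullMk f y C θ s) (add_assoc η η' θ)
  simply_transitive y a b := by
    obtain ⟨s⟩ := C.isTorsor.nonempty (f.toFun y)
    rw [← pullMk_pullCoord f hX s a, ← pullMk_pullCoord f hX s b]
    refine ⟨pullCoord f hX s b - pullCoord f hX s a, ?_, fun η hη => ?_⟩
    · change pullMk f y C (_ - _ + _) s = _
      rw [sub_add_cancel]
    · exact eq_sub_of_add_eq (pullMk_injective f hX s hη)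
  curv_sec y a := by
    rintro ⟨θ, s, hθ, hs, ha⟩
    refine (hθ.d2.add (IsFormSec.pullForm f hX (C.isTorsor.curv_sec _ s hs))).congr
      (ha.mono fun z hz => ?_)
    rw [hz, pullTorsorData_curv_mk f C hX]
  curv_closed := by
    rintro y ⟨θ, s⟩
    change IsClosedForm ((pullTorsorData f C).curv (pullMk f y C θ s))
    rw [pullTorsorData_curv_mk f C hX]
    exact (isClosedForm_d2 θ).add (isClosedForm_pullForm f hX (C.isTorsor.curv_closed _ s))
  curv_vadd := by
    rintro y η ⟨θ, s⟩
    change (pullTorsorData f C).curv (pullMk f y C (η + θ) s) =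
      d2 η + (pullTorsorData f C).curv (pullMk f y C θ s)
    rw [pullTorsorData_curv_mk f C hX, pullTorsorData_curv_mk f C hX, d2_add, add_assoc]

theorem torsorPullbackWellDefined (hX : HasCoords 𝒪X) (hY : HasCoords 𝒪Y) :
    TorsorPullbackWellDefined f where
  existsUnique_pullForm _ _ θ := existsUnique_isFormPullback f hX θ
  curv_mk C _ θ s := pullTorsorData_curv_mk f C hX θ s
  isTorsor C := isTorsor_pullTorsorData f C hX hY

end TorsorPullback

/-! ### The inverse image of a connection -/

section ConnPullback

variable {𝒪Y : FunctionSheaf K Y} {𝒪X : FunctionSheaf K X} (f : 𝒪Y.Map 𝒪X) {y : Y}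

/-- The connection of a twisted splitting. -/
def IsTwisted.conn {𝒪 : FunctionSheaf K X} {Q : CourantData 𝒪} {x : X} {H : 𝒪.Form x 3}
    {Ψ : Q.stalk x ≃ₗ[𝒪.stalk x] 𝒪.Form x 1 × 𝒪.T x} (h : IsTwisted Q x H Ψ) : Conn Q x :=
  ⟨Ψ.symm.toLinearMap ∘ₗ LinearMap.inr _ _ _, fun ξ => by
      rw [h.anchor]
      change (Ψ (Ψ.symm (0, ξ))).2 = ξ
      rw [LinearEquiv.apply_symm_apply],
    fun ξ η => by
      rw [h.pairing]
      change (Ψ (Ψ.symm (0, ξ))).1 ![(Ψ (Ψ.symm (0, η))).2] +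
        (Ψ (Ψ.symm (0, η))).1 ![(Ψ (Ψ.symm (0, ξ))).2] = 0
      rw [LinearEquiv.apply_symm_apply, LinearEquiv.apply_symm_apply]
      exact add_zero _⟩

lemma IsTwisted.conn_apply {𝒪 : FunctionSheaf K X} {Q : CourantData 𝒪} {x : X} {H : 𝒪.Form x 3}
    {Ψ : Q.stalk x ≃ₗ[𝒪.stalk x] 𝒪.Form x 1 × 𝒪.T x} (h : IsTwisted Q x H Ψ) (ξ : 𝒪.T x) :
    Ψ (h.conn.1 ξ) = (0, ξ) := Ψ.apply_symm_apply (0, ξ)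

lemma IsTwisted.isCurvature {𝒪 : FunctionSheaf K X} {Q : CourantData 𝒪} {x : X} {H : 𝒪.Form x 3}
    {Ψ : Q.stalk x ≃ₗ[𝒪.stalk x] 𝒪.Form x 1 × 𝒪.T x} (h : IsTwisted Q x H Ψ) :
    IsCurvature h.conn H := by
  intro ξ η
  apply Ψ.injective
  rw [map_sub, h.bracket, h.coanchor, h.conn_apply, h.conn_apply, h.conn_apply]
  refine Prod.ext (form1_ext fun ζ => ?_) (sub_self _)
  change twist H 0 ξ 0 η ![ζ] - 0 = H ![ξ, η, ζ]
  rw [twist_apply]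
  simp

/-- The connection `f⁺⁺D`. -/
def connPull (hX : HasCoords 𝒪X) (Q : ECA 𝒪X) (D : Conn Q.toCourantData (f.toFun y)) :
    Conn (inverseData f Q.toCourantData) y :=
  (isTwisted_inverseEquiv f hX Q.isExact D).conn

variable (hX : HasCoords 𝒪X)

lemma isClass_connPull (Q : ECA 𝒪X) (D : Conn Q.toCourantData (f.toFun y)) {ξ : 𝒪Y.T y}
    {t : PullStalk f y (𝒪X.T (f.toFun y))} (ht : IsDifferential f y ξ t) :
    IsClass ((connPull f hX Q D).1 ξ) 0 (D.1.baseChange (𝒪Y.stalk y) t) ξ := by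
  rw [ht.unique f hX (isDifferential_differential f hX ξ)]
  exact ⟨conn_mem_fiberProduct f D 0 (isDifferential_differential f hX ξ), rfl⟩

variable (hY : HasCoords 𝒪Y)

/-- The inverse image of an exact Courant algebroid. -/
abbrev inverseECA (Q : ECA 𝒪X) : ECA 𝒪Y :=
  ⟨inverseData f Q.toCourantData, (inverseImageWellDefined f hX hY).isExactCourant Q⟩

include hY in
lemma curvature_connPull (Q : ECA 𝒪X) (D : Conn Q.toCourantData (f.toFun y)) :
    curvature (connPull f hX Q D) = pullForm f y (curvature D) := by
  rw [curvature_eq_curvForm Q.isExact]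
  exact (isTwisted_inverseEquiv f hX Q.isExact D).isCurvature.eq_curvature
    (inverseECA f hX hY Q).isExact

/-- `f⁺⁺` is compatible with the actions of `2`-forms on connections. -/
lemma connPull_vadd (Q : ECA 𝒪X) (θ : 𝒪X.Form (f.toFun y) 2)
    (D : Conn Q.toCourantData (f.toFun y)) :
    connPull f hX Q ((connData Q).vadd θ D) =
      (connData (inverseECA f hX hY Q)).vadd (pullForm f y θ) (connPull f hX Q D) := by
  refine Subtype.ext (LinearMap.ext fun ξ => ?_)
  have hT := isTwisted_inverseEquiv f hX Q.isExact D
  obtain ⟨m, h, v, H⟩ := exists_isDifferential f hX ξ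
  apply (inverseEquiv f hX Q.isExact D).injective
  have e1 : inverseEquiv f hX Q.isExact D
      (((connData (inverseECA f hX hY Q)).vadd (pullForm f y θ) (connPull f hX Q D) :
        Conn (inverseData f Q.toCourantData) y).1 ξ) = (contract ξ (pullForm f y θ), ξ) := by
    change inverseEquiv f hX Q.isExact D ((connPull f hX Q D).1 ξ +
      (inverseData f Q.toCourantData).coanchor y (contract ξ (pullForm f y θ))) = _
    refine (map_add (inverseEquiv f hX Q.isExact D) _ _).trans
      ((congrArg₂ (· + ·) (hT.conn_apply ξ) (hT.coanchor _)).trans ?_)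
    rw [Prod.mk_add_mk, zero_add, add_zero]
  rw [e1, (isClass_connPull f hX Q ((connData Q).vadd θ D) H).inverseEquiv_eq hX Q.isExact D,
    zero_add, contract_pullForm f hX H, map_sum, map_sum]
  refine congrArg (fun α => (α, ξ)) (Finset.sum_congr rfl fun i _ => ?_)
  change h i • pullForm f y (connForm Q.isExact.toIsCourant D
    (D.1 (v i) + Q.coanchor _ (contract (v i) θ))) = _
  rw [map_add, connForm_conn, connForm_coanchor, zero_add]

/-- The map `(θ, D) ↦ f⁺⁺D + π†(ι_{(·)} θ)` from `f^*C(Q)` to `C(f⁺⁺Q)`. -/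
def connPullMap (Q : ECA 𝒪X) (y : Y) :
    PullTorsorStalk f y ((connFunctor (connectionsWellDefined hX)).obj Q) →
      (connData (inverseECA f hX hY Q)).stalk y :=
  Quot.lift (fun p => (connData (inverseECA f hX hY Q)).vadd p.1 (connPull f hX Q p.2)) (by
    rintro _ _ ⟨θ', θ, D⟩
    change _ = (connData (inverseECA f hX hY Q)).vadd θ'
      (connPull f hX Q ((connData Q).vadd θ D))
    exact ((isTorsor_connData hY (inverseECA f hX hY Q)).add_vadd y θ' (pullForm f y θ) _).trans
      (congrArg ((connData (inverseECA f hX hY Q)).vadd θ') (connPull_vadd f hX hY Q θ D).symm))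

lemma isConnSec_connPull (Q : ECA 𝒪X) {D : ∀ x, Conn Q.toCourantData x}
    (hD : IsConnSec Q.toCourantData (f.toFun y) D) :
    IsConnSec (inverseData f Q.toCourantData) y fun z => connPull f hX Q (D (f.toFun z)) := by
  have h : ∀ᶠ x in 𝓝 (f.toFun y), IsConnSec Q.toCourantData x D :=
    Filter.Eventually.eventually_nhds hD
  filter_upwards [f.continuous.tendsto y |>.eventually h] with z hz ξ hξ
  refine (isInverseSec_iff f hX Q.isExact hz _).2 ?_
  have e : ∀ w, inverseEquiv f hX Q.isExact (D (f.toFun w))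
      ((connPull f hX Q (D (f.toFun w))).1 (ξ w)) = (0, ξ w) := fun w =>
    (isTwisted_inverseEquiv f hX Q.isExact (D (f.toFun w))).conn_apply (ξ w)
  simp only [e]
  exact ⟨isFormSec_zero, hξ⟩

lemma isTorsorHom_connPullMap (Q : ECA 𝒪X) :
    IsTorsorHom (pullTorsorData f ((connFunctor (connectionsWellDefined hX)).obj Q))
      (connData (inverseECA f hX hY Q)) (connPullMap f hX hY Q) where
  map_sec := by
    rintro y a ⟨θ, D, hθ, hD, ha⟩
    have hT := isTorsor_connData hY (inverseECA f hX hY Q)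
    refine hT.isSheaf.congr y _ _ (hT.vadd_sec y _ _ hθ (isConnSec_connPull f hX Q hD))
      (ha.mono fun z hz => ?_)
    rw [hz]
    rfl
  map_vadd := by
    rintro y η ⟨θ, D⟩
    exact (isTorsor_connData hY (inverseECA f hX hY Q)).add_vadd y η θ _
  map_curv := by
    rintro y ⟨θ, D⟩
    refine ((isTorsor_connData hY (inverseECA f hX hY Q)).curv_vadd y θ _).trans
      (Eq.trans ?_ (pullTorsorData_curv_mk f
        ((connFunctor (connectionsWellDefined hX)).obj Q) hX θ D).symm)
    exact congrArg (d2 θ + ·) (curvature_connPull f hX hY Q D)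

/-- The natural transformation `f^*C(Q) → C(f⁺⁺Q)`. -/
def connPullTrans : connFunctor (connectionsWellDefined hX) ⋙
    torsorPullback f (torsorPullbackWellDefined f hX hY) ⟶
      inverseImage f (inverseImageWellDefined f hX hY) ⋙
        connFunctor (connectionsWellDefined hY) where
  app Q := ⟨connPullMap f hX hY Q, isTorsorHom_connPullMap f hX hY Q⟩
  naturality Q P φ := by
    refine Torsor.Hom.ext (funext fun y => funext ?_)
    rintro ⟨θ, D⟩
    have hP := (connectionsWellDefined hX).isConnection φ D
    have e : connPull f hX P ⟨_, hP⟩ = (⟨_, (connectionsWellDefined hY).isConnection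
        ((inverseImage f (inverseImageWellDefined f hX hY)).map φ) (connPull f hX Q D)⟩ :
          Conn (inverseData f P.toCourantData) y) := by
      refine Subtype.ext (LinearMap.ext fun ξ => ?_)
      have ht := isDifferential_differential f hX ξ
      obtain ⟨_, h1⟩ := isClass_connPull f hX P ⟨_, hP⟩ ht
      obtain ⟨_, h2⟩ := IsClass.inverseMap f φ (isClass_connPull f hX Q D ht)
      refine h1.trans (Eq.trans ?_ h2.symm)
      refine congrArg Submodule.Quotient.mk (Subtype.ext (Prod.ext rfl (Prod.ext ?_ rfl)))
      exact congrArg (fun F => F (differential f hX y ξ)) 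
        (LinearMap.baseChange_comp (D.1) (φ.toFun (f.toFun y)))
    have h := ((connectionsWellDefined hY).isTorsorHom
      ((inverseImage f (inverseImageWellDefined f hX hY)).map φ)).map_vadd y θ
        (connPull f hX Q D)
    refine Eq.trans ?_ h.symm
    exact congrArg ((connData (inverseECA f hX hY P)).vadd θ) e

/-- For function sheaves with local coordinates, the square of functors commutes up to an isomorphism
which sends the class of `(0, D)` to `f⁺⁺D`, and `f⁺⁺D` has curvature `f^*c(D)`. -/
theorem exists_connFunctor_pullback_iso (hX : HasCoords 𝒪X) (hY : HasCoords 𝒪Y) :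
    ∃ (hX : ConnectionsWellDefined 𝒪X) (hY : ConnectionsWellDefined 𝒪Y)
      (hf : InverseImageWellDefined f) (ht : TorsorPullbackWellDefined f)
      (e : connFunctor hX ⋙ torsorPullback f ht ≅ inverseImage f hf ⋙ connFunctor hY),
      ∀ (Q : ECA 𝒪X) (y : Y) (D : Conn Q.toCourantData (f.toFun y)),
        let D' : Conn (inverseData f Q.toCourantData) y :=
          Torsor.Hom.toFun (e.hom.app Q) y (pullMk f y ((connFunctor hX).obj Q) 0 D)
        IsConnPullback f y D D' ∧ curvature D' = pullForm f y (curvature D) := by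
  have hiso : IsIso (connPullTrans f hX hY) := by
    have : ∀ Q, IsIso ((connPullTrans f hX hY).app Q) := fun Q => isIso_of_torsorHom _
    exact NatIso.isIso_of_isIso_app _
  refine ⟨connectionsWellDefined hX, connectionsWellDefined hY, inverseImageWellDefined f hX hY,
    torsorPullbackWellDefined f hX hY, asIso (connPullTrans f hX hY), fun Q y D => ?_⟩
  have h : Torsor.Hom.toFun ((asIso (connPullTrans f hX hY)).hom.app Q) y
      (pullMk f y ((connFunctor (connectionsWellDefined hX)).obj Q) 0 D) = connPull f hX Q D :=
    (isTorsor_connData hY (inverseECA f hX hY Q)).zero_vadd y (connPull f hX Q D)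
  intro D'
  have hD' : D' = connPull f hX Q D := h
  rw [hD']
  exact ⟨fun ξ t ht => isClass_connPull f hX Q D ht, curvature_connPull f hX hY Q D⟩

end ConnPullback

/-! ### Hadamard's lemma -/

section Hadamard

variable {𝕜 : Type} [RCLike 𝕜] {E : Type*} [NormedAddCommGroup E] [NormedSpace 𝕜 E]

/-- Differentiation under the integral sign. -/
lemma hasFDerivAt_integral_pow_smul [FiniteDimensional 𝕜 E] {G : Type*} [NormedAddCommGroup G]
    [NormedSpace ℝ G] [NormedSpace 𝕜 G] {r : ℝ} {h : E → G}
    (hh : ContDiffOn 𝕜 1 h (Metric.ball 0 r)) (k : ℕ) {v : E} (hv : v ∈ Metric.ball (0 : E) r) :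
    HasFDerivAt (fun v => ∫ t in (0 : ℝ)..1, (t : 𝕜) ^ k • h ((t : 𝕜) • v))
      (∫ t in (0 : ℝ)..1, (t : 𝕜) ^ (k + 1) • fderiv 𝕜 h ((t : 𝕜) • v)) v := by
  have : ProperSpace E := FiniteDimensional.proper 𝕜 E
  obtain ⟨ρ, hρ, hρr⟩ := exists_between (mem_ball_zero_iff.1 hv)
  have hmem : ∀ t ∈ Set.uIcc (0 : ℝ) 1, ∀ x ∈ Metric.closedBall (0 : E) ρ,
      (t : 𝕜) • x ∈ Metric.closedBall (0 : E) ρ := by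
    intro t ht x hx
    rw [Set.uIcc_of_le zero_le_one] at ht
    rw [mem_closedBall_zero_iff] at hx ⊢
    rw [norm_smul, RCLike.norm_ofReal, abs_of_nonneg ht.1]
    exact (mul_le_of_le_one_left (norm_nonneg x) ht.2).trans hx
  have hsub : Metric.closedBall (0 : E) ρ ⊆ Metric.ball 0 r := Metric.closedBall_subset_ball hρr
  have hc' : ContinuousOn (fderiv 𝕜 h) (Metric.closedBall 0 ρ) :=
    (hh.continuousOn_fderiv_of_isOpen Metric.isOpen_ball le_rfl).mono hsub
  obtain ⟨C, hC⟩ := (isCompact_closedBall (0 : E) ρ).exists_bound_of_continuousOn hc'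
  have hline : ∀ x : E, Continuous fun t : ℝ => (t : 𝕜) • x := fun x => by fun_prop
  have hpow : ∀ j : ℕ, Continuous fun t : ℝ => (t : 𝕜) ^ j := fun j => by fun_prop
  have hcont : ∀ x ∈ Metric.ball (0 : E) ρ, ContinuousOn
      (fun t : ℝ => (t : 𝕜) ^ k • h ((t : 𝕜) • x)) (Set.uIcc 0 1) := fun x hx =>
    (hpow k).continuousOn.smul
      ((hh.continuousOn.mono hsub).comp (hline x).continuousOn
        fun t ht => hmem t ht x (Metric.ball_subset_closedBall hx))
  have hcont' : ContinuousOn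
      (fun t : ℝ => (t : 𝕜) ^ (k + 1) • fderiv 𝕜 h ((t : 𝕜) • v)) (Set.uIcc 0 1) :=
    (hpow (k + 1)).continuousOn.smul (hc'.comp (g := fderiv 𝕜 h) (f := fun t : ℝ => (t : 𝕜) • v)
      (hline v).continuousOn fun t ht => hmem t ht v (mem_closedBall_zero_iff.2 hρ.le))
  have hvρ : v ∈ Metric.ball (0 : E) ρ := mem_ball_zero_iff.2 hρ
  refine intervalIntegral.hasFDerivAt_integral_of_dominated_of_fderiv_le
    (F' := fun x t => (t : 𝕜) ^ (k + 1) • fderiv 𝕜 h ((t : 𝕜) • x)) (bound := fun _ => C)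
    (Metric.isOpen_ball.mem_nhds hvρ) ?_ (hcont v hvρ).intervalIntegrable
    ((hcont'.mono Set.uIoc_subset_uIcc).aestronglyMeasurable measurableSet_uIoc) ?_ intervalIntegrable_const ?_
  · filter_upwards [Metric.isOpen_ball.mem_nhds hvρ] with x hx
    exact ((hcont x hx).mono Set.uIoc_subset_uIcc).aestronglyMeasurable measurableSet_uIoc
  · refine Eventually.of_forall fun t ht x hx => ?_
    have ht' := Set.uIoc_subset_uIcc ht
    have hb := hC _ (hmem t ht' x (Metric.ball_subset_closedBall hx))
    rw [Set.uIcc_of_le zero_le_one] at ht'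
    rw [norm_smul, norm_pow, RCLike.norm_ofReal, abs_of_nonneg ht'.1]
    exact (mul_le_of_le_one_left (norm_nonneg _) (pow_le_one₀ ht'.1 ht'.2)).trans hb
  · refine Eventually.of_forall fun t ht x hx => ?_
    have hm := hsub (hmem t (Set.uIoc_subset_uIcc ht) x (Metric.ball_subset_closedBall hx))
    have hd := ((hh.differentiableOn one_ne_zero).differentiableAt
      (Metric.isOpen_ball.mem_nhds hm)).hasFDerivAt
    have h1 : HasFDerivAt (fun x : E => (t : 𝕜) • x) ((t : 𝕜) • ContinuousLinearMap.id 𝕜 E) x :=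
      (hasFDerivAt_id x).const_smul (t : 𝕜)
    refine ((hd.comp x h1).const_smul ((t : 𝕜) ^ k)).congr_fderiv ?_
    ext w
    simp [pow_succ, mul_smul]

/-- The derivative of such an integral is again one, with the derivative of `h` in place of `h`. -/
lemma contDiffOn_integral_pow_smul.{v} {E : Type v} [NormedAddCommGroup E] [NormedSpace 𝕜 E]
    [FiniteDimensional 𝕜 E] (r : ℝ) (m : ℕ) :
    ∀ {G : Type v} [NormedAddCommGroup G] [NormedSpace ℝ G] [NormedSpace 𝕜 G] {h : E → G} (k : ℕ),
      ContDiffOn 𝕜 ((⊤ : ℕ∞) : WithTop ℕ∞) h (Metric.ball 0 r) →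
      ContDiffOn 𝕜 m (fun v => ∫ t in (0 : ℝ)..1, (t : 𝕜) ^ k • h ((t : 𝕜) • v))
        (Metric.ball 0 r) := by
  have hle : (1 : WithTop ℕ∞) ≤ ((⊤ : ℕ∞) : WithTop ℕ∞) := by exact_mod_cast le_top
  induction m with
  | zero =>
    intro G _ _ _ h k hh
    exact contDiffOn_zero.2 fun v hv =>
      (hasFDerivAt_integral_pow_smul (hh.of_le hle) k hv).continuousAt.continuousWithinAt
  | succ m ih =>
    intro G _ _ _ h k hh
    have hd := fun v hv => hasFDerivAt_integral_pow_smul (hh.of_le hle) k (v := v) hv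
    rw [Nat.cast_succ, contDiffOn_succ_iff_fderiv_of_isOpen Metric.isOpen_ball]
    refine ⟨fun v hv => (hd v hv).differentiableAt.differentiableWithinAt, by simp, ?_⟩
    exact (ih (k + 1) (hh.fderiv_of_isOpen Metric.isOpen_ball le_rfl)).congr
      fun v hv => (hd v hv).fderiv

variable [NormedAlgebra 𝕜 K]

/-- Hadamard's lemma for `C^∞` functions: `F (a + v) - F a` is the integral of the derivative of
`t ↦ F (a + t • v)`. -/
lemma exists_hadamard_smooth [FiniteDimensional 𝕜 E] {F : E → K} {a : E}
    (hF : ∀ᶠ z in 𝓝 a, ContDiffAt 𝕜 ((⊤ : ℕ∞) : WithTop ℕ∞) F z) :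
    ∃ g : E → E →L[𝕜] K, (∀ᶠ z in 𝓝 a, ContDiffAt 𝕜 ((⊤ : ℕ∞) : WithTop ℕ∞) g z) ∧
      ∀ᶠ z in 𝓝 a, F z = F a + g z (z - a) := by
  obtain ⟨r, hr, hball⟩ := Metric.eventually_nhds_iff_ball.1 hF
  set H : E → K := fun v => F (v + a) with hH
  have hHs : ContDiffOn 𝕜 ((⊤ : ℕ∞) : WithTop ℕ∞) H (Metric.ball 0 r) := fun v hv => by
    have h1 : ContDiffAt 𝕜 ((⊤ : ℕ∞) : WithTop ℕ∞) F (v + a) :=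
      hball _ (by simpa [dist_eq_norm] using hv)
    exact (h1.comp v (contDiff_id.add contDiff_const).contDiffAt).contDiffWithinAt
  have hH' := hHs.fderiv_of_isOpen (m := ((⊤ : ℕ∞) : WithTop ℕ∞)) Metric.isOpen_ball le_rfl
  set I : E → E →L[𝕜] K := fun v => ∫ t in (0 : ℝ)..1, (t : 𝕜) ^ 0 • fderiv 𝕜 H ((t : 𝕜) • v)
    with hI
  have hIs : ContDiffOn 𝕜 ((⊤ : ℕ∞) : WithTop ℕ∞) I (Metric.ball 0 r) :=
    contDiffOn_infty.2 fun m => contDiffOn_integral_pow_smul r m 0 hH'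
  have hmem : ∀ z ∈ Metric.ball a r, z - a ∈ Metric.ball (0 : E) r := fun z hz => by
    simpa [dist_eq_norm] using hz
  refine ⟨fun z => I (z - a), ?_, ?_⟩
  · filter_upwards [Metric.ball_mem_nhds a hr] with z hz
    exact (hIs.contDiffAt (Metric.isOpen_ball.mem_nhds (hmem z hz))).comp z
      (contDiff_id.sub contDiff_const).contDiffAt
  · filter_upwards [Metric.ball_mem_nhds a hr] with z hz
    have hv := hmem z hz
    set v := z - a with hvz
    have hin : ∀ t ∈ Set.uIcc (0 : ℝ) 1, (t : 𝕜) • v ∈ Metric.ball (0 : E) r := by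
      intro t ht
      rw [Set.uIcc_of_le zero_le_one] at ht
      rw [mem_ball_zero_iff] at hv ⊢
      rw [norm_smul, RCLike.norm_ofReal, abs_of_nonneg ht.1]
      exact (mul_le_of_le_one_left (norm_nonneg v) ht.2).trans_lt hv
    have hline : Continuous fun t : ℝ => (t : 𝕜) • v := by fun_prop
    have hcont : ContinuousOn (fun t : ℝ => fderiv 𝕜 H ((t : 𝕜) • v)) (Set.uIcc 0 1) :=
      hH'.continuousOn.comp hline.continuousOn hin
    have hderiv : ∀ t ∈ Set.uIcc (0 : ℝ) 1, HasDerivAt (fun t : ℝ => H ((t : 𝕜) • v))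
        (fderiv 𝕜 H ((t : 𝕜) • v) v) t := by
      intro t ht
      have h1 : HasFDerivAt H (fderiv 𝕜 H ((t : 𝕜) • v)) ((t : 𝕜) • v) :=
        ((hHs.differentiableOn (by simp)).differentiableAt
          (Metric.isOpen_ball.mem_nhds (hin t ht))).hasFDerivAt
      have h2 : HasDerivAt (fun s : 𝕜 => s • v) v (t : 𝕜) := by
        simpa using (hasDerivAt_id (t : 𝕜)).smul_const v
      have h3 : HasDerivAt (fun s : 𝕜 => H (s • v)) (fderiv 𝕜 H ((t : 𝕜) • v) v) (t : 𝕜) :=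
        HasFDerivAt.comp_hasDerivAt (l := H) (t : 𝕜) h1 h2
      have h4 : HasDerivAt (fun s : ℝ => (s : 𝕜)) 1 t := by
        simpa using (RCLike.ofRealCLM (K := 𝕜)).hasDerivAt (x := t)
      exact (HasDerivAt.scomp t h3 h4).congr_deriv (one_smul 𝕜 _)
    have hint : IntervalIntegrable (fun t : ℝ => fderiv 𝕜 H ((t : 𝕜) • v)) MeasureTheory.volume
      0 1 := hcont.intervalIntegrable
    have hFTC := intervalIntegral.integral_eq_sub_of_hasDerivAt hderiv
      (hcont.clm_apply continuousOn_const).intervalIntegrable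
    have e : I v v = H v - H 0 := by
      rw [hI]
      simp only [pow_zero, one_smul]
      rw [ContinuousLinearMap.intervalIntegral_apply hint, hFTC]
      simp
    rw [e, hH, hvz]
    simp

/-- Hadamard's lemma for analytic functions: the power series without its constant term is divided
by the variable. -/
lemma exists_hadamard_analytic {F : E → K} {a : E} (hF : AnalyticAt 𝕜 F a) :
    ∃ g : E → E →L[𝕜] K, AnalyticAt 𝕜 g a ∧ ∀ᶠ z in 𝓝 a, F z = F a + g z (z - a) := by
  obtain ⟨p, r, hp⟩ := hF
  have hrad : 0 < p.shift.radius := by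
    rw [FormalMultilinearSeries.radius_shift]
    exact hp.r_pos.trans_le hp.r_le
  have hq := (p.shift.hasFPowerSeriesOnBall hrad).comp_sub a
  rw [zero_add] at hq
  refine ⟨fun z => p.shift.sum (z - a), ⟨p.shift, _, hq⟩, ?_⟩
  filter_upwards [hp.eventually_hasSum_sub, hq.eventually_hasSum_sub] with z h1 h2
  have h3 := h2.mapL (ContinuousLinearMap.apply 𝕜 K (z - a))
  have h4 := (hasSum_nat_add_iff' 1).2 h1
  rw [Finset.sum_range_one, hp.coeff_zero] at h4
  rw [← sub_eq_iff_eq_add']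
  refine h4.unique (h3.congr_fun fun k => ?_)
  refine congrArg (p (k + 1)) (funext fun i => ?_)
  refine Fin.lastCases ?_ (fun j => ?_) i <;> simp

lemma exists_hadamard [FiniteDimensional 𝕜 E] {n : WithTop ℕ∞} (hn : n = ((⊤ : ℕ∞) : WithTop ℕ∞) ∨ n = ⊤) {F : E → K}
    {a : E} (hF : ∀ᶠ z in 𝓝 a, ContDiffAt 𝕜 n F z) :
    ∃ g : E → E →L[𝕜] K, (∀ᶠ z in 𝓝 a, ContDiffAt 𝕜 n g z) ∧
      ∀ᶠ z in 𝓝 a, F z = F a + g z (z - a) := by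
  obtain rfl | rfl := hn
  · exact exists_hadamard_smooth hF
  · obtain ⟨g, hg, e⟩ := exists_hadamard_analytic hF.self_of_nhds.analyticAt
    exact ⟨g, hg.eventually_analyticAt.mono fun z hz => hz.contDiffAt, e⟩

end Hadamard

/-! ### Local coordinates on manifolds -/

namespace FunctionSheaf

variable {𝒪 : FunctionSheaf K X} {x : X}

open Classical in
variable (𝒪) in
/-- The germ of `s` at `z`, and `0` if it does not belong to the sheaf. -/
def ofFun (s : X → K) (z : X) : 𝒪.stalk z :=
  if h : (s : Germ (𝓝 z) K) ∈ 𝒪.germs z then ⟨s, h⟩ else 0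

lemma ofFun_coe {s : X → K} (h : (s : Germ (𝓝 x) K) ∈ 𝒪.germs x) :
    (𝒪.ofFun s x).1 = (s : Germ (𝓝 x) K) :=
  congrArg Subtype.val (dif_pos h)

lemma isSec_ofFun {s : X → K} (h : (s : Germ (𝓝 x) K) ∈ 𝒪.germs x) : 𝒪.IsSec x (𝒪.ofFun s) :=
  ⟨s, (𝒪.spread x s h).mono fun _ hz => ofFun_coe hz⟩

lemma value_ofFun {s : X → K} (h : (s : Germ (𝓝 x) K) ∈ 𝒪.germs x) :
    value (𝒪.ofFun s x) = s x := by
  rw [value, ofFun_coe h]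
  rfl

end FunctionSheaf

section Manifold

variable {𝕜 : Type} [RCLike 𝕜] [NormedAlgebra 𝕜 K] {E : Type*} [NormedAddCommGroup E]
  [NormedSpace 𝕜 E] {n : WithTop ℕ∞} [ChartedSpace E X]

lemma mem_germs_iff {x : X} {s : X → K} :
    (s : Germ (𝓝 x) K) ∈ (smoothFunctions K n 𝕜 E X).germs x ↔
      ∀ᶠ z in 𝓝 x, ContMDiffAt 𝓘(𝕜, E) 𝓘(𝕜, K) n s z := by
  refine ⟨?_, fun h => ⟨s, h, rfl⟩⟩
  rintro ⟨t, ht, hst⟩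
  filter_upwards [ht, (Germ.coe_eq.mp hst).eventually_nhds] with z h1 h2
  exact h1.congr_of_eventuallyEq h2

lemma exists_rep {x : X} (g : (smoothFunctions K n 𝕜 E X).stalk x) : ∃ s : X → K,
    g.1 = (s : Germ (𝓝 x) K) ∧ ∀ᶠ z in 𝓝 x, ContMDiffAt 𝓘(𝕜, E) 𝓘(𝕜, K) n s z := by
  obtain ⟨_, s, hs, rfl⟩ := g
  exact ⟨s, rfl, hs⟩

variable (x : X)

lemma tendsto_chart_symm {z : X} (hz : z ∈ (chartAt E x).source) :
    Tendsto (chartAt E x).symm (𝓝 (chartAt E x z)) (𝓝 z) := by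
  have h := (chartAt E x).continuousAt_symm ((chartAt E x).map_source hz)
  rwa [ContinuousAt, (chartAt E x).left_inv hz] at h

lemma tendsto_chart {z : X} (hz : z ∈ (chartAt E x).source) :
    Tendsto (chartAt E x) (𝓝 z) (𝓝 (chartAt E x z)) :=
  (chartAt E x).continuousAt hz

variable (E) in
lemma eventually_mem_source {z : X} (hz : z ∈ (chartAt E x).source) :
    ∀ᶠ w in 𝓝 z, w ∈ (chartAt E x).source :=
  (chartAt E x).open_source.mem_nhds hz

variable (𝕜) in
/-- The derivative of `s` in the direction `v`, in the chart at `x`. -/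
def chartDeriv (v : E) (s : X → K) (w : X) : K :=
  fderiv 𝕜 (s ∘ (chartAt E x).symm) (chartAt E x w) v

lemma chartDeriv_congr {v : E} {s t : X → K} {z : X} (hz : z ∈ (chartAt E x).source)
    (h : s =ᶠ[𝓝 z] t) : chartDeriv 𝕜 x v s =ᶠ[𝓝 z] chartDeriv 𝕜 x v t := by
  filter_upwards [h.eventually_nhds, eventually_mem_source E x hz] with w h1 h2
  have e : s ∘ (chartAt E x).symm =ᶠ[𝓝 (chartAt E x w)] t ∘ (chartAt E x).symm :=
    (tendsto_chart_symm x h2).eventually h1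
  rw [chartDeriv, chartDeriv, e.fderiv_eq]

lemma chartDeriv_clm (L : E →L[𝕜] K) (v : E) {z : X} (hz : z ∈ (chartAt E x).source) :
    chartDeriv 𝕜 x v (L ∘ chartAt E x) z = L v := by
  have e : (L ∘ chartAt E x) ∘ (chartAt E x).symm =ᶠ[𝓝 (chartAt E x z)] L := by
    filter_upwards [(chartAt E x).open_target.mem_nhds ((chartAt E x).map_source hz)] with w hw
    simp only [Function.comp_apply, (chartAt E x).right_inv hw]
  rw [chartDeriv, e.fderiv_eq, L.fderiv]

variable [IsManifold 𝓘(𝕜, E) n X]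

lemma contMDiffAt_iff_chart {s : X → K} {z : X} (hz : z ∈ (chartAt E x).source) :
    ContMDiffAt 𝓘(𝕜, E) 𝓘(𝕜, K) n s z ↔
      ContDiffAt 𝕜 n (s ∘ (chartAt E x).symm) (chartAt E x z) := by
  rw [contMDiffAt_iff_source_of_mem_source (I := 𝓘(𝕜, E)) (x := x) hz]
  simp only [modelWithCornersSelf_coe, Set.range_id, contMDiffWithinAt_univ, mfld_simps]
  rw [contMDiffAt_iff_contDiffAt]

lemma contMDiffAt_chartDeriv (hn : n = ((⊤ : ℕ∞) : WithTop ℕ∞) ∨ n = ⊤) (v : E) {s : X → K}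
    {z : X} (hz : z ∈ (chartAt E x).source) (h : ContMDiffAt 𝓘(𝕜, E) 𝓘(𝕜, K) n s z) :
    ContMDiffAt 𝓘(𝕜, E) 𝓘(𝕜, K) n (chartDeriv 𝕜 x v s) z := by
  rw [contMDiffAt_iff_chart x hz] at h ⊢
  have hle : n + 1 ≤ n := by
    obtain rfl | rfl := hn
    · exact le_rfl
    · exact le_rfl
  refine ((h.fderiv_right hle).clm_apply (contDiffAt_const (c := v))).congr_of_eventuallyEq ?_
  filter_upwards [(chartAt E x).open_target.mem_nhds ((chartAt E x).map_source hz)] with w hw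
  simp only [Function.comp_apply, chartDeriv, (chartAt E x).right_inv hw]

lemma differentiableAt_chart (hn : n = ((⊤ : ℕ∞) : WithTop ℕ∞) ∨ n = ⊤) {s : X → K} {z : X}
    (hz : z ∈ (chartAt E x).source) (h : ContMDiffAt 𝓘(𝕜, E) 𝓘(𝕜, K) n s z) :
    DifferentiableAt 𝕜 (s ∘ (chartAt E x).symm) (chartAt E x z) :=
  ((contMDiffAt_iff_chart x hz).1 h).differentiableAt (by obtain rfl | rfl := hn <;> simp)

/-- `chartDeriv` on germs. -/
def chartDerivGerm (hn : n = ((⊤ : ℕ∞) : WithTop ℕ∞) ∨ n = ⊤) (v : E) {z : X}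
    (hz : z ∈ (chartAt E x).source) (g : (smoothFunctions K n 𝕜 E X).stalk z) :
    (smoothFunctions K n 𝕜 E X).stalk z :=
  ⟨chartDeriv 𝕜 x v (exists_rep g).choose, mem_germs_iff.2 (by
    filter_upwards [(exists_rep g).choose_spec.2, eventually_mem_source E x hz] with w h1 h2
    exact contMDiffAt_chartDeriv x hn v h2 h1)⟩

lemma chartDerivGerm_coe (hn : n = ((⊤ : ℕ∞) : WithTop ℕ∞) ∨ n = ⊤) (v : E) {z : X}
    (hz : z ∈ (chartAt E x).source) {g : (smoothFunctions K n 𝕜 E X).stalk z} {s : X → K}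
    (h : g.1 = (s : Germ (𝓝 z) K)) :
    (chartDerivGerm x hn v hz g).1 = (chartDeriv 𝕜 x v s : Germ (𝓝 z) K) :=
  Germ.coe_eq.mpr (chartDeriv_congr x hz
    (Germ.coe_eq.mp ((exists_rep g).choose_spec.1.symm.trans h)))

/-- The derivation of the stalk at `z` given by `chartDeriv`. -/
def chartDer (hn : n = ((⊤ : ℕ∞) : WithTop ℕ∞) ∨ n = ⊤) (v : E) {z : X}
    (hz : z ∈ (chartAt E x).source) : (smoothFunctions K n 𝕜 E X).Der z :=
  Derivation.mk'
    { toFun := chartDerivGerm x hn v hz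
      map_add' := fun g h => by
        obtain ⟨s, hs, hs'⟩ := exists_rep g
        obtain ⟨t, ht, ht'⟩ := exists_rep h
        have e : (g + h).1 = ((s + t : X → K) : Germ (𝓝 z) K) := congrArg₂ (· + ·) hs ht
        apply Subtype.ext
        refine (chartDerivGerm_coe x hn v hz e).trans (Eq.trans ?_ (congrArg₂ (· + ·)
          (chartDerivGerm_coe x hn v hz hs) (chartDerivGerm_coe x hn v hz ht)).symm)
        refine Germ.coe_eq.mpr ?_
        filter_upwards [hs', ht', eventually_mem_source E x hz] with w h1 h2 h3
        exact congrArg (fun F => F v) (fderiv_add (differentiableAt_chart x hn h3 h1)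
          (differentiableAt_chart x hn h3 h2))
      map_smul' := fun k g => by
        obtain ⟨s, hs, hs'⟩ := exists_rep g
        have e : (k • g).1 = ((k • s : X → K) : Germ (𝓝 z) K) := congrArg (k • ·) hs
        apply Subtype.ext
        refine (chartDerivGerm_coe x hn v hz e).trans (Eq.trans ?_ (congrArg (k • ·)
          (chartDerivGerm_coe x hn v hz hs)).symm)
        refine Germ.coe_eq.mpr ?_
        filter_upwards [hs', eventually_mem_source E x hz] with w h1 h3
        exact congrArg (fun F => F v) (fderiv_const_mul (differentiableAt_chart x hn h3 h1) k) }
    fun g h => by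
      obtain ⟨s, hs, hs'⟩ := exists_rep g
      obtain ⟨t, ht, ht'⟩ := exists_rep h
      have e : (g * h).1 = ((s * t : X → K) : Germ (𝓝 z) K) := congrArg₂ (· * ·) hs ht
      apply Subtype.ext
      refine (chartDerivGerm_coe x hn v hz e).trans (Eq.trans ?_ (congrArg₂ (· + ·)
        (congrArg₂ (· * ·) hs (chartDerivGerm_coe x hn v hz ht))
        (congrArg₂ (· * ·) ht (chartDerivGerm_coe x hn v hz hs))).symm)
      refine Germ.coe_eq.mpr ?_
      filter_upwards [hs', ht', eventually_mem_source E x hz] with w h1 h2 h3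
      refine (congrArg (fun F => F v) (fderiv_mul (differentiableAt_chart x hn h3 h1)
        (differentiableAt_chart x hn h3 h2))).trans ?_
      simp [chartDeriv, (chartAt E x).left_inv h3]

open Classical in
/-- The vector field of derivatives in the direction `v` in the chart at `x`, extended by `0`. -/
def chartVect (hn : n = ((⊤ : ℕ∞) : WithTop ℕ∞) ∨ n = ⊤) (v : E) (z : X) :
    (smoothFunctions K n 𝕜 E X).T z :=
  if hz : z ∈ (chartAt E x).source then
    ⟨chartDer x hn v hz, fun w => if hw : w ∈ (chartAt E x).source then chartDer x hn v hw else 0,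
      by
        filter_upwards [eventually_mem_source E x hz] with w hw g
        rintro ⟨s, hs⟩
        refine ⟨chartDeriv 𝕜 x v s, ?_⟩
        filter_upwards [hs, eventually_mem_source E x hw] with u h1 h2
        rw [dif_pos h2]
        exact chartDerivGerm_coe x hn v h2 h1,
      dif_pos hz⟩
  else 0

lemma act_chartVect_coe (hn : n = ((⊤ : ℕ∞) : WithTop ℕ∞) ∨ n = ⊤) (v : E) {z : X}
    (hz : z ∈ (chartAt E x).source) {g : (smoothFunctions K n 𝕜 E X).stalk z} {s : X → K}
    (h : g.1 = (s : Germ (𝓝 z) K)) :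
    (act (chartVect x hn v z) g).1 = (chartDeriv 𝕜 x v s : Germ (𝓝 z) K) := by
  exact (congrArg (fun ξ => (act ξ g).1) (dif_pos hz)).trans (chartDerivGerm_coe x hn v hz h)

lemma isVectSec_chartVect (hn : n = ((⊤ : ℕ∞) : WithTop ℕ∞) ∨ n = ⊤) (v : E) :
    (smoothFunctions K n 𝕜 E X).IsVectSec x (chartVect x hn v) := by
  filter_upwards [eventually_mem_source E x (mem_chart_source E x)] with w hw g
  rintro ⟨s, hs⟩
  refine ⟨chartDeriv 𝕜 x v s, ?_⟩
  filter_upwards [hs, eventually_mem_source E x hw] with u h1 h2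
  exact act_chartVect_coe x hn v h2 h1

/-- A smooth function of the chart is a smooth function. -/
lemma contMDiffAt_comp_chart {G : E → K} {z : X} (hz : z ∈ (chartAt E x).source)
    (hG : ContDiffAt 𝕜 n G (chartAt E x z)) :
    ContMDiffAt 𝓘(𝕜, E) 𝓘(𝕜, K) n (G ∘ chartAt E x) z := by
  rw [contMDiffAt_iff_chart x hz]
  refine hG.congr_of_eventuallyEq ?_
  filter_upwards [(chartAt E x).open_target.mem_nhds ((chartAt E x).map_source hz)] with w hw
  simp only [Function.comp_apply, (chartAt E x).right_inv hw]

lemma comp_chart_mem_germs {G : E → K} {z : X} (hz : z ∈ (chartAt E x).source)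
    (hG : ∀ᶠ w in 𝓝 (chartAt E x z), ContDiffAt 𝕜 n G w) :
    ((G ∘ chartAt E x : X → K) : Germ (𝓝 z) K) ∈ (smoothFunctions K n 𝕜 E X).germs z := by
  rw [mem_germs_iff]
  filter_upwards [(tendsto_chart x hz).eventually hG, eventually_mem_source E x hz] with w h1 h2
  exact contMDiffAt_comp_chart x h2 h1

/-- A manifold has local coordinates: the components of a chart, with Hadamard's lemma. -/
theorem hasCoords_smoothFunctions [FiniteDimensional 𝕜 E]
    (hn : n = ((⊤ : ℕ∞) : WithTop ℕ∞) ∨ n = ⊤) : HasCoords (smoothFunctions K n 𝕜 E X) := by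
  intro x
  set b := Module.finBasis 𝕜 E
  let L : Fin (Module.finrank 𝕜 E) → E →L[𝕜] K := fun i =>
    (Algebra.linearMap 𝕜 K ∘ₗ b.coord i).toContinuousLinearMap
  have hL : ∀ i v, L i v = algebraMap 𝕜 K (b.repr v i) := fun i v => rfl
  have hLmem : ∀ i, ∀ z ∈ (chartAt E x).source, ((L i ∘ chartAt E x : X → K) : Germ (𝓝 z) K) ∈
      (smoothFunctions K n 𝕜 E X).germs z := fun i z hz =>
    comp_chart_mem_germs x hz (Eventually.of_forall fun _ => (L i).contDiff.contDiffAt)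
  have hx := eventually_mem_source E x (mem_chart_source E x)
  refine ⟨_, fun i => (smoothFunctions K n 𝕜 E X).ofFun (L i ∘ chartAt E x),
    fun i => chartVect x hn (b i), fun i => isSec_ofFun (hLmem i x (mem_chart_source E x)),
    fun i => isVectSec_chartVect x hn (b i), ?_, ?_⟩
  · filter_upwards [hx] with z hz i j
    have e : (act (chartVect x hn (b i) z)
        ((smoothFunctions K n 𝕜 E X).ofFun (L j ∘ chartAt E x) z)).1 =
        ((fun _ => if i = j then 1 else 0 : X → K) : Germ (𝓝 z) K) := by
      rw [act_chartVect_coe x hn (b i) hz (ofFun_coe (hLmem j z hz))]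
      refine Germ.coe_eq.mpr ?_
      filter_upwards [eventually_mem_source E x hz] with w hw
      rw [chartDeriv_clm x _ _ hw, hL, b.repr_self, Finsupp.single_apply]
      split_ifs <;> simp
    apply Subtype.ext
    rw [e]
    split_ifs <;> rfl
  · filter_upwards [hx] with z hz g
    obtain ⟨s, hs, hs'⟩ := exists_rep g
    have hF : ∀ᶠ w in 𝓝 (chartAt E x z), ContDiffAt 𝕜 n (s ∘ (chartAt E x).symm) w := by
      filter_upwards [(tendsto_chart_symm x hz).eventually hs',
        (chartAt E x).open_target.mem_nhds ((chartAt E x).map_source hz)] with w h1 h2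
      have h3 := (contMDiffAt_iff_chart x ((chartAt E x).map_target h2)).1 h1
      rwa [(chartAt E x).right_inv h2] at h3
    obtain ⟨G, hG, e⟩ := exists_hadamard hn hF
    have hGmem : ∀ i, (((fun v => G v (b i)) ∘ chartAt E x : X → K) : Germ (𝓝 z) K) ∈
        (smoothFunctions K n 𝕜 E X).germs z := fun i =>
      comp_chart_mem_germs x hz (hG.mono fun w hw => hw.clm_apply contDiffAt_const)
    have hsmem : (s : Germ (𝓝 z) K) ∈ (smoothFunctions K n 𝕜 E X).germs z := mem_germs_iff.2 hs'
    refine ⟨s z, fun i => (smoothFunctions K n 𝕜 E X).ofFun ((fun v => G v (b i)) ∘ chartAt E x) z,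
      ?_⟩
    have hg : g = (smoothFunctions K n 𝕜 E X).ofFun s z :=
      Subtype.ext (hs.trans (ofFun_coe hsmem).symm)
    rw [hg, ← sub_eq_zero]
    -- A section is determined by its values, which are given by Hadamard's lemma.
    refine IsSec.eq_zero_of_value (g := fun w => (smoothFunctions K n 𝕜 E X).ofFun s w -
      (algebraMap K _ (s z) + ∑ i, ((smoothFunctions K n 𝕜 E X).ofFun (L i ∘ chartAt E x) w -
        algebraMap K _ (value ((smoothFunctions K n 𝕜 E X).ofFun (L i ∘ chartAt E x) z))) *
          (smoothFunctions K n 𝕜 E X).ofFun ((fun v => G v (b i)) ∘ chartAt E x) w)) ?_ ?_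
    · exact (isSec_ofFun hsmem).sub ((IsSec.const _).add (IsSec.sum _ fun i =>
        ((isSec_ofFun (hLmem i z hz)).sub (IsSec.const _)).mul (isSec_ofFun (hGmem i))))
    · filter_upwards [(tendsto_chart x hz).eventually e, eventually_mem_source E x hz,
        FunctionSheaf.spread _ z s hsmem, eventually_all.2 fun i =>
          FunctionSheaf.spread _ z _ (hGmem i)] with w h1 h2 h3 h4
      simp only [value_sub, value_add, value_sum, value_mul, value_algebraMap, value_ofFun h3,
        value_ofFun (h4 _), value_ofFun (hLmem _ w h2), value_ofFun (hLmem _ z hz)]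
      simp only [Function.comp_apply, (chartAt E x).left_inv h2, (chartAt E x).left_inv hz] at h1 ⊢
      rw [h1, sub_eq_zero]
      congr 1
      conv_lhs => rw [← b.sum_repr (chartAt E x w - chartAt E x z)]
      simp only [map_sum, map_smul, hL, map_sub, Finsupp.sub_apply, Algebra.smul_def]

end Manifold

end CourantPullback

end

open CourantPullback in
theorem mainTheorem4 {𝕜 K : Type} [RCLike 𝕜] [RCLike K] [NormedAlgebra 𝕜 K]
    {E F : Type*} [NormedAddCommGroup E] [NormedSpace 𝕜 E] [FiniteDimensional 𝕜 E]
    [NormedAddCommGroup F] [NormedSpace 𝕜 F] [FiniteDimensional 𝕜 F]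
    (n : WithTop ℕ∞) (hn : n = ((⊤ : ℕ∞) : WithTop ℕ∞) ∨ n = ⊤)
    {X Y : Type u} [TopologicalSpace X] [ChartedSpace E X] [IsManifold 𝓘(𝕜, E) n X]
    [TopologicalSpace Y] [ChartedSpace F Y] [IsManifold 𝓘(𝕜, F) n Y]
    (f : C^n⟮𝓘(𝕜, F), Y; 𝓘(𝕜, E), X⟯) :
    ∃ (hX : ConnectionsWellDefined (smoothFunctions K n 𝕜 E X))
      (hY : ConnectionsWellDefined (smoothFunctions K n 𝕜 F Y))
      (hf : InverseImageWellDefined (smoothMap K n f))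
      (ht : TorsorPullbackWellDefined (smoothMap K n f))
      (e : connFunctor hX ⋙ torsorPullback (smoothMap K n f) ht ≅
        inverseImage (smoothMap K n f) hf ⋙ connFunctor hY),
      ∀ (Q : ECA (smoothFunctions K n 𝕜 E X)) (y : Y)
        (D : Conn Q.toCourantData ((smoothMap K n f).toFun y)),
        let D' : Conn (inverseData (smoothMap K n f) Q.toCourantData) y :=
          Torsor.Hom.toFun (e.hom.app Q) y
            (pullMk (smoothMap K n f) y ((connFunctor hX).obj Q) 0 D)
        IsConnPullback (smoothMap K n f) y D D' ∧
          curvature D' = pullForm (smoothMap K n f) y (curvature D) := by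
  exact exists_connFunctor_pullback_iso (smoothMap K n f) (hasCoords_smoothFunctions hn)
    (hasCoords_smoothFunctions hn)
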